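/- Let $L/\mathbb{Q}_p$ be a finite extension with ring of integers $\mathfrak{o}$ and uniformizer $\varpi$, let $X_0$ be a smooth scheme over $\mathrm{Spec}\,\mathfrak{o}$, let $\mathcal{I}\subseteq\mathcal{O}_{X_0}$ be a coherent ideal sheaf containing $\varpi^N$, and let $\mathrm{pr}\colon X\to X_0$ be the blow-up of $\mathcal{I}$ (the relative $\mathrm{Proj}$ of $\bigoplus_n\mathcal{I}^n$). Fix integers $m\ge 0$ and $k\ge N$. For an affine open $U\subseteq X_0$ with local coordinates $x_1,\dots,x_n$ (that is, $dx_1,\dots,dx_n$ is a basis of $\Omega^1_{U/\mathfrak{o}}$), let $\partial_i$ be the dual derivations, let $\partial_i^{[\nu]}$ be the operators with $\nu!\,\partial_i^{[\nu]}=\partial_i^{\nu}$, and for $\nu\in\mathbb{N}^n$ put $\partial^{\langle\nu\rangle}=\prod_i q_{\nu_i}!\,\partial_i^{[\nu_i]}$ and $\tilde\partial^{\nu}=\varpi^{k|\nu|}\partial^{\langle\nu\rangle}$, where $q_j=\lfloor j/p^m\rfloor$. Let $\widetilde{\mathcal{D}}^{(m)}_{X_0,k}$ be the sheaf of rings of those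 operators on $\mathcal{O}_{X_0}$ that locally lie in the ring generated by the functions and the operators $\tilde\partial^{\nu}$ (so on $U$ it is the free left $\mathcal{O}_U$-module with basis the $\tilde\partial^{\nu}$). For $\mu\le\nu$ put $\left\{{\nu\atop\mu}\right\}=\prod_i \frac{q_{\nu_i}!}{q_{\mu_i}!\,q_{\nu_i-\mu_i}!}\in\mathbb{N}$. Then: (1) $\mathcal{O}_X$ can be endowed with a structure of $\mathrm{pr}^{-1}\widetilde{\mathcal{D}}^{(m)}_{X_0,k}$-module such that the map $\mathrm{pr}^{-1}\mathcal{O}_{X_0}\to\mathcal{O}_X$ is $\mathrm{pr}^{-1}\widetilde{\mathcal{D}}^{(m)}_{X_0,k}$-linear. Moreover this structure can be chosen compatible with the algebra structure of $\mathcal{O}_X$: local sections of $\mathrm{pr}^{-1}\mathcal{O}_{X_0}$ act by multiplication and, for all local coordinates as above and all local sections $s,t$ of $\mathcal{O}_X$ over an open subset of $\mathrm{pr}^{-1}(U)$, $$\tilde\partial^{\nu}(st)=\sum_{\mu\le\nu}\left\{{\nu\atop\mu}\right\}\tilde\partial^{\mu}(s)\,\tilde\partial^{\nu-\mu}(t).$$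 (2) With this action of (1), the $\mathcal{O}_X$-module $\mathrm{pr}^*\widetilde{\mathcal{D}}^{(m)}_{X_0,k}=\mathcal{O}_X\otimes_{\mathrm{pr}^{-1}\mathcal{O}_{X_0}}\mathrm{pr}^{-1}\widetilde{\mathcal{D}}^{(m)}_{X_0,k}$ carries a structure of sheaf of rings such that $s\mapsto s\otimes 1$ and $P\mapsto 1\otimes P$ are homomorphisms of sheaves of rings from $\mathcal{O}_X$ and $\mathrm{pr}^{-1}\widetilde{\mathcal{D}}^{(m)}_{X_0,k}$, left multiplication by $s\otimes 1$ is the $\mathcal{O}_X$-module structure, and for all local coordinates as above $$(1\otimes\tilde\partial^{\nu})(s\otimes 1)=\sum_{\mu\le\nu}\left\{{\nu\atop\mu}\right\}\tilde\partial^{\mu}(s)\otimes\tilde\partial^{\nu-\mu}.$$ -/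

import Mathlib

open AlgebraicGeometry CategoryTheory TopologicalSpace Opposite
open scoped Polynomial DirectSum

universe u

namespace ArithDiff

/-! ### Blow-ups -/

section Rees

variable {A : Type u} [CommRing A] (I : Ideal A)

/-- The degree `n` part `Iⁿ Tⁿ` of the Rees algebra `⨁ Iⁿ Tⁿ ⊆ A[T]`. -/
noncomputable def reesGrading (n : ℕ) : Submodule A (reesAlgebra I) where
  carrier := {f | ∀ i, i ≠ n → (f : A[X]).coeff i = 0}
  add_mem' := by
    intro a b ha hb i hi
    simp [ha i hi, hb i hi]
  zero_mem' := by simp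
  smul_mem' := by
    intro c a ha i hi
    simp [ha i hi]

/-- The degree `n` component of an element of the Rees algebra. -/
noncomputable def reesComponent (n : ℕ) (f : reesAlgebra I) : reesGrading I n :=
  ⟨⟨Polynomial.monomial n ((f : A[X]).coeff n), reesAlgebra.monomial_mem.2 (f.2 n)⟩, by
    intro i hi
    simp [Polynomial.coeff_monomial, hi.symm]⟩

instance : SetLike.GradedMonoid (reesGrading I) where
  one_mem := by
    intro i hi
    simp [Polynomial.coeff_one, hi]
  mul_mem := by
    intro m n a b ha hb i hi
    simp only [MulMemClass.coe_mul, Polynomial.coeff_mul]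
    refine Finset.sum_eq_zero fun x hx => ?_
    by_cases h : x.1 = m
    · have hx' := Finset.HasAntidiagonal.mem_antidiagonal.1 hx
      rw [hb x.2 (by rintro rfl; exact hi (by rw [← hx', h])), mul_zero]
    · rw [ha x.1 h, zero_mul]

/-- The decomposition of an element of the Rees algebra into its components. -/
noncomputable def reesDecompose (f : reesAlgebra I) : ⨁ n, reesGrading I n :=
  ∑ n ∈ (f : A[X]).support, DirectSum.of (fun n => reesGrading I n) n (reesComponent I n f)

noncomputable instance : GradedAlgebra (reesGrading I) where
  decompose' := reesDecompose I
  left_inv f := by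
    have h : DirectSum.coeAddMonoidHom (reesGrading I) (reesDecompose I f)
        = ∑ n ∈ (f : A[X]).support, (reesComponent I n f : reesAlgebra I) := by
      rw [reesDecompose, map_sum]
      simp
    rw [h]
    ext1
    rw [AddSubmonoidClass.coe_finsetSum]
    exact ((f : A[X]).as_sum_support).symm
  right_inv x := by
    have hcoeff : ∀ n (y : ⨁ n, reesGrading I n),
        (((DirectSum.coeAddMonoidHom (reesGrading I) y : reesAlgebra I) : A[X]).coeff n)
          = ((y n : reesAlgebra I) : A[X]).coeff n := by
      intro n y
      induction y using DirectSum.induction_on with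
      | zero => simp
      | of i y =>
        rw [DirectSum.coeAddMonoidHom_of]
        by_cases h : i = n
        · subst h; simp
        · rw [DirectSum.of_eq_of_ne _ _ _ (Ne.symm h), y.2 n (Ne.symm h)]; simp
      | add a b ha hb => simp_all
    refine DFinsupp.ext fun n => ?_
    ext i
    by_cases hi : i = n
    · subst hi
      have hdec : (reesDecompose I (DirectSum.coeAddMonoidHom (reesGrading I) x)) i
          = reesComponent I i (DirectSum.coeAddMonoidHom (reesGrading I) x) := by
        generalize DirectSum.coeAddMonoidHom (reesGrading I) x = g
        rw [reesDecompose, DFinsupp.finsetSum_apply]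
        by_cases hs : i ∈ (g : A[X]).support
        · rw [Finset.sum_eq_single_of_mem i hs fun j _ hj =>
            DirectSum.of_eq_of_ne _ _ _ (Ne.symm hj)]
          exact DirectSum.of_eq_same _ _
        · rw [Finset.sum_eq_zero fun j hj => DirectSum.of_eq_of_ne j i _ (by rintro rfl; exact hs hj)]
          ext
          simp [reesComponent, Polynomial.notMem_support_iff.1 hs]
      rw [hdec, ← hcoeff]
      simp [reesComponent]
    · rw [(Subtype.prop _ : _ ∈ reesGrading I n) i hi, (x n).2 i hi]

/-- The structure morphism `Proj (⨁ Iⁿ) ⟶ Spec A`. -/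
noncomputable def reesProjToSpec : Proj (reesGrading I) ⟶ Spec (.of A) :=
  Proj.toSpecZero (reesGrading I) ≫ Spec.map (CommRingCat.ofHom (algebraMap A (reesGrading I 0)))

end Rees

/-- `pr : X ⟶ Y` is the blow-up of `Y` in the quasi-coherent ideal sheaf `I`, that is, the relative
`Proj` of `⨁ Iⁿ`: over every affine open `V` of `Y` it is isomorphic to
`Proj (⨁ I(V)ⁿ) ⟶ Spec Γ(Y, V) = V`. -/
def IsBlowup {X Y : Scheme.{u}} (pr : X ⟶ Y) (I : Y.IdealSheafData) : Prop :=
  ∀ V : Y.affineOpens,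
    ∃ e : (pr ⁻¹ᵁ V.1).toScheme ≅ Proj (reesGrading (I.ideal V)),
      e.hom ≫ reesProjToSpec (I.ideal V) ≫ V.2.fromSpec = (pr ⁻¹ᵁ V.1).ι ≫ pr

/-! ### The sheaf of additive endomorphisms of the structure sheaf -/

section EndSheaf

variable (X : Scheme.{u})

/-- The ring of endomorphisms of the sheaf of abelian groups `𝒪_X|_V`. -/
def endRing (V : X.Opens) : Subring (∀ W : {W : X.Opens // W ≤ V}, AddMonoid.End Γ(X, W.1)) where
  carrier := {P | ∀ (W W' : {W : X.Opens // W ≤ V}) (h : W'.1 ≤ W.1) (s : Γ(X, W.1)),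
    P W' (X.presheaf.map (homOfLE h).op s) = X.presheaf.map (homOfLE h).op (P W s)}
  mul_mem' := by
    intro P Q hP hQ W W' h s
    change P W' (Q W' _) = X.presheaf.map (homOfLE h).op (P W (Q W s))
    rw [hQ W W' h, hP W W' h]
  one_mem' _ _ _ _ := rfl
  add_mem' := by
    intro P Q hP hQ W W' h s
    change P W' _ + Q W' _ = X.presheaf.map (homOfLE h).op (P W s + Q W s)
    rw [hP W W' h, hQ W W' h, map_add]
  zero_mem' := by
    intro W W' h s
    change 0 = X.presheaf.map (homOfLE h).op 0
    rw [map_zero]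
  neg_mem' := by
    intro P hP W W' h s
    change -(P W' _) = X.presheaf.map (homOfLE h).op (-(P W s))
    rw [hP W W' h, map_neg]

variable {X}

/-- The value of an endomorphism of `𝒪_X|_V` on sections over `W ⊆ V`. -/
def evalOp {V : X.Opens} (P : endRing X V) {W : X.Opens} (h : W ≤ V) :
    AddMonoid.End Γ(X, W) :=
  P.1 ⟨W, h⟩

/-- Restriction of endomorphisms of `𝒪_X|_V` to `V' ⊆ V`. -/
def endRing.res {V V' : X.Opens} (h : V' ≤ V) : endRing X V →+* endRing X V' where
  toFun P := ⟨fun W => P.1 ⟨W.1, W.2.trans h⟩, fun W W' hW s =>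
    P.2 ⟨W.1, W.2.trans h⟩ ⟨W'.1, W'.2.trans h⟩ hW s⟩
  map_one' := rfl
  map_mul' _ _ := rfl
  map_zero' := rfl
  map_add' _ _ := rfl

/-- Multiplication by `a ∈ Γ(X, V)`, as an endomorphism of `𝒪_X|_V`. -/
def mulOp (V : X.Opens) : Γ(X, V) →+* endRing X V where
  toFun a := ⟨fun W => AddMonoidHom.mulLeft (X.presheaf.map (homOfLE W.2).op a), by
    intro W W' h s
    change X.presheaf.map _ a * X.presheaf.map _ s
      = X.presheaf.map (homOfLE h).op (X.presheaf.map _ a * s)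
    rw [map_mul, ← CommRingCat.comp_apply, ← Functor.map_comp]
    rfl⟩
  map_one' := by
    ext W s
    change X.presheaf.map _ 1 * s = s
    rw [map_one, one_mul]
  map_mul' a b := by
    ext W s
    change X.presheaf.map _ (a * b) * s = X.presheaf.map _ a * (X.presheaf.map _ b * s)
    rw [map_mul, mul_assoc]
  map_zero' := by
    ext W s
    change X.presheaf.map _ 0 * s = 0
    rw [map_zero, zero_mul]
  map_add' a b := by
    ext W s
    change X.presheaf.map _ (a + b) * s = X.presheaf.map _ a * s + X.presheaf.map _ b * s
    rw [map_add, add_mul]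

lemma res_mulOp {V V' : X.Opens} (h : V' ≤ V) (a : Γ(X, V)) :
    endRing.res h (mulOp V a) = mulOp V' (X.presheaf.map (homOfLE h).op a) := by
  ext W s
  change X.presheaf.map _ a * s = X.presheaf.map _ (X.presheaf.map _ a) * s
  rw [← CommRingCat.comp_apply, ← Functor.map_comp]
  rfl

variable (X) in
/-- A family of subrings of the rings of endomorphisms of `𝒪_X|_V`, stable under restriction,
membership in which is local, and which contain the multiplications by functions. -/
structure LocalSubrings where
  ring : ∀ V : X.Opens, Subring (endRing X V)
  res_mem : ∀ {V V' : X.Opens} (h : V' ≤ V) (P : endRing X V),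
    P ∈ ring V → endRing.res h P ∈ ring V'
  mem_of_local : ∀ {V : X.Opens} (P : endRing X V),
    (∀ x ∈ V, ∃ (W : X.Opens) (h : W ≤ V), x ∈ W ∧ endRing.res h P ∈ ring W) → P ∈ ring V
  mulOp_mem : ∀ {V : X.Opens} (a : Γ(X, V)), mulOp V a ∈ ring V

namespace LocalSubrings

variable (S : LocalSubrings X)

/-- The presheaf of rings attached to a local family of subrings. -/
def presheaf : TopCat.Presheaf RingCat.{u} X where
  obj V := RingCat.of (S.ring V.unop)
  map {V V'} i := RingCat.ofHom
    (((endRing.res i.unop.le).comp (S.ring V.unop).subtype).codRestrict (S.ring V'.unop)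
      fun P => S.res_mem i.unop.le P.1 P.2)
  map_id _ := rfl
  map_comp _ _ := rfl

lemma presheaf_isSheaf : S.presheaf.IsSheaf := by
  rw [TopCat.Presheaf.isSheaf_iff_isSheafUniqueGluing]
  intro ι U sf hsf
  have hsf' : ∀ (i j : ι) (W : X.Opens) (hi : W ≤ U i) (hj : W ≤ U j) (s : Γ(X, W)),
      evalOp (sf i).1 hi s = evalOp (sf j).1 hj s := by
    intro i j W hi hj s
    have h := congrArg (fun P : S.ring (U i ⊓ U j) => evalOp P.1 (le_inf hi hj) s) (hsf i j)
    exact h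
  have hcov : ∀ W : {W : X.Opens // W ≤ iSup U}, W.1 ≤ ⨆ i, W.1 ⊓ U i := by
    intro W
    rw [← inf_iSup_eq]
    exact le_inf le_rfl W.2
  have hsep : ∀ (W : {W : X.Opens // W ≤ iSup U}) (s t : Γ(X, W.1)),
      (∀ i, X.presheaf.map (homOfLE (inf_le_left : W.1 ⊓ U i ≤ W.1)).op s
        = X.presheaf.map (homOfLE (inf_le_left : W.1 ⊓ U i ≤ W.1)).op t) → s = t := fun W s t h =>
    X.sheaf.eq_of_locally_eq' (fun i => W.1 ⊓ U i) W.1 (fun i => homOfLE inf_le_left) (hcov W) s t h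
  have hex : ∀ (W : {W : X.Opens // W ≤ iSup U}) (s : Γ(X, W.1)), ∃ t : Γ(X, W.1), ∀ i,
      X.presheaf.map (homOfLE (inf_le_left : W.1 ⊓ U i ≤ W.1)).op t
        = evalOp (sf i).1 (inf_le_right : W.1 ⊓ U i ≤ U i)
          (X.presheaf.map (homOfLE (inf_le_left : W.1 ⊓ U i ≤ W.1)).op s) := by
    intro W s
    refine (X.sheaf.existsUnique_gluing' (fun i => W.1 ⊓ U i) W.1 (fun i => homOfLE inf_le_left)
      (hcov W) (fun i => evalOp (sf i).1 (inf_le_right : W.1 ⊓ U i ≤ U i)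
          (X.presheaf.map (homOfLE (inf_le_left : W.1 ⊓ U i ≤ W.1)).op s)) ?_).exists
    intro i j
    have h1 := (sf i).1.2 ⟨W.1 ⊓ U i, inf_le_right⟩
      ⟨(W.1 ⊓ U i) ⊓ (W.1 ⊓ U j), inf_le_left.trans inf_le_right⟩ inf_le_left
      (X.presheaf.map (homOfLE (inf_le_left : W.1 ⊓ U i ≤ W.1)).op s)
    have h2 := (sf j).1.2 ⟨W.1 ⊓ U j, inf_le_right⟩
      ⟨(W.1 ⊓ U i) ⊓ (W.1 ⊓ U j), inf_le_right.trans inf_le_right⟩ inf_le_right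
      (X.presheaf.map (homOfLE (inf_le_left : W.1 ⊓ U j ≤ W.1)).op s)
    refine h1.symm.trans (Eq.trans ?_ h2)
    rw [← CommRingCat.comp_apply, ← CommRingCat.comp_apply, ← Functor.map_comp, ← Functor.map_comp]
    exact hsf' i j _ (inf_le_left.trans inf_le_right) (inf_le_right.trans inf_le_right) _
  choose G hG using hex
  have hadd : ∀ W s t, G W (s + t) = G W s + G W t := by
    intro W s t
    refine hsep W _ _ fun i => ?_
    rw [hG, map_add, map_add, map_add, hG, hG]
  have hloc : ∀ W i (hi : W.1 ≤ U i) s, G W s = evalOp (sf i).1 hi s := by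
    intro W i hi s
    refine hsep W _ _ fun j => ?_
    rw [hG]
    refine (hsf' j i _ inf_le_right (inf_le_left.trans hi) _).trans ?_
    exact (sf i).1.2 ⟨W.1, hi⟩ ⟨W.1 ⊓ U j, inf_le_left.trans hi⟩ inf_le_left s
  have hnat : ∀ (W W' : {W : X.Opens // W ≤ iSup U}) (h : W'.1 ≤ W.1) (s : Γ(X, W.1)),
      G W' (X.presheaf.map (homOfLE h).op s) = X.presheaf.map (homOfLE h).op (G W s) := by
    intro W W' h s
    refine hsep W' _ _ fun i => ?_
    have h0 : X.presheaf.map (homOfLE (inf_le_left : W'.1 ⊓ U i ≤ W'.1)).op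
          (X.presheaf.map (homOfLE h).op s)
        = X.presheaf.map (homOfLE (inf_le_left.trans h : W'.1 ⊓ U i ≤ W.1)).op s := by
      rw [← CommRingCat.comp_apply, ← Functor.map_comp]
      rfl
    rw [hG, h0, ← CommRingCat.comp_apply, ← Functor.map_comp]
    have h1 := (sf i).1.2 ⟨W.1 ⊓ U i, inf_le_right⟩ ⟨W'.1 ⊓ U i, inf_le_right⟩
      (inf_le_inf_right _ h) (X.presheaf.map (homOfLE (inf_le_left : W.1 ⊓ U i ≤ W.1)).op s)
    rw [← CommRingCat.comp_apply, ← Functor.map_comp] at h1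
    refine h1.trans ?_
    change X.presheaf.map _ (evalOp (sf i).1 (inf_le_right : W.1 ⊓ U i ≤ U i) _) = _
    rw [← hG W s i, ← CommRingCat.comp_apply, ← Functor.map_comp]
    rfl
  let P : endRing X (iSup U) := ⟨fun W => AddMonoidHom.mk' (G W) (hadd W), hnat⟩
  have hres : ∀ i, endRing.res (le_iSup U i) P = (sf i).1 := by
    intro i
    ext W s
    exact hloc ⟨W.1, W.2.trans (le_iSup U i)⟩ i W.2 s
  refine ⟨⟨P, S.mem_of_local P fun x hx => ?_⟩, fun i => Subtype.ext (hres i), ?_⟩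
  · obtain ⟨i, hi⟩ := Opens.mem_iSup.1 hx
    exact ⟨U i, le_iSup U i, hi, by rw [hres]; exact (sf i).2⟩
  · intro Q hQ
    refine Subtype.ext ?_
    ext W s
    refine hsep W _ _ fun i => ?_
    refine Eq.trans ?_ (hG W s i).symm
    refine (Q.1.2 W ⟨W.1 ⊓ U i, inf_le_left.trans W.2⟩ inf_le_left s).symm.trans ?_
    have h := congrArg (fun P : S.ring (U i) =>
      evalOp P.1 (inf_le_right : W.1 ⊓ U i ≤ U i) (X.presheaf.map (homOfLE inf_le_left).op s)) (hQ i)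
    exact h

/-- The sheaf of rings attached to a local family of subrings. -/
def sheaf : TopCat.Sheaf RingCat.{u} X := ⟨S.presheaf, S.presheaf_isSheaf⟩

/-- Functions act by multiplication. -/
def mulHom : X.ringCatSheaf ⟶ S.sheaf where
  hom := 
    { app V := RingCat.ofHom ((mulOp V.unop).codRestrict (S.ring V.unop) fun a => S.mulOp_mem a)
      naturality V V' i := by
        ext a
        exact Subtype.ext (res_mulOp i.unop.le a).symm }

/-- The sheaf of rings attached to a local family of subrings, as an `𝒪_X`-module by left
multiplication. -/
noncomputable def leftModule : X.Modules :=
  { val := (PresheafOfModules.restrictScalars S.mulHom.hom).obj (SheafOfModules.unit S.sheaf).val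
    isSheaf := (SheafOfModules.unit S.sheaf).isSheaf }

end LocalSubrings

variable (X) in
/-- All endomorphisms. -/
def endSubrings : LocalSubrings X where
  ring _ := ⊤
  res_mem _ _ _ := trivial
  mem_of_local _ _ := trivial
  mulOp_mem _ := trivial

variable (X) in
/-- The sheaf of rings `ℰnd(𝒪_X)` of endomorphisms of the sheaf of abelian groups `𝒪_X`. -/
def endSheaf : TopCat.Sheaf RingCat.{u} X := (endSubrings X).sheaf

end EndSheaf

/-! ### Arithmetic differential operators with congruence level -/

section Operators

variable {X : Scheme.{u}} {R : CommRingCat.{u}} (f : X ⟶ Spec R)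

/-- The structure map `R → Γ(X, V)` of an `R`-scheme `X`. -/
noncomputable def const (V : X.Opens) : R →+* Γ(X, V) :=
  ((Scheme.ΓSpecIso R).inv ≫ f.appTop ≫ X.presheaf.map (homOfLE le_top).op).hom

/-- Local coordinates `x₁, …, xₙ` on an affine open `U` of the `R`-scheme `X`, together with the
derivations `∂ᵢ` dual to `dxᵢ` and their divided powers `∂ᵢ^[ν]`, which satisfy `ν! ∂ᵢ^[ν] = ∂ᵢ^ν`.
The `∂ᵢ` (and, if `𝒪_X` is `ℤ`-torsion free, the `∂ᵢ^[ν]`) are determined by the `xᵢ`. -/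
structure Coordinates (U : X.Opens) where
  affine : IsAffineOpen U
  n : ℕ
  x : Fin n → Γ(X, U)
  span_dx : letI := (const f U).toAlgebra
    Submodule.span Γ(X, U) (Set.range fun i => KaehlerDifferential.D R Γ(X, U) (x i)) = ⊤
  pd : Fin n → endRing X U
  pd_mul : ∀ (i : Fin n) {W : X.Opens} (h : W ≤ U) (a b : Γ(X, W)),
    evalOp (pd i) h (a * b) = a * evalOp (pd i) h b + b * evalOp (pd i) h a
  pd_const : ∀ (i : Fin n) {W : X.Opens} (h : W ≤ U) (r : R), evalOp (pd i) h (const f W r) = 0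
  pd_x : ∀ i j, evalOp (pd i) le_rfl (x j) = if i = j then 1 else 0
  dpd : Fin n → ℕ → endRing X U
  factorial_mul_dpd : ∀ (i : Fin n) (ν : ℕ), ((Nat.factorial ν : ℕ) : endRing X U) * dpd i ν = pd i ^ ν

variable {f}

/-- The operator `ϖ^{k|ν|} ∂^⟨ν⟩`, where `∂^⟨ν⟩ = ∏ᵢ qᵢ! ∂ᵢ^[νᵢ]` and `qᵢ = ⌊νᵢ / p^m⌋`. -/
noncomputable def Coordinates.op {U : X.Opens} (c : Coordinates f U) (ϖ : R) (p m k : ℕ)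
    (ν : Fin c.n → ℕ) : endRing X U :=
  mulOp U (const f U ϖ ^ (k * ∑ i, ν i)) *
    (List.ofFn fun i => ((Nat.factorial (ν i / p ^ m) : ℕ) : endRing X U) * c.dpd i (ν i)).prod

variable (f)

/-- The multiplications by functions on `V` and the restrictions to `V` of the operators
`ϖ^{k|ν|} ∂^⟨ν⟩` for coordinates on an affine open containing `V`. -/
def generators (ϖ : R) (p m k : ℕ) (V : X.Opens) : Set (endRing X V) :=
  Set.range (mulOp V) ∪
    {P | ∃ (U : X.Opens) (h : V ≤ U) (c : Coordinates f U) (ν : Fin c.n → ℕ),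
      P = endRing.res h (c.op ϖ p m k ν)}

lemma res_mem_closure (ϖ : R) (p m k : ℕ) {V V' : X.Opens} (h : V' ≤ V) {P : endRing X V}
    (hP : P ∈ Subring.closure (generators f ϖ p m k V)) :
    endRing.res h P ∈ Subring.closure (generators f ϖ p m k V') := by
  have hle : Subring.closure (generators f ϖ p m k V) ≤
      (Subring.closure (generators f ϖ p m k V')).comap (endRing.res h) := by
    rw [Subring.closure_le]
    rintro Q (⟨a, rfl⟩ | ⟨U, hU, c, ν, rfl⟩)
    · exact Subring.subset_closure (Or.inl ⟨_, (res_mulOp h a).symm⟩)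
    · exact Subring.subset_closure (Or.inr ⟨U, h.trans hU, c, ν, rfl⟩)
  exact hle hP

/-- The differential operators of level `m` and congruence level `k`: the endomorphisms of
`𝒪_X|_V` that locally lie in the ring generated by the functions and the operators
`ϖ^{k|ν|} ∂^⟨ν⟩` attached to local coordinates. -/
def levelSubrings (ϖ : R) (p m k : ℕ) : LocalSubrings X where
  ring V :=
    { carrier := {P | ∀ x ∈ V, ∃ (W : X.Opens) (h : W ≤ V), x ∈ W ∧
        endRing.res h P ∈ Subring.closure (generators f ϖ p m k W)}
      mul_mem' := by
        intro P Q hP hQ x hx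
        obtain ⟨W, h, hxW, hW⟩ := hP x hx
        obtain ⟨W', h', hxW', hW'⟩ := hQ x hx
        refine ⟨W ⊓ W', inf_le_left.trans h, ⟨hxW, hxW'⟩, ?_⟩
        rw [map_mul]
        exact mul_mem (res_mem_closure f ϖ p m k inf_le_left hW)
          (res_mem_closure f ϖ p m k inf_le_right hW')
      one_mem' := by
        intro x hx
        exact ⟨V, le_rfl, hx, by rw [map_one]; exact one_mem _⟩
      add_mem' := by
        intro P Q hP hQ x hx
        obtain ⟨W, h, hxW, hW⟩ := hP x hx
        obtain ⟨W', h', hxW', hW'⟩ := hQ x hx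
        refine ⟨W ⊓ W', inf_le_left.trans h, ⟨hxW, hxW'⟩, ?_⟩
        rw [map_add]
        exact add_mem (res_mem_closure f ϖ p m k inf_le_left hW)
          (res_mem_closure f ϖ p m k inf_le_right hW')
      zero_mem' := by
        intro x hx
        exact ⟨V, le_rfl, hx, by rw [map_zero]; exact zero_mem _⟩
      neg_mem' := by
        intro P hP x hx
        obtain ⟨W, h, hxW, hW⟩ := hP x hx
        exact ⟨W, h, hxW, by rw [map_neg]; exact neg_mem hW⟩ }
  res_mem := by
    intro V V' h P hP x hx
    obtain ⟨W, hW, hxW, hP⟩ := hP x (h hx)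
    exact ⟨W ⊓ V', inf_le_right, ⟨hxW, hx⟩, res_mem_closure f ϖ p m k inf_le_left hP⟩
  mem_of_local := by
    intro V P hP x hx
    obtain ⟨W, h, hxW, hW⟩ := hP x hx
    obtain ⟨W', h', hxW', hW'⟩ := hW x hxW
    exact ⟨W', h'.trans h, hxW', hW'⟩
  mulOp_mem := by
    intro V a x hx
    exact ⟨V, le_rfl, hx, Subring.subset_closure (Or.inl ⟨a, rfl⟩)⟩

/-- The sheaf of rings `𝒟̃_{X,k}^{(m)}` of arithmetic differential operators of level `m` and
congruence level `k` on the `R`-scheme `X`. -/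
def levelSheaf (ϖ : R) (p m k : ℕ) : TopCat.Sheaf RingCat.{u} X := (levelSubrings f ϖ p m k).sheaf

/-- `𝒟̃_{X,k}^{(m)}` as an `𝒪_X`-module by left multiplication. -/
noncomputable def levelModule (ϖ : R) (p m k : ℕ) : X.Modules := (levelSubrings f ϖ p m k).leftModule

variable {f}

/-- `ϖ^{k|ν|} ∂^⟨ν⟩` as a section of `𝒟̃_{X,k}^{(m)}`. -/
noncomputable def Coordinates.levelSection {U : X.Opens} (c : Coordinates f U) (ϖ : R) (p m k : ℕ)
    (ν : Fin c.n → ℕ) : (levelSubrings f ϖ p m k).ring U :=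
  ⟨c.op ϖ p m k ν, fun _ hx =>
    ⟨U, le_rfl, hx, Subring.subset_closure (Or.inr ⟨U, le_rfl, c, ν, rfl⟩)⟩⟩

/-- The integer `∏ᵢ qᵢ! / (qᵢ'! qᵢ''!)`, where `qᵢ`, `qᵢ'`, `qᵢ''` are the quotients of `νᵢ`, `μᵢ`,
`νᵢ - μᵢ` by `p^m`. -/
def leibnizCoeff (p m : ℕ) {n : ℕ} (ν μ : Fin n → ℕ) : ℕ :=
  ∏ i, Nat.factorial (ν i / p ^ m) /
    (Nat.factorial (μ i / p ^ m) * Nat.factorial ((ν i - μ i) / p ^ m))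

end Operators

/-! ### Inverse images -/

section Pullback

variable {X Y : Scheme.{u}} (pr : X ⟶ Y)

/-- The inverse image `pr⁻¹ 𝒜` of a sheaf of rings. -/
noncomputable def inverseImage (𝒜 : TopCat.Sheaf RingCat.{u} Y) : TopCat.Sheaf RingCat.{u} X :=
  (TopCat.Sheaf.pullback RingCat.{u} pr.base).obj 𝒜

variable {pr}

/-- The map `𝒜(V) → ℬ(pr⁻¹ V)` induced by a morphism of sheaves of rings `pr⁻¹ 𝒜 ⟶ ℬ`. -/
noncomputable def onSections {𝒜 : TopCat.Sheaf RingCat.{u} Y} {ℬ : TopCat.Sheaf RingCat.{u} X}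
    (ψ : inverseImage pr 𝒜 ⟶ ℬ) (V : Y.Opens) :
    𝒜.obj.obj (op V) →+* ℬ.obj.obj (op (pr ⁻¹ᵁ V)) :=
  (((TopCat.Sheaf.pullbackPushforwardAdjunction RingCat.{u} pr.base).homEquiv 𝒜 ℬ ψ).hom.app
    (op V)).hom

/-- The section `1 ⊗ s` of `pr^* M` over `pr⁻¹ V`, for a section `s` of `M` over `V`. -/
noncomputable def pullbackSection (pr : X ⟶ Y) (M : Y.Modules) (V : Y.Opens) :
    Γ(M, V) →+ Γ((Scheme.Modules.pullback pr).obj M, pr ⁻¹ᵁ V) :=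
  (((Scheme.Modules.pullbackPushforwardAdjunction pr).unit.app M).app V).hom

end Pullback

/-! ### The structures on `X` -/

section Structures

variable {X Y : Scheme.{u}} {R : CommRingCat.{u}} (f : Y ⟶ Spec R) (ϖ : R) (p m k : ℕ) (pr : X ⟶ Y)

/-- The conditions on a `pr⁻¹ 𝒟̃_{Y,k}^{(m)}`-module structure on the sheaf of abelian groups `𝒪_X`,
given as a morphism of sheaves of rings `ρ : pr⁻¹ 𝒟̃_{Y,k}^{(m)} ⟶ ℰnd(𝒪_X)`, to be compatible with
the structure of `𝒪_X`. -/
structure IsCompatibleAction (ρ : inverseImage pr (levelSheaf f ϖ p m k) ⟶ endSheaf X) : Prop where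
  /-- The map `pr⁻¹ 𝒪_Y → 𝒪_X` is `pr⁻¹ 𝒟̃_{Y,k}^{(m)}`-linear. -/
  linear : ∀ (V : Y.Opens) (P : (levelSubrings f ϖ p m k).ring V) {W : Y.Opens} (h : W ≤ V)
    (a : Γ(Y, W)),
    evalOp (onSections ρ V P).1 (pr.preimage_mono h) (pr.app W a) = pr.app W (evalOp P.1 h a)
  /-- The action of `pr⁻¹ 𝒟̃_{Y,k}^{(m)}` extends the action of `pr⁻¹ 𝒪_Y` by multiplication. -/
  mul : ∀ (V : Y.Opens) (a : Γ(Y, V)),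
    (onSections ρ V ⟨mulOp V a, (levelSubrings f ϖ p m k).mulOp_mem a⟩).1
      = mulOp (pr ⁻¹ᵁ V) (pr.app V a)
  /-- The Leibniz formula. -/
  leibniz : ∀ {V : Y.Opens} (c : Coordinates f V) (ν : Fin c.n → ℕ) {U : X.Opens}
    (h : U ≤ pr ⁻¹ᵁ V) (s t : Γ(X, U)),
    evalOp (onSections ρ V (c.levelSection ϖ p m k ν)).1 h (s * t) =
      ∑ μ ∈ Finset.Iic ν, (leibnizCoeff p m ν μ : Γ(X, U)) *
        (evalOp (onSections ρ V (c.levelSection ϖ p m k μ)).1 h s *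
          evalOp (onSections ρ V (c.levelSection ϖ p m k (ν - μ))).1 h t)

/-- The `𝒪_X`-module `pr^* 𝒟̃_{Y,k}^{(m)} = 𝒪_X ⊗_{pr⁻¹ 𝒪_Y} pr⁻¹ 𝒟̃_{Y,k}^{(m)}`. -/
noncomputable def pullbackLevelModule : X.Modules :=
  (Scheme.Modules.pullback pr).obj (levelModule f ϖ p m k)

variable {f ϖ p m k pr}

/-- A structure of sheaf of rings on the `𝒪_X`-module `pr^* 𝒟̃_{Y,k}^{(m)}` associated with an action
`ρ` of `pr⁻¹ 𝒟̃_{Y,k}^{(m)}` on `𝒪_X`. -/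
structure PullbackRingStructure (ρ : inverseImage pr (levelSheaf f ϖ p m k) ⟶ endSheaf X) where
  /-- A sheaf of rings. -/
  ring : TopCat.Sheaf RingCat.{u} X
  /-- Its underlying sheaf of abelian groups is `pr^* 𝒟̃_{Y,k}^{(m)}`. -/
  iso : ring.obj ⋙ forget₂ RingCat.{u} Ab.{u} ≅ (pullbackLevelModule f ϖ p m k pr).presheaf
  /-- The ring homomorphism `s ↦ s ⊗ 1`. -/
  left : X.ringCatSheaf ⟶ ring
  /-- The ring homomorphism `P ↦ 1 ⊗ P`. -/
  right : inverseImage pr (levelSheaf f ϖ p m k) ⟶ ring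
  /-- Left multiplication by `s ⊗ 1` is the `𝒪_X`-module structure of `pr^* 𝒟̃_{Y,k}^{(m)}`. -/
  left_mul : ∀ (U : X.Opens) (s : Γ(X, U)) (r : ring.obj.obj (op U)),
    iso.hom.app (op U) (left.hom.app (op U) s * r : ring.obj.obj (op U)) =
      (s • (iso.hom.app (op U) r : Γ(pullbackLevelModule f ϖ p m k pr, U)) :
        Γ(pullbackLevelModule f ϖ p m k pr, U))
  /-- The homomorphism `right` is `P ↦ 1 ⊗ P`. -/
  right_eq : ∀ (V : Y.Opens) (P : (levelSubrings f ϖ p m k).ring V),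
    iso.hom.app (op (pr ⁻¹ᵁ V)) (onSections right V P) =
      pullbackSection pr (levelModule f ϖ p m k) V P
  /-- The commutation formula
  `(1 ⊗ ∂^⟨ν⟩)(s ⊗ 1) = ∑_{μ ≤ ν} {ν, μ} ∂^⟨μ⟩(s) ⊗ ∂^⟨ν - μ⟩`, with `∂^⟨ν⟩` scaled by `ϖ^{k|ν|}`. -/
  commutation : ∀ {V : Y.Opens} (c : Coordinates f V) (ν : Fin c.n → ℕ) {U : X.Opens}
    (h : U ≤ pr ⁻¹ᵁ V) (s : Γ(X, U)),
    ring.obj.map (homOfLE h).op (onSections right V (c.levelSection ϖ p m k ν)) *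
        (left.hom.app (op U) s : ring.obj.obj (op U)) =
      ∑ μ ∈ Finset.Iic ν, (leibnizCoeff p m ν μ : ring.obj.obj (op U)) *
        ((left.hom.app (op U) (evalOp (onSections ρ V (c.levelSection ϖ p m k μ)).1 h s) :
            ring.obj.obj (op U)) *
          ring.obj.map (homOfLE h).op (onSections right V (c.levelSection ϖ p m k (ν - μ))))

end Structures

end ArithDiff

namespace ArithDiff

/-! ### Valuations of factorials -/

section Factorial

variable {p : ℕ} [hp : Fact p.Prime]

/-! Where `ϖ` is invertible the ideal is trivial, so `pr` is an isomorphism over that open subset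
`Z`. The blow-up of a flat scheme is torsion free, so a function on `X` is determined by its
restriction to `pr⁻¹ Z` (`IsBlowup.isModification`). An operator on `𝒪_{X₀}` therefore has at most
one extension to `𝒪_X`, and identities between operators, such as the Leibniz formula, pass to
extensions. For assertion (1) only the existence of extensions is at stake.

Existence is checked on the charts of the blow-up, where a function is `s = b / aʳ` with `a ∈ Jⁿ`,
`b ∈ Jⁿʳ`. Since `k ≥ N`, the ideal `J` contains `ϖ^k`, so an operator `ϖ^{k|ν|} ∂^⟨ν⟩` with `ν ≠ 0`
has all its values in `J`; by the Leibniz formula these operators preserve every power of `J`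
(`Coordinates.evalOp_op_mem_pow`). Applying the Leibniz formula to `aʳ s = b` and solving for the
top term gives a quotient rule: the value at `s` is a polynomial in lower values and in quotients by
`aʳ` of elements of `Jⁿʳ`, all of which are functions on the chart (`Coordinates.extends_op`).

For assertion (2), the ring is the sheaf of subrings of `ℰnd(𝒪_X)` generated by the functions on `X`
and the extended operators, so that associativity and the commutation formula come for free. It
remains to see that `s ⊗ P ↦ s ρ(P)` is an isomorphism onto it. In coordinates the operators span it
over `𝒪_X`, because the commutation formula moves functions to the left. They are linearly
independent over `𝒪_X`, because their action on the monomials `x^μ` is triangular with cancellable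
diagonal (`DiffSystem.eq_zero_of_sum_act_op_monomial`). Hence `s ρ(P) ↦ s ⊗ P` is well defined
locally and glues to an inverse (`OperatorAction.pullbackIso`).

Both halves rest on the local structure of the operators. In one variable the product of the
operators of indices `a` and `b` is the one of index `a + b` times `q_a! q_b! (a+b choose a) /
q_{a+b}!`. This number is `p`-integral, and a `p`-adic unit if `p^m ∣ a`. So the operators span a
ring, generated over the functions by those in one variable of index at most `p^m`. In that range
they are plain divided powers scaled by `ϖ`, for which independence of the coordinates is a
statement about order (`Coordinates.closure_generators_le`). -/

lemma padicValNat_factorial_eq_sum_add (m n : ℕ) :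
    padicValNat p n.factorial =
      ∑ i ∈ Finset.Ico 1 (m + 1), n / p ^ i + padicValNat p (n / p ^ m).factorial := by
  have hb : Nat.log p n < Nat.log p n + 1 := Nat.lt_succ_self _
  have hle : Nat.log p (n / p ^ m) < Nat.log p n + 1 :=
    (Nat.log_mono_right (Nat.div_le_self _ _)).trans_lt hb
  -- Legendre's formula may be summed up to any large enough bound. With this one, the terms beyond
  -- `m` are exactly the Legendre sum of `n / p ^ m`, shifted by `m`.
  rw [padicValNat_factorial (b := m + (Nat.log p n + 1)) (by omega), padicValNat_factorial hle,
    ← Finset.sum_Ico_consecutive _ (Nat.le_add_left 1 m) (by omega : m + 1 ≤ m + (Nat.log p n + 1))]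
  congr 1
  rw [Finset.sum_Ico_eq_sum_range, Finset.sum_Ico_eq_sum_range]
  refine Finset.sum_congr (by congr 1; omega) fun i _ => ?_
  rw [Nat.div_div_eq_div_mul, ← pow_add, add_assoc]

/-- Take valuations in `(a+b)! = (a+b choose a) a! b!` and cut Legendre's formula at `m`. The two
valuations differ by the floor defects of `a + b` at `p, …, p^m`. -/
lemma padicValNat_choose_add (m a b : ℕ) :
    padicValNat p ((a / p ^ m).factorial * (b / p ^ m).factorial * (a + b).choose a)
        + ∑ i ∈ Finset.Ico 1 (m + 1), (a / p ^ i + b / p ^ i) =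
      padicValNat p ((a + b) / p ^ m).factorial + ∑ i ∈ Finset.Ico 1 (m + 1), (a + b) / p ^ i := by
  have h := congrArg (padicValNat p) (Nat.add_choose_mul_factorial_mul_factorial a b)
  rw [← Nat.choose_symm_add] at h
  have h0 : ∀ n : ℕ, n.factorial ≠ 0 := Nat.factorial_ne_zero
  have hc : (a + b).choose a ≠ 0 := (Nat.choose_pos (Nat.le_add_right a b)).ne'
  rw [padicValNat.mul (mul_ne_zero hc (h0 _)) (h0 _), padicValNat.mul hc (h0 _),
    padicValNat_factorial_eq_sum_add m a, padicValNat_factorial_eq_sum_add m b,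
    padicValNat_factorial_eq_sum_add m (a + b)] at h
  rw [padicValNat.mul (mul_ne_zero (h0 _) (h0 _)) hc, padicValNat.mul (h0 _) (h0 _),
    Finset.sum_add_distrib]
  omega

/-- Floors are superadditive. This makes the structure constants of the operators `p`-integral, so
that products stay in their span. -/
lemma padicValNat_le_choose_add (m a b : ℕ) :
    padicValNat p ((a + b) / p ^ m).factorial ≤
      padicValNat p ((a / p ^ m).factorial * (b / p ^ m).factorial * (a + b).choose a) := by
  have h := padicValNat_choose_add (p := p) m a b
  have h' : ∑ i ∈ Finset.Ico 1 (m + 1), (a / p ^ i + b / p ^ i) ≤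
      ∑ i ∈ Finset.Ico 1 (m + 1), (a + b) / p ^ i :=
    Finset.sum_le_sum fun i _ => Nat.div_add_div_le_add_div
  omega

/-- No floor defect occurs when one summand is a multiple of `p ^ m`. The structure constant is then
a `p`-adic unit and the product formula can be inverted. -/
lemma padicValNat_choose_add_le_of_dvd (m a b : ℕ) (ha : p ^ m ∣ a) :
    padicValNat p ((a / p ^ m).factorial * (b / p ^ m).factorial * (a + b).choose a) ≤
      padicValNat p ((a + b) / p ^ m).factorial := by
  have h := padicValNat_choose_add (p := p) m a b
  have h' : ∑ i ∈ Finset.Ico 1 (m + 1), (a / p ^ i + b / p ^ i) =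
      ∑ i ∈ Finset.Ico 1 (m + 1), (a + b) / p ^ i := by
    refine Finset.sum_congr rfl fun i hi => ?_
    rw [Nat.add_div_of_dvd_right]
    exact (pow_dvd_pow p (by simp at hi; omega)).trans ha
  omega

/-- The prime-to-`p` part of `b` is a unit of `R`, so only the powers of `p` obstruct divisibility.
-/
lemma exists_natCast_eq_mul {R : Type*} [CommRing R] (hR : ∀ n : ℕ, ¬ p ∣ n → IsUnit (n : R))
    {a b : ℕ} (ha : a ≠ 0) (hb : b ≠ 0) (h : padicValNat p b ≤ padicValNat p a) :
    ∃ r : R, (a : R) = r * b := by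
  obtain ⟨e, b', hb', rfl⟩ := Nat.exists_eq_pow_mul_and_not_dvd hb p hp.out.ne_one
  obtain ⟨a', rfl⟩ := (padicValNat_dvd_iff_le ha).2
    (((padicValNat_dvd_iff_le hb).1 (Dvd.intro _ rfl)).trans h)
  obtain ⟨u, hu⟩ := hR b' hb'
  refine ⟨a' * ↑u⁻¹, ?_⟩
  push_cast
  rw [← hu, mul_comm _ (u : R), mul_assoc, ← mul_assoc (↑u⁻¹ : R), Units.inv_mul, one_mul,
    mul_comm]

end Factorial

/-! ### Rings of operators generated by commuting derivations -/

/-- Commuting `R`-derivations `δ i` of a commutative `R`-algebra `A`, dual to elements `x i`, with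
divided powers `dp i ν`, as elements of a torsion free ring `E` of operators on `A`. -/
structure DiffSystem (R A E : Type*) [CommRing R] [CommRing A] [Algebra R A] [Ring E] (n : ℕ) where
  mul : A →+* E
  act : E →+* AddMonoid.End A
  act_mul : ∀ a b, act (mul a) b = a * b
  x : Fin n → A
  δ : Fin n → E
  dp : Fin n → ℕ → E
  δ_comm : ∀ i j, Commute (δ i) (δ j)
  δ_mul : ∀ i a, δ i * mul a = mul a * δ i + mul (act (δ i) a)
  δ_algebraMap : ∀ i r, act (δ i) (algebraMap R A r) = 0
  δ_x : ∀ i j, act (δ i) (x j) = if i = j then 1 else 0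
  factorial_mul_dp : ∀ i ν, ((Nat.factorial ν : ℕ) : E) * dp i ν = δ i ^ ν
  eq_zero_of_natCast_mul : ∀ ν : ℕ, ν ≠ 0 → ∀ P : E, (ν : E) * P = 0 → P = 0

namespace DiffSystem

variable {R A E : Type*} [CommRing R] [CommRing A] [Algebra R A] [Ring E] {n : ℕ}
  (S : DiffSystem R A E n)

include S in
lemma natCast_mul_cancel {ν : ℕ} (hν : ν ≠ 0) {P Q : E} (h : (ν : E) * P = ν * Q) : P = Q := by
  rw [← sub_eq_zero]
  exact S.eq_zero_of_natCast_mul ν hν _ (by rw [mul_sub, h, sub_self])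

include S in
lemma factorial_mul_cancel (ν : ℕ) {P Q : E}
    (h : ((Nat.factorial ν : ℕ) : E) * P = (Nat.factorial ν : ℕ) * Q) : P = Q :=
  S.natCast_mul_cancel (Nat.factorial_ne_zero ν) h

lemma act_natCast (ν : ℕ) (a : A) : S.act (ν : E) a = ν * a := by
  rw [← map_natCast S.mul, S.act_mul]

lemma act_mul_apply (P Q : E) (a : A) : S.act (P * Q) a = S.act P (S.act Q a) := by
  rw [map_mul]; rfl

lemma act_add_apply (P Q : E) (a : A) : S.act (P + Q) a = S.act P a + S.act Q a := by
  rw [map_add]; rfl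

lemma act_sum_apply {κ : Type*} (s : Finset κ) (P : κ → E) (a : A) :
    S.act (∑ i ∈ s, P i) a = ∑ i ∈ s, S.act (P i) a := by
  exact map_sum (AddMonoidHom.mk' (fun P => S.act P a) fun P Q => S.act_add_apply P Q a) P s

/-- After multiplication by `a! b!` this is commutation of powers of derivations, and factorials
cancel in `E`. -/
lemma dp_comm (i j : Fin n) (a b : ℕ) : Commute (S.dp i a) (S.dp j b) := by
  refine S.factorial_mul_cancel a (S.factorial_mul_cancel b ?_)
  have h := ((S.δ_comm i j).pow_pow a b).eq
  rw [← S.factorial_mul_dp, ← S.factorial_mul_dp] at h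
  have h1 : ∀ (m : ℕ) (P : E), P * (m : E) = m * P := fun m P => (Nat.cast_commute m P).symm
  calc _ = ((a.factorial : ℕ) : E) * S.dp i a * ((b.factorial : ℕ) * S.dp j b) := by
        rw [mul_assoc _ (S.dp i a), ← mul_assoc (S.dp i a), h1 _ (S.dp i a)]
        simp only [← mul_assoc]
        rw [h1]
    _ = _ := by
        rw [h, mul_assoc _ (S.dp j b), ← mul_assoc (S.dp j b), h1 _ (S.dp j b)]
        simp only [← mul_assoc]

lemma δ_mul_algebraMap (i : Fin n) (r : R) :
    Commute (S.mul (algebraMap R A r)) (S.δ i) := by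
  rw [commute_iff_eq, S.δ_mul, S.δ_algebraMap, map_zero, add_zero]

lemma dp_mul_algebraMap (i : Fin n) (a : ℕ) (r : R) :
    Commute (S.mul (algebraMap R A r)) (S.dp i a) := by
  refine S.factorial_mul_cancel a ?_
  rw [← mul_assoc, ← mul_assoc, S.factorial_mul_dp, (Nat.cast_commute _ (S.mul _)).eq, mul_assoc,
    S.factorial_mul_dp]
  exact (S.δ_mul_algebraMap i r).pow_right a

/-- Generators of the commutative ring of operators with constant coefficients. -/
def constGenerators : Set E :=
  Set.range (fun r => S.mul (algebraMap R A r)) ∪ Set.range fun q : Fin n × ℕ => S.dp q.1 q.2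

/-- The commutative ring of operators with constant coefficients. -/
def constOp : Subring E := Subring.closure S.constGenerators

instance : IsMulCommutative S.constOp := by
  refine Subring.isMulCommutative_closure ?_
  rintro _ (⟨r, rfl⟩ | ⟨q, rfl⟩) _ (⟨s, rfl⟩ | ⟨q', rfl⟩)
  · dsimp only; rw [← map_mul, ← map_mul, ← map_mul, ← map_mul, mul_comm]
  · exact S.dp_mul_algebraMap _ _ _
  · exact (S.dp_mul_algebraMap _ _ _).symm
  · exact S.dp_comm _ _ _ _

open scoped IsMulCommutative in
noncomputable instance : CommRing S.constOp := inferInstance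

/-- The constants, as operators with constant coefficients. -/
def constHom : R →+* S.constOp :=
  (S.mul.comp (algebraMap R A)).codRestrict S.constOp
    fun r => Subring.subset_closure (Or.inl ⟨r, rfl⟩)

/-- The divided powers of derivations, as operators with constant coefficients. -/
def dpc (i : Fin n) (a : ℕ) : S.constOp := ⟨S.dp i a, Subring.subset_closure (Or.inr ⟨(i, a), rfl⟩)⟩

lemma coe_dpc (i : Fin n) (a : ℕ) : (S.dpc i a : E) = S.dp i a := rfl

lemma coe_constHom (r : R) : (S.constHom r : E) = S.mul (algebraMap R A r) := rfl

lemma coe_dpc_one (i : Fin n) : (S.dpc i 1 : E) = S.δ i := by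
  have h := S.factorial_mul_dp i 1
  rwa [Nat.factorial_one, Nat.cast_one, one_mul, pow_one] at h

lemma factorial_mul_dpc (i : Fin n) (a : ℕ) :
    ((a.factorial : ℕ) : S.constOp) * S.dpc i a = S.dpc i 1 ^ a := by
  ext
  push_cast
  rw [coe_dpc, S.factorial_mul_dp, coe_dpc_one]

lemma dpc_zero (i : Fin n) : S.dpc i 0 = 1 := by
  have h := S.factorial_mul_dpc i 0
  rwa [Nat.factorial_zero, Nat.cast_one, one_mul, pow_zero] at h

lemma dpc_mul_dpc (i : Fin n) (a b : ℕ) :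
    S.dpc i a * S.dpc i b = ((a + b).choose a : ℕ) * S.dpc i (a + b) := by
  have h : ((a.factorial * b.factorial : ℕ) : S.constOp) * (S.dpc i a * S.dpc i b) =
      (a.factorial * b.factorial : ℕ) * (((a + b).choose a : ℕ) * S.dpc i (a + b)) := by
    have h1 : ((a.factorial * b.factorial : ℕ) : S.constOp) * (S.dpc i a * S.dpc i b) =
        (a.factorial * S.dpc i a) * (b.factorial * S.dpc i b) := by push_cast; ring
    have h2 : ((a.factorial * b.factorial : ℕ) : S.constOp) *
        (((a + b).choose a : ℕ) * S.dpc i (a + b)) = (a + b).factorial * S.dpc i (a + b) := by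
      rw [← Nat.add_choose_mul_factorial_mul_factorial a b, Nat.choose_symm_add]
      push_cast; ring
    rw [h1, h2, factorial_mul_dpc, factorial_mul_dpc, factorial_mul_dpc, pow_add]
  ext
  refine S.natCast_mul_cancel (mul_ne_zero a.factorial_ne_zero b.factorial_ne_zero) ?_
  simpa using congrArg Subtype.val h

/-! #### The Leibniz formula -/

/-- The map `P ⊗ Q ↦ P(a) Q`. -/
noncomputable def actTensor (a : A) : TensorProduct ℤ S.constOp S.constOp →+ E :=
  (TensorProduct.lift
    (AddMonoidHom.toIntLinearMap
      ((AddMonoidHom.mk' (fun P : S.constOp =>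
        ((AddMonoidHom.mulLeft (S.mul (S.act P a))).comp
          S.constOp.subtype.toAddMonoidHom).toIntLinearMap)
        (by
          intro P Q
          ext T
          change S.mul (S.act (P + Q : E) a) * T = S.mul (S.act P a) * T + S.mul (S.act Q a) * T
          rw [S.act_add_apply, map_add, add_mul]))))).toAddMonoidHom

lemma actTensor_tmul (a : A) (P Q : S.constOp) :
    S.actTensor a (P ⊗ₜ Q) = S.mul (S.act P a) * Q := rfl

lemma natCast_mul_actTensor (a : A) (ν : ℕ) (z : TensorProduct ℤ S.constOp S.constOp) :
    (ν : E) * S.actTensor a z = S.actTensor a (ν * z) := by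
  rw [← nsmul_eq_mul, ← nsmul_eq_mul, map_nsmul]

/-- The Leibniz rule in coproduct form: moving a derivation past `a` is multiplication by `δ ⊗ 1 + 1
⊗ δ`. The tensor square is a commutative ring, so the higher Leibniz formulas become computations
there. -/
lemma δ_mul_actTensor (i : Fin n) (a : A) (z : TensorProduct ℤ S.constOp S.constOp) :
    S.δ i * S.actTensor a z = S.actTensor a ((S.dpc i 1 ⊗ₜ 1 + 1 ⊗ₜ S.dpc i 1) * z) := by
  induction z using TensorProduct.induction_on with
  | zero => simp
  | tmul P Q =>
    rw [add_mul, map_add, Algebra.TensorProduct.tmul_mul_tmul, Algebra.TensorProduct.tmul_mul_tmul,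
      actTensor_tmul, actTensor_tmul, actTensor_tmul, one_mul, one_mul, Subring.coe_mul,
      Subring.coe_mul, coe_dpc_one, ← mul_assoc, S.δ_mul, map_mul, add_mul, add_comm, mul_assoc]
    rfl
  | add z w hz hw => rw [map_add, mul_add, mul_add, map_add, hz, hw]

lemma δ_pow_mul_actTensor (i : Fin n) (a : A) (ν : ℕ) (z : TensorProduct ℤ S.constOp S.constOp) :
    S.δ i ^ ν * S.actTensor a z =
      S.actTensor a ((S.dpc i 1 ⊗ₜ 1 + 1 ⊗ₜ S.dpc i 1) ^ ν * z) := by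
  induction ν generalizing z with
  | zero => simp
  | succ ν ih => rw [pow_succ, mul_assoc, δ_mul_actTensor, ih, pow_succ, mul_assoc]

/-- This is the binomial theorem, with the binomial coefficients absorbed into the divided powers.
-/
lemma factorial_mul_coproduct (i : Fin n) (ν : ℕ) :
    ((ν.factorial : ℕ) : TensorProduct ℤ S.constOp S.constOp) *
        ∑ q ∈ Finset.HasAntidiagonal.antidiagonal ν, S.dpc i q.1 ⊗ₜ S.dpc i q.2 =
      (S.dpc i 1 ⊗ₜ 1 + 1 ⊗ₜ S.dpc i 1) ^ ν := by
  rw [(Commute.all _ _).add_pow', Finset.mul_sum]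
  refine Finset.sum_congr rfl fun q hq => ?_
  obtain rfl := Finset.HasAntidiagonal.mem_antidiagonal.1 hq
  rw [Algebra.TensorProduct.tmul_pow, Algebra.TensorProduct.tmul_pow, one_pow, one_pow,
    Algebra.TensorProduct.tmul_mul_tmul, one_mul, mul_one, ← factorial_mul_dpc,
    ← factorial_mul_dpc, ← nsmul_eq_mul, ← nsmul_eq_mul, ← nsmul_eq_mul, TensorProduct.smul_tmul',
    TensorProduct.tmul_smul, TensorProduct.smul_tmul', smul_smul, TensorProduct.smul_tmul',
    smul_smul, ← Nat.add_choose_mul_factorial_mul_factorial q.1 q.2,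
    ← Nat.choose_symm_add]
  congr 2
  ring

lemma dp_mul_actTensor (i : Fin n) (a : A) (ν : ℕ) (z : TensorProduct ℤ S.constOp S.constOp) :
    S.dp i ν * S.actTensor a z =
      S.actTensor a ((∑ q ∈ Finset.HasAntidiagonal.antidiagonal ν, S.dpc i q.1 ⊗ₜ S.dpc i q.2) * z) := by
  refine S.factorial_mul_cancel ν ?_
  rw [← mul_assoc, S.factorial_mul_dp, S.δ_pow_mul_actTensor, natCast_mul_actTensor, ← mul_assoc,
    S.factorial_mul_coproduct]

/-- Constants commute with the derivations, so they can be absorbed into the left tensor factor, or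
into the right one as in `algebraMap_mul_actTensor'`. This distributes `ϖ^{kν} = ϖ^{kμ} ϖ^{k(ν-μ)}`
over the two factors. -/
lemma algebraMap_mul_actTensor (r : R) (a : A) (z : TensorProduct ℤ S.constOp S.constOp) :
    S.mul (algebraMap R A r) * S.actTensor a z = S.actTensor a (S.constHom r ⊗ₜ 1 * z) := by
  induction z using TensorProduct.induction_on with
  | zero => simp
  | tmul P Q =>
    rw [Algebra.TensorProduct.tmul_mul_tmul, actTensor_tmul, actTensor_tmul, one_mul,
      Subring.coe_mul, ← mul_assoc, coe_constHom, map_mul, ← map_mul, ← S.act_mul]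
    rfl
  | add z w hz hw => rw [map_add, mul_add, mul_add, map_add, hz, hw]

lemma algebraMap_mul_actTensor' (r : R) (a : A) (z : TensorProduct ℤ S.constOp S.constOp) :
    S.mul (algebraMap R A r) * S.actTensor a z = S.actTensor a (1 ⊗ₜ S.constHom r * z) := by
  induction z using TensorProduct.induction_on with
  | zero => simp
  | tmul P Q =>
    rw [Algebra.TensorProduct.tmul_mul_tmul, actTensor_tmul, actTensor_tmul, one_mul,
      Subring.coe_mul, ← mul_assoc, coe_constHom, ← map_mul, mul_comm, map_mul, mul_assoc]
  | add z w hz hw => rw [map_add, mul_add, mul_add, map_add, hz, hw]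

variable (ϖ : R) (p m k : ℕ)

/-- The operator `ϖ^{kν} q! ∂ᵢ^[ν]`, where `q = ⌊ν / p^m⌋`. -/
noncomputable def levelOp (i : Fin n) (ν : ℕ) : S.constOp :=
  S.constHom (ϖ ^ (k * ν)) * ((Nat.factorial (ν / p ^ m) : ℕ) * S.dpc i ν)

/-- Ensures that the natural number division in `leibnizCoeff` is exact. -/
lemma factorial_dvd_factorial_div {ν μ : ℕ} (h : μ ≤ ν) :
    Nat.factorial (μ / p ^ m) * Nat.factorial ((ν - μ) / p ^ m) ∣ Nat.factorial (ν / p ^ m) := by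
  refine (Nat.factorial_mul_factorial_dvd_factorial_add _ _).trans (Nat.factorial_dvd_factorial ?_)
  refine Nat.div_add_div_le_add_div.trans ?_
  rw [Nat.add_sub_cancel' h]

lemma levelOp_mul_actTensor (i : Fin n) (a : A) (ν : ℕ)
    (z : TensorProduct ℤ S.constOp S.constOp) :
    (S.levelOp ϖ p m k i ν : E) * S.actTensor a z =
      S.actTensor a ((∑ μ ∈ Finset.Iic ν, ((Nat.factorial (ν / p ^ m) /
        (Nat.factorial (μ / p ^ m) * Nat.factorial ((ν - μ) / p ^ m)) : ℕ) :
          TensorProduct ℤ S.constOp S.constOp) *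
          (S.levelOp ϖ p m k i μ ⊗ₜ S.levelOp ϖ p m k i (ν - μ))) * z) := by
  rw [levelOp, Subring.coe_mul, Subring.coe_mul, coe_dpc, mul_assoc, mul_assoc, dp_mul_actTensor,
    Subring.coe_natCast, natCast_mul_actTensor, Finset.Nat.sum_antidiagonal_eq_sum_range_succ_mk,
    Finset.sum_mul, Finset.mul_sum, map_sum, Finset.mul_sum, Finset.sum_mul, map_sum,
    Nat.range_succ_eq_Iic]
  refine Finset.sum_congr rfl fun μ hμ => ?_
  have hμ' : μ ≤ ν := Finset.mem_Iic.1 hμ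
  have h1 : (S.levelOp ϖ p m k i μ ⊗ₜ[ℤ] S.levelOp ϖ p m k i (ν - μ)) =
      (S.constHom (ϖ ^ (k * μ)) ⊗ₜ 1) * ((1 ⊗ₜ S.constHom (ϖ ^ (k * (ν - μ)))) *
        (((Nat.factorial (μ / p ^ m) * Nat.factorial ((ν - μ) / p ^ m) : ℕ) :
          TensorProduct ℤ S.constOp S.constOp) * (S.dpc i μ ⊗ₜ S.dpc i (ν - μ)))) := by
    rw [levelOp, levelOp, ← nsmul_eq_mul, ← nsmul_eq_mul, ← nsmul_eq_mul, TensorProduct.smul_tmul',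
      Algebra.TensorProduct.tmul_mul_tmul, Algebra.TensorProduct.tmul_mul_tmul, one_mul, one_mul,
      mul_smul_comm, mul_smul_comm, mul_smul_comm, TensorProduct.tmul_smul,
      TensorProduct.smul_tmul', smul_smul, mul_comm (Nat.factorial _)]
  rw [h1]
  have h2 : ∀ w u v t z : TensorProduct ℤ S.constOp S.constOp,
      w * (u * (v * t)) * z = u * (v * (w * t * z)) := by intros; ring
  rw [h2, ← algebraMap_mul_actTensor, ← algebraMap_mul_actTensor', ← mul_assoc _ _ (S.actTensor a _),
    ← map_mul, ← map_mul, ← pow_add, ← mul_add, Nat.add_sub_cancel' hμ', coe_constHom, ← mul_assoc,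
    ← mul_assoc, ← Nat.cast_mul, Nat.div_mul_cancel (factorial_dvd_factorial_div p m hμ')]

/-- The operator `ϖ^{k|ν|} ∂^⟨ν⟩`. -/
noncomputable def op (ν : Fin n → ℕ) : E :=
  S.mul (algebraMap R A ϖ ^ (k * ∑ i, ν i)) *
    (List.ofFn fun i => ((Nat.factorial (ν i / p ^ m) : ℕ) : E) * S.dp i (ν i)).prod

lemma coe_prod_levelOp (ν : Fin n → ℕ) :
    ((∏ i, S.levelOp ϖ p m k i (ν i) : S.constOp) : E) = S.op ϖ p m k ν := by
  simp only [levelOp]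
  rw [Finset.prod_mul_distrib, ← map_prod, Finset.prod_pow_eq_pow_sum, ← Finset.mul_sum,
    Subring.coe_mul, coe_constHom, map_pow, op, ← List.prod_ofFn, ← Subring.coe_subtype,
    map_list_prod, List.map_ofFn]
  rfl

lemma prod_mul_actTensor {ι : Type*} (s : Finset ι) (P : ι → S.constOp)
    (z : ι → TensorProduct ℤ S.constOp S.constOp)
    (h : ∀ i a w, (P i : E) * S.actTensor a w = S.actTensor a (z i * w)) (a : A)
    (w : TensorProduct ℤ S.constOp S.constOp) :
    ((∏ i ∈ s, P i : S.constOp) : E) * S.actTensor a w = S.actTensor a ((∏ i ∈ s, z i) * w) := by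
  classical
  induction s using Finset.induction_on generalizing w with
  | empty => simp
  | insert i s hi ih =>
    rw [Finset.prod_insert hi, Finset.prod_insert hi, Subring.coe_mul, mul_assoc, ih, h, mul_assoc]

/-- The Leibniz formula. -/
lemma op_mul_mul (ν : Fin n → ℕ) (a : A) :
    S.op ϖ p m k ν * S.mul a = ∑ μ ∈ Finset.Iic ν, (leibnizCoeff p m ν μ : E) *
      (S.mul (S.act (S.op ϖ p m k μ) a) * S.op ϖ p m k (ν - μ)) := by
  -- Starting from `1`, the operator acts by the product of the one-variable coproducts. Expanding
  -- this product of sums gives a sum over the box of all `μ ≤ ν`.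
  have h0 : S.mul a = S.actTensor a 1 := by
    rw [Algebra.TensorProduct.one_def, actTensor_tmul]; simp
  rw [h0, ← coe_prod_levelOp, prod_mul_actTensor _ _ _ _
    (fun i a w => S.levelOp_mul_actTensor ϖ p m k i a (ν i) w), mul_one,
    Finset.prod_univ_sum, map_sum]
  refine Finset.sum_congr rfl fun μ _ => ?_
  rw [Finset.prod_mul_distrib, ← Nat.cast_prod, ← leibnizCoeff, ← natCast_mul_actTensor]
  congr 1
  rw [← coe_prod_levelOp, ← coe_prod_levelOp, ← actTensor_tmul]
  congr 1
  -- Pure tensors are written as products of images under two ring homomorphisms, so that a product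
  -- of tensors is the tensor of the products.
  have h1 : ∀ P Q : S.constOp, P ⊗ₜ[ℤ] Q =
      Algebra.TensorProduct.includeLeft (R := ℤ) (S := ℤ) (B := S.constOp) P *
        Algebra.TensorProduct.includeRight (R := ℤ) (A := S.constOp) Q := by
    intro P Q
    simp
  simp only [h1]
  rw [Finset.prod_mul_distrib, ← map_prod, ← map_prod]
  rfl

lemma act_op_mul (ν : Fin n → ℕ) (a b : A) :
    S.act (S.op ϖ p m k ν) (a * b) = ∑ μ ∈ Finset.Iic ν, (leibnizCoeff p m ν μ : A) *
      (S.act (S.op ϖ p m k μ) a * S.act (S.op ϖ p m k (ν - μ)) b) := by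
  have h := congrArg (fun P => S.act P b) (S.op_mul_mul ϖ p m k ν a)
  simp only [act_mul_apply, act_sum_apply, S.act_mul, act_natCast] at h
  exact h

end DiffSystem

/-- The linear combination `∑ a_i B_i` of operators, where coefficients act by `μ`. -/
noncomputable def lcomb {A E κ : Type*} [CommRing A] [Ring E] (μ : A →+* E) (B : κ → E) :
    (κ →₀ A) →+ E :=
  Finsupp.liftAddHom fun i => (AddMonoidHom.mulRight (B i)).comp μ.toAddMonoidHom

/-! ### Linear combinations of operators with functions as coefficients -/

section lcomb

variable {A E κ : Type*} [CommRing A] [Ring E] (μ : A →+* E) (B : κ → E)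

lemma lcomb_apply (b : κ →₀ A) : lcomb μ B b = b.sum fun i a => μ a * B i := rfl

lemma lcomb_single (i : κ) (a : A) : lcomb μ B (Finsupp.single i a) = μ a * B i :=
  Finsupp.liftAddHom_apply_single _ _ _

lemma mul_mem_range_lcomb (i : κ) (a : A) : μ a * B i ∈ (lcomb μ B).range :=
  ⟨Finsupp.single i a, lcomb_single μ B i a⟩

lemma mul_mem_range_lcomb_of_mem (a : A) {P : E} (hP : P ∈ (lcomb μ B).range) :
    μ a * P ∈ (lcomb μ B).range := by
  obtain ⟨b, rfl⟩ := hP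
  induction b using Finsupp.induction_linear with
  | zero => simp
  | add b c hb hc => rw [map_add, mul_add]; exact add_mem hb hc
  | single i c => rw [lcomb_single, ← mul_assoc, ← map_mul]; exact mul_mem_range_lcomb μ B i _

lemma range_lcomb_induction {C : E → Prop} (zero : C 0) (add : ∀ P Q, C P → C Q → C (P + Q))
    (mul : ∀ i a, C (μ a * B i)) {P : E} (hP : P ∈ (lcomb μ B).range) : C P := by
  obtain ⟨b, rfl⟩ := hP
  induction b using Finsupp.induction_linear with
  | zero => simpa using zero
  | add b c hb hc => rw [map_add]; exact add _ _ hb hc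
  | single i c => rw [lcomb_single]; exact mul _ _

end lcomb

namespace DiffSystem

variable {R A E : Type*} [CommRing R] [CommRing A] [Algebra R A] [Ring E] {n : ℕ}
  (S : DiffSystem R A E n) (ϖ : R) (p m k : ℕ)

/-! #### The ring spanned by the operators `ϖ^{k|ν|} ∂^⟨ν⟩` -/

lemma levelOp_zero (i : Fin n) : S.levelOp ϖ p m k i 0 = 1 := by
  simp [levelOp, dpc_zero]

lemma op_zero : S.op ϖ p m k 0 = 1 := by
  rw [← coe_prod_levelOp]
  simp [levelOp_zero]

lemma levelOp_mul_levelOp_aux (i : Fin n) (a b : ℕ) :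
    S.levelOp ϖ p m k i a * S.levelOp ϖ p m k i b = S.constHom (ϖ ^ (k * (a + b))) *
      (((a / p ^ m).factorial * (b / p ^ m).factorial * (a + b).choose a : ℕ) *
        S.dpc i (a + b)) := by
  have h := S.dpc_mul_dpc i a b
  rw [levelOp, levelOp, mul_add, pow_add, map_mul]
  push_cast
  linear_combination S.constHom (ϖ ^ (k * a)) * S.constHom (ϖ ^ (k * b)) *
    ((a / p ^ m).factorial : S.constOp) * ((b / p ^ m).factorial : S.constOp) * h

variable [Fact p.Prime] (hR : ∀ ν : ℕ, ¬ p ∣ ν → IsUnit (ν : R))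
include hR

/-- Here `r` represents `q_a! q_b! (a+b choose a) / q_{a+b}!`, which is `p`-integral. In
`levelOp_add` it represents the inverse. -/
lemma levelOp_mul_levelOp (i : Fin n) (a b : ℕ) : ∃ r : R,
    S.levelOp ϖ p m k i a * S.levelOp ϖ p m k i b = S.constHom r * S.levelOp ϖ p m k i (a + b) := by
  obtain ⟨r, hr⟩ := exists_natCast_eq_mul hR
    (mul_ne_zero (mul_ne_zero (Nat.factorial_ne_zero _) (Nat.factorial_ne_zero _))
      (Nat.choose_pos (Nat.le_add_right a b)).ne') (Nat.factorial_ne_zero _)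
    (padicValNat_le_choose_add (p := p) m a b)
  refine ⟨r, ?_⟩
  have h := congrArg S.constHom hr
  rw [map_natCast, map_mul, map_natCast] at h
  rw [levelOp_mul_levelOp_aux, h, levelOp]
  ring

lemma levelOp_add (i : Fin n) (a b : ℕ) (ha : p ^ m ∣ a) : ∃ r : R,
    S.levelOp ϖ p m k i (a + b) =
      S.constHom r * (S.levelOp ϖ p m k i a * S.levelOp ϖ p m k i b) := by
  obtain ⟨r, hr⟩ := exists_natCast_eq_mul hR (Nat.factorial_ne_zero _)
    (mul_ne_zero (mul_ne_zero (Nat.factorial_ne_zero _) (Nat.factorial_ne_zero _))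
      (Nat.choose_pos (Nat.le_add_right a b)).ne')
    (padicValNat_choose_add_le_of_dvd (p := p) m a b ha)
  refine ⟨r, ?_⟩
  have h := congrArg S.constHom hr
  rw [map_natCast, map_mul, map_natCast] at h
  rw [levelOp_mul_levelOp_aux, levelOp, h]
  ring

lemma op_mul_op (ν μ : Fin n → ℕ) : ∃ r : R,
    S.op ϖ p m k ν * S.op ϖ p m k μ = S.mul (algebraMap R A r) * S.op ϖ p m k (ν + μ) := by
  choose r hr using fun i => S.levelOp_mul_levelOp ϖ p m k hR i (ν i) (μ i)
  refine ⟨∏ i, r i, ?_⟩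
  rw [← coe_prod_levelOp, ← coe_prod_levelOp, ← Subring.coe_mul, ← Finset.prod_mul_distrib,
    Finset.prod_congr rfl fun i _ => hr i, Finset.prod_mul_distrib, ← map_prod, Subring.coe_mul,
    coe_constHom]
  congr 1
  exact S.coe_prod_levelOp ϖ p m k (ν + μ)

/-- The Leibniz formula moves the inner function to the left, after which `op_mul_op` merges the two
adjacent operators. -/
lemma mul_mem_range_op {P Q : E} (hP : P ∈ (lcomb S.mul (S.op ϖ p m k)).range)
    (hQ : Q ∈ (lcomb S.mul (S.op ϖ p m k)).range) :
    P * Q ∈ (lcomb S.mul (S.op ϖ p m k)).range := by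
  refine range_lcomb_induction (C := fun P => P * Q ∈ (lcomb S.mul (S.op ϖ p m k)).range) _ _
    (by simp) (fun P P' h h' => by rw [add_mul]; exact add_mem h h') (fun ν a => ?_) hP
  refine range_lcomb_induction (C := fun Q => S.mul a * S.op ϖ p m k ν * Q ∈
    (lcomb S.mul (S.op ϖ p m k)).range) _ _
    (by simp) (fun P P' h h' => by rw [mul_add]; exact add_mem h h') (fun μ b => ?_) hQ
  rw [mul_assoc, ← mul_assoc (S.op ϖ p m k ν), op_mul_mul, Finset.sum_mul]
  refine mul_mem_range_lcomb_of_mem _ _ _ (sum_mem fun l _ => ?_)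
  obtain ⟨r, hr⟩ := S.op_mul_op ϖ p m k hR (ν - l) μ
  rw [mul_assoc, mul_assoc, hr, ← map_natCast S.mul]
  exact mul_mem_range_lcomb_of_mem _ _ _ (mul_mem_range_lcomb_of_mem _ _ _
    (mul_mem_range_lcomb _ _ _ _))

/-- The ring of linear combinations of the operators `ϖ^{k|ν|} ∂^⟨ν⟩`. -/
noncomputable def opSubring : Subring E :=
  { (lcomb S.mul (S.op ϖ p m k)).range with
    mul_mem' := S.mul_mem_range_op ϖ p m k hR
    one_mem' := ⟨Finsupp.single 0 1, by rw [lcomb_single, op_zero, map_one, one_mul]⟩ }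

lemma mem_opSubring {P : E} :
    P ∈ S.opSubring ϖ p m k hR ↔ P ∈ (lcomb S.mul (S.op ϖ p m k)).range := Iff.rfl

lemma mul_mem_opSubring (a : A) : S.mul a ∈ S.opSubring ϖ p m k hR :=
  ⟨Finsupp.single 0 a, by rw [lcomb_single, op_zero, mul_one]⟩

lemma op_mem_opSubring (ν : Fin n → ℕ) : S.op ϖ p m k ν ∈ S.opSubring ϖ p m k hR :=
  ⟨Finsupp.single ν 1, by rw [lcomb_single, map_one, one_mul]⟩

/-- Divide each index by `p ^ m` with remainder and split off blocks of length `p ^ m` with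
`levelOp_add`. The gain is that `q! = 1` for indices up to and including `p ^ m`, so no factorials
are left in the generators. -/
lemma op_mem_of_levelOp_mem (T : Subring E) (hT : ∀ r : R, S.mul (algebraMap R A r) ∈ T)
    (hT' : ∀ i, ∀ ν ≤ p ^ m, (S.levelOp ϖ p m k i ν : E) ∈ T) (ν : Fin n → ℕ) :
    S.op ϖ p m k ν ∈ T := by
  have hpm : 0 < p ^ m := pow_pos (Fact.out : p.Prime).pos m
  have h1 : ∀ i q, (S.levelOp ϖ p m k i (p ^ m * q) : E) ∈ T := by
    intro i q
    induction q with
    | zero => rw [mul_zero]; exact hT' i 0 (Nat.zero_le _)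
    | succ q ih =>
      obtain ⟨r, hr⟩ := S.levelOp_add ϖ p m k hR i (p ^ m * q) (p ^ m) (dvd_mul_right _ _)
      rw [mul_add, mul_one, hr]
      exact mul_mem (hT r) (mul_mem ih (hT' i _ le_rfl))
  have h2 : ∀ i ν, (S.levelOp ϖ p m k i ν : E) ∈ T := by
    intro i ν
    obtain ⟨r, hr⟩ := S.levelOp_add ϖ p m k hR i (p ^ m * (ν / p ^ m)) (ν % p ^ m)
      (dvd_mul_right _ _)
    rw [Nat.div_add_mod] at hr
    rw [hr]
    exact mul_mem (hT r) (mul_mem (h1 i _) (hT' i _ (Nat.mod_lt _ hpm).le))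
  rw [← coe_prod_levelOp]
  have h3 : ∏ i, S.levelOp ϖ p m k i (ν i) ∈ T.comap S.constOp.subtype :=
    prod_mem fun i _ => h2 i (ν i)
  exact h3

omit [Fact p.Prime] hR

/-! #### Action on monomials -/

lemma mul_injective : Function.Injective S.mul := by
  intro a b h
  have := congrArg (fun P => S.act P 1) h
  simpa [S.act_mul] using this

include S in
lemma natCast_mul_cancel_left {ν : ℕ} (hν : ν ≠ 0) {a b : A} (h : (ν : A) * a = ν * b) :
    a = b := by
  refine S.mul_injective (S.natCast_mul_cancel hν ?_)
  rw [← map_natCast S.mul, ← map_mul, ← map_mul, h]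

lemma act_δ_mul (i : Fin n) (a b : A) :
    S.act (S.δ i) (a * b) = a * S.act (S.δ i) b + S.act (S.δ i) a * b := by
  have h := congrArg (fun P => S.act P b) (S.δ_mul i a)
  simpa only [act_mul_apply, act_add_apply, S.act_mul] using h

lemma act_δ_one (i : Fin n) : S.act (S.δ i) 1 = 0 := by
  simpa using S.δ_algebraMap i 1

lemma act_δ_pow (i j : Fin n) (l : ℕ) :
    S.act (S.δ i) (S.x j ^ l) = if i = j then l * S.x j ^ (l - 1) else 0 := by
  induction l with
  | zero => simp [act_δ_one]
  | succ l ih =>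
    rw [pow_succ, act_δ_mul, ih, S.δ_x]
    split_ifs
    · rcases l with - | l
      · simp
      · simp only [Nat.add_sub_cancel, pow_succ]; push_cast; ring
    · simp

lemma act_δ_prod (i : Fin n) (s : Finset (Fin n)) (hi : i ∉ s) (μ : Fin n → ℕ) :
    S.act (S.δ i) (∏ j ∈ s, S.x j ^ μ j) = 0 := by
  induction s using Finset.induction_on with
  | empty => simp [act_δ_one]
  | insert j s hj ih =>
    rw [Finset.prod_insert hj, act_δ_mul, act_δ_pow, if_neg (by rintro rfl; simp at hi),
      ih (fun h => hi (Finset.mem_insert_of_mem h))]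
    simp

lemma act_δ_pow_mul_pow (i : Fin n) (c : A) (hc : S.act (S.δ i) c = 0) (l ν : ℕ) :
    S.act (S.δ i ^ ν) (c * S.x i ^ l) = (l.descFactorial ν : A) * (c * S.x i ^ (l - ν)) := by
  induction ν with
  | zero => simp
  | succ ν ih =>
    rw [pow_succ', act_mul_apply, ih, act_δ_mul, act_δ_mul, hc, act_δ_pow, if_pos rfl,
      Nat.descFactorial_succ, ← map_natCast (algebraMap R A), S.δ_algebraMap, Nat.sub_sub]
    push_cast
    ring

lemma act_dp_mul_pow (i : Fin n) (c : A) (hc : S.act (S.δ i) c = 0) (l ν : ℕ) :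
    S.act (S.dp i ν) (c * S.x i ^ l) = (l.choose ν : A) * (c * S.x i ^ (l - ν)) := by
  refine S.natCast_mul_cancel_left ν.factorial_ne_zero ?_
  rw [← S.act_natCast, ← act_mul_apply, S.factorial_mul_dp, S.act_δ_pow_mul_pow i c hc,
    Nat.descFactorial_eq_factorial_mul_choose]
  push_cast
  ring

/-- The operator `∂^[ν]`. -/
noncomputable def dpow (ν : Fin n → ℕ) : S.constOp := ∏ i, S.dpc i (ν i)

/-- The monomial `x^μ`. -/
def monomial (μ : Fin n → ℕ) : A := ∏ i, S.x i ^ μ i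

lemma act_prod_dpc_monomial (s : Finset (Fin n)) (ν μ : Fin n → ℕ) :
    S.act (∏ i ∈ s, S.dpc i (ν i) : S.constOp) (S.monomial μ) =
      ((∏ i ∈ s, (μ i).choose (ν i) : ℕ) : A) *
        S.monomial fun i => if i ∈ s then μ i - ν i else μ i := by
  induction s using Finset.induction_on with
  | empty => simp
  | insert i s hi ih =>
    rw [Finset.prod_insert hi, Subring.coe_mul, act_mul_apply, ih, Finset.prod_insert hi, monomial,
      monomial, ← Finset.prod_erase_mul _ _ (Finset.mem_univ i), if_neg hi,
      ← Finset.prod_erase_mul _ _ (Finset.mem_univ i), if_pos (Finset.mem_insert_self i s),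
      ← mul_assoc, coe_dpc, S.act_dp_mul_pow]
    · have h : ∏ j ∈ Finset.univ.erase i, S.x j ^ (if j ∈ s then μ j - ν j else μ j) =
          ∏ j ∈ Finset.univ.erase i, S.x j ^ if j ∈ insert i s then μ j - ν j else μ j :=
        Finset.prod_congr rfl fun j hj => by simp [Finset.ne_of_mem_erase hj]
      rw [h]
      push_cast
      ring
    · rw [act_δ_mul, S.act_δ_prod _ _ (Finset.notMem_erase _ _), ← map_natCast (algebraMap R A),
        S.δ_algebraMap]
      ring

lemma act_dpow_monomial (ν μ : Fin n → ℕ) :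
    S.act (S.dpow ν) (S.monomial μ) =
      ((∏ i, (μ i).choose (ν i) : ℕ) : A) * S.monomial (μ - ν) := by
  rw [dpow, act_prod_dpc_monomial]
  simp
  rfl

/-- Together with `act_dpow_monomial_of_not_le`, this makes the pairing of divided powers with
monomials unitriangular for the product order. -/
lemma act_dpow_monomial_self (μ : Fin n → ℕ) : S.act (S.dpow μ) (S.monomial μ) = 1 := by
  rw [act_dpow_monomial]
  simp [monomial]

lemma act_dpow_monomial_of_not_le {ν μ : Fin n → ℕ} (h : ¬ ν ≤ μ) :
    S.act (S.dpow ν) (S.monomial μ) = 0 := by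
  rw [Pi.le_def] at h
  push Not at h
  obtain ⟨i, hi⟩ := h
  rw [act_dpow_monomial, Finset.prod_eq_zero (Finset.mem_univ i) (Nat.choose_eq_zero_of_lt hi)]
  simp

lemma op_eq (ν : Fin n → ℕ) :
    S.op ϖ p m k ν = S.mul (algebraMap R A (ϖ ^ (k * ∑ i, ν i))) *
      (((∏ i, (ν i / p ^ m).factorial : ℕ) : E) * S.dpow ν) := by
  rw [← coe_prod_levelOp, dpow]
  simp only [levelOp]
  rw [Finset.prod_mul_distrib, ← map_prod, Finset.prod_pow_eq_pow_sum, ← Finset.mul_sum,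
    Subring.coe_mul, coe_constHom, Finset.prod_mul_distrib, Subring.coe_mul, ← Nat.cast_prod,
    Subring.coe_natCast]

/-- Operators of the form `∑_ν s_ν ϖ^{k|ν|} ∂^⟨ν⟩` with coefficients in an extension of `A` are
determined by their action on the monomials. -/
lemma eq_zero_of_sum_act_op_monomial {B : Type*} [CommRing B] (φ : A →+* B)
    (h0 : ∀ ν : ℕ, ν ≠ 0 → ∀ b : B, (ν : B) * b = 0 → b = 0)
    (hϖ : ∀ b : B, φ (algebraMap R A ϖ) * b = 0 → b = 0) (s : (Fin n → ℕ) →₀ B)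
    (h : ∀ μ, (s.sum fun ν b => b * φ (S.act (S.op ϖ p m k ν) (S.monomial μ))) = 0) : s = 0 := by
  have hop : ∀ ν a, S.act (S.op ϖ p m k ν) a = algebraMap R A (ϖ ^ (k * ∑ i, ν i)) *
      (((∏ i, (ν i / p ^ m).factorial : ℕ) : A) * S.act (S.dpow ν) a) := by
    intro ν a
    rw [op_eq, act_mul_apply, act_mul_apply, S.act_mul, act_natCast]
  have hϖ' : ∀ l (b : B), φ (algebraMap R A ϖ) ^ l * b = 0 → b = 0 := by
    intro l b hb
    induction l with
    | zero => simpa using hb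
    | succ l ih => exact ih (hϖ _ (by rw [← mul_assoc, ← pow_succ']; exact hb))
  ext μ
  -- In the relation tested on `x^μ`, the coefficients of indices below `μ` vanish by induction, and
  -- indices not below `μ` kill `x^μ`. Only the coefficient of `μ` survives, times a power of `ϖ`
  -- and factorials.
  induction μ using WellFoundedLT.induction with
  | ind μ ih =>
    have hμ := h μ
    rw [Finsupp.sum, Finset.sum_eq_single μ] at hμ
    · rw [hop, act_dpow_monomial_self, mul_one, map_mul, map_natCast, map_pow, map_pow, mul_comm,
        mul_assoc] at hμ
      exact h0 _ (Finset.prod_ne_zero_iff.2 fun i _ => Nat.factorial_ne_zero _) _ (hϖ' _ _ hμ)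
    · intro ν _ hν
      by_cases hle : ν ≤ μ
      · rw [ih ν (lt_of_le_of_ne hle hν)]
        simp
      · rw [hop, S.act_dpow_monomial_of_not_le hle]
        simp
    · intro hμ'
      rw [Finsupp.notMem_support_iff.1 hμ', zero_mul]

/-! #### Change of coordinates -/

/-- The operators of order at most `d`. -/
noncomputable def orderLE (d : ℕ) : AddSubgroup E :=
  AddSubgroup.closure {P | ∃ (a : A) (ν : Fin n → ℕ), ∑ i, ν i ≤ d ∧ P = S.mul a * S.dpow ν}

lemma mul_dpow_mem_orderLE {d : ℕ} (a : A) {ν : Fin n → ℕ} (h : ∑ i, ν i ≤ d) :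
    S.mul a * S.dpow ν ∈ S.orderLE d :=
  AddSubgroup.subset_closure ⟨a, ν, h, rfl⟩

lemma mul_mem_orderLE {d : ℕ} (a : A) {P : E} (hP : P ∈ S.orderLE d) :
    S.mul a * P ∈ S.orderLE d := by
  induction hP using AddSubgroup.closure_induction with
  | mem P hP =>
    obtain ⟨b, ν, hν, rfl⟩ := hP
    rw [← mul_assoc, ← map_mul]
    exact S.mul_dpow_mem_orderLE _ hν
  | zero => rw [mul_zero]; exact zero_mem _
  | add P Q _ _ hP hQ => rw [mul_add]; exact add_mem hP hQ
  | neg P _ hP => rw [mul_neg]; exact neg_mem hP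

lemma δ_mul_dpow (i : Fin n) (ν : Fin n → ℕ) : S.δ i * S.dpow ν =
    S.mul ((ν i + 1 : ℕ) : A) * S.dpow (ν + Pi.single i 1) := by
  have h1 := S.dpc_mul_dpc i 1 (ν i)
  rw [Nat.choose_one_right, add_comm 1] at h1
  have h2 : ∏ j ∈ Finset.univ.erase i, S.dpc j ((ν + Pi.single i 1 : Fin n → ℕ) j) =
      ∏ j ∈ Finset.univ.erase i, S.dpc j (ν j) :=
    Finset.prod_congr rfl fun j hj => by simp [Finset.ne_of_mem_erase hj]
  have h3 : S.dpow (ν + Pi.single i 1) =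
      S.dpc i (ν i + 1) * ∏ j ∈ Finset.univ.erase i, S.dpc j (ν j) := by
    rw [dpow, ← Finset.mul_prod_erase _ _ (Finset.mem_univ i), h2]
    simp
  have h4 : S.dpow ν = S.dpc i (ν i) * ∏ j ∈ Finset.univ.erase i, S.dpc j (ν j) :=
    (Finset.mul_prod_erase _ _ (Finset.mem_univ i)).symm
  rw [← coe_dpc_one, map_natCast, ← Subring.coe_natCast S.constOp, ← Subring.coe_mul,
    ← Subring.coe_mul, h3, h4, ← mul_assoc, h1, mul_assoc]

lemma δ_mul_mem_orderLE {d : ℕ} (i : Fin n) {P : E} (hP : P ∈ S.orderLE d) :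
    S.δ i * P ∈ S.orderLE (d + 1) := by
  induction hP using AddSubgroup.closure_induction with
  | mem P hP =>
    obtain ⟨b, ν, hν, rfl⟩ := hP
    rw [← mul_assoc, S.δ_mul, add_mul, mul_assoc, δ_mul_dpow, ← mul_assoc, ← map_mul]
    refine add_mem (S.mul_dpow_mem_orderLE _ ?_) (S.mul_dpow_mem_orderLE _ (hν.trans (Nat.le_succ d)))
    simp only [Pi.add_apply, Finset.sum_add_distrib, Finset.sum_pi_single', Finset.mem_univ,
      if_true]
    omega
  | zero => rw [mul_zero]; exact zero_mem _
  | add P Q _ _ hP hQ => rw [mul_add]; exact add_mem hP hQ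
  | neg P _ hP => rw [mul_neg]; exact neg_mem hP

lemma sum_δ_pow_mem_orderLE (α : Fin n → A) (d : ℕ) :
    (∑ i, S.mul (α i) * S.δ i) ^ d ∈ S.orderLE d := by
  induction d with
  | zero =>
    have h := S.mul_dpow_mem_orderLE (d := 0) 1 (ν := 0) (by simp)
    have h' : S.dpow 0 = 1 := by simp [dpow, dpc_zero]
    rw [pow_zero]
    rwa [map_one, one_mul, h'] at h
  | succ d ih =>
    rw [pow_succ', Finset.sum_mul]
    refine sum_mem fun i _ => ?_
    rw [mul_assoc]
    exact S.mul_mem_orderLE _ (S.δ_mul_mem_orderLE i ih)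

lemma exists_finsupp_of_mem_orderLE {d : ℕ} {P : E} (hP : P ∈ S.orderLE d) :
    ∃ b : (Fin n → ℕ) →₀ A, (∀ ν ∈ b.support, ∑ i, ν i ≤ d) ∧
      P = b.sum fun ν a => S.mul a * S.dpow ν := by
  classical
  induction hP using AddSubgroup.closure_induction with
  | mem P hP =>
    obtain ⟨a, ν, hν, rfl⟩ := hP
    refine ⟨Finsupp.single ν a, fun μ hμ => ?_, by rw [Finsupp.sum_single_index (by simp)]⟩
    rwa [Finset.mem_singleton.1 (Finsupp.support_single_subset hμ)]
  | zero => exact ⟨0, by simp, by simp⟩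
  | add P Q _ _ hP hQ =>
    obtain ⟨b, hb, rfl⟩ := hP
    obtain ⟨c, hc, rfl⟩ := hQ
    refine ⟨b + c, fun ν hν => ?_, ?_⟩
    · exact (Finset.mem_union.1 (Finsupp.support_add hν)).elim (hb ν) (hc ν)
    · rw [Finsupp.sum_add_index' (by simp) (by simp [add_mul])]
  | neg P _ hP =>
    obtain ⟨b, hb, rfl⟩ := hP
    refine ⟨-b, fun ν hν => hb ν (by simpa using hν), ?_⟩
    rw [Finsupp.sum_neg_index (by simp), Finsupp.sum, Finsupp.sum]
    simp

/-- All values of `d! P` are divisible by `d!`. Its coefficients are recovered from its values on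
monomials by a unitriangular system, so they are divisible by `d!` as well, and the factorial can be
cancelled. -/
lemma exists_eq_of_factorial_mul_mem_orderLE {d : ℕ} {P : E}
    (hP : (d.factorial : E) * P ∈ S.orderLE d) :
    ∃ b : (Fin n → ℕ) →₀ A, (∀ ν ∈ b.support, ∑ i, ν i ≤ d) ∧
      P = b.sum fun ν a => S.mul a * S.dpow ν := by
  obtain ⟨b, hb, hb'⟩ := S.exists_finsupp_of_mem_orderLE hP
  have hdvd : ∀ μ, (d.factorial : A) ∣ b μ := by
    intro μ
    induction μ using WellFoundedLT.induction with
    | ind μ ih =>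
      have h := congrArg (fun P => S.act P (S.monomial μ)) hb'
      simp only [act_mul_apply, act_natCast, Finsupp.sum, act_sum_apply, S.act_mul] at h
      rw [Finset.sum_subset (Finset.subset_insert μ b.support)
        (fun ν _ hν => by rw [Finsupp.notMem_support_iff.1 hν, zero_mul]),
        ← Finset.add_sum_erase _ _ (Finset.mem_insert_self μ _), act_dpow_monomial_self,
        mul_one] at h
      rw [eq_sub_of_add_eq h.symm]
      refine dvd_sub (dvd_mul_right _ _) (Finset.dvd_sum fun ν hν => ?_)
      by_cases hle : ν ≤ μ
      · exact (ih ν (lt_of_le_of_ne hle (Finset.ne_of_mem_erase hν))).mul_right _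
      · rw [S.act_dpow_monomial_of_not_le hle, mul_zero]
        exact dvd_zero _
  choose c hc using hdvd
  -- The chosen quotients are cut off outside the support of `b`, which keeps the sum finite and the
  -- order at most `d`.
  refine ⟨Finsupp.onFinset b.support (fun ν => if ν ∈ b.support then c ν else 0)
    (fun ν hν => by by_contra h; simp [h] at hν), fun ν hν => hb ν ?_,
    S.factorial_mul_cancel d ?_⟩
  · exact Finsupp.support_onFinset_subset hν
  · rw [hb', Finsupp.onFinset_sum _ (by simp), Finsupp.sum, Finset.mul_sum]
    refine Finset.sum_congr rfl fun ν hν => ?_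
    rw [if_pos hν, ← mul_assoc, ← map_natCast S.mul, ← map_mul, ← hc]

/-- The operators `ϖ^{k|ν|} ∂^⟨ν⟩` attached to derivations `∂'_j = ∑ α_i ∂_i` are linear
combinations of those attached to the `∂_i`. -/
lemma op_mem_opSubring_of_δ_eq [Fact p.Prime] (hR : ∀ ν : ℕ, ¬ p ∣ ν → IsUnit (ν : R)) {n' : ℕ}
    (S' : DiffSystem R A E n') (h : S'.mul = S.mul) (α : Fin n' → Fin n → A)
    (hα : ∀ j, S'.δ j = ∑ i, S.mul (α j i) * S.δ i) (ν : Fin n' → ℕ) :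
    S'.op ϖ p m k ν ∈ S.opSubring ϖ p m k hR := by
  -- It suffices to treat one derivation `∂'_j` and an index `d ≤ p ^ m`, where the operator is just
  -- `ϖ^{kd} ∂'_j^[d]`.
  refine S'.op_mem_of_levelOp_mem ϖ p m k hR _
    (fun r => by rw [h]; exact S.mul_mem_opSubring ϖ p m k hR _) (fun j d hd => ?_) ν
  have hpm : 0 < p ^ m := pow_pos (Fact.out : p.Prime).pos m
  have hq : ∀ e ≤ p ^ m, Nat.factorial (e / p ^ m) = 1 := by
    intro e he
    refine Nat.factorial_eq_one.2 ?_
    exact (Nat.div_le_div_right he).trans (Nat.div_self hpm).le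
  obtain ⟨b, hb, hb'⟩ := S.exists_eq_of_factorial_mul_mem_orderLE (d := d) (P := S'.dp j d)
    (by rw [S'.factorial_mul_dp, hα]; exact S.sum_δ_pow_mem_orderLE _ _)
  rw [levelOp, hq d hd, Nat.cast_one, one_mul, Subring.coe_mul, coe_constHom, coe_dpc, hb', h,
    Finsupp.sum, Finset.mul_sum]
  refine sum_mem fun μ hμ => ?_
  have hμd := hb μ hμ
  have hfac : (∏ i, (μ i / p ^ m).factorial : ℕ) = 1 := by
    refine Finset.prod_eq_one fun i _ => hq _ (le_trans ?_ (hμd.trans hd))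
    exact Finset.single_le_sum (f := μ) (fun _ _ => Nat.zero_le _) (Finset.mem_univ i)
  have hop := S.op_eq ϖ p m k μ
  rw [hfac, Nat.cast_one, one_mul] at hop
  -- The order does not go up, `|μ| ≤ d`, so `ϖ^{kd}` contains the factor `ϖ^{k|μ|}` that is needed
  -- and the rest joins the coefficient.
  have : S.mul (algebraMap R A (ϖ ^ (k * d))) * (S.mul (b μ) * S.dpow μ) =
      S.mul (algebraMap R A (ϖ ^ (k * (d - ∑ i, μ i))) * b μ) * S.op ϖ p m k μ := by
    rw [hop, ← mul_assoc, ← mul_assoc, ← map_mul, ← map_mul]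
    congr 2
    have hd' : ϖ ^ (k * d) = ϖ ^ (k * (d - ∑ i, μ i)) * ϖ ^ (k * ∑ i, μ i) := by
      rw [← pow_add, ← mul_add, Nat.sub_add_cancel hμd]
    rw [hd', map_mul]
    ring
  rw [this]
  exact mul_mem (S.mul_mem_opSubring ϖ p m k hR _) (S.op_mem_opSubring ϖ p m k hR μ)

end DiffSystem

/-! ### Restriction and gluing of sections -/

/-- Gluing of local sections that are characterized by a local property. -/
lemma exists_of_locally {C : Type (u + 1)} [Category.{u} C] {FC : C → C → Type*} {CC : C → Type u}
    [∀ X Y, FunLike (FC X Y) (CC X) (CC Y)] [ConcreteCategory.{u} C FC]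
    [Limits.HasLimits C] [(forget C).ReflectsIsomorphisms] [Limits.PreservesLimits (forget C)]
    {X : TopCat.{u}} (F : TopCat.Sheaf C X) {V : Opens X}
    (Q : ∀ W : Opens X, ToType (F.obj.obj (op W)) → Prop)
    (hres : ∀ (W W' : Opens X) (h : W' ≤ W) t, Q W t → Q W' (F.obj.map (homOfLE h).op t))
    (huniq : ∀ W ≤ V, ∀ t t', Q W t → Q W t' → t = t')
    (hex : ∀ x ∈ V, ∃ W ≤ V, x ∈ W ∧ ∃ t, Q W t) :
    ∃ t, ∀ x ∈ V, ∃ (W : Opens X) (h : W ≤ V), x ∈ W ∧ Q W (F.obj.map (homOfLE h).op t) := by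
  choose W hW hxW t ht using fun x : V => hex x.1 x.2
  obtain ⟨t', ht', -⟩ := F.existsUnique_gluing' W V (fun x => homOfLE (hW x))
    (fun x hx => Opens.mem_iSup.2 ⟨⟨x, hx⟩, hxW ⟨x, hx⟩⟩) t
    (fun x y => huniq _ (inf_le_left.trans (hW x)) _ _ (hres _ _ inf_le_left _ (ht x))
      (hres _ _ inf_le_right _ (ht y)))
  exact ⟨t', fun x hx => ⟨W ⟨x, hx⟩, hW _, hxW _, by
    have := ht ⟨x, hx⟩
    rw [← ht' ⟨x, hx⟩] at this
    exact this⟩⟩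

section Restriction

variable {X : Scheme.{u}}

/-- Restriction of functions. -/
def rs {V W : X.Opens} (h : W ≤ V) : Γ(X, V) →+* Γ(X, W) := (X.presheaf.map (homOfLE h).op).hom

lemma rs_rs {V W W' : X.Opens} (h : W ≤ V) (h' : W' ≤ W) (s : Γ(X, V)) :
    rs h' (rs h s) = rs (h'.trans h) s := by
  change (X.presheaf.map (homOfLE h).op ≫ X.presheaf.map (homOfLE h').op) s = _
  rw [← Functor.map_comp]
  rfl

lemma rs_self {V : X.Opens} (h : V ≤ V) (s : Γ(X, V)) : rs h s = s := by
  change (X.presheaf.map (𝟙 (op V))) s = s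
  rw [X.presheaf.map_id]
  rfl

lemma rs_ext {V : X.Opens} {s t : Γ(X, V)}
    (h : ∀ x ∈ V, ∃ (W : X.Opens) (h : W ≤ V), x ∈ W ∧ rs h s = rs h t) : s = t := by
  choose W hW hxW hs using fun x : V => h x.1 x.2
  exact X.sheaf.eq_of_locally_eq' W V (fun x => homOfLE (hW x))
    (fun x hx => Opens.mem_iSup.2 ⟨⟨x, hx⟩, hxW ⟨x, hx⟩⟩) s t hs

variable {Y : Scheme.{u}} (pr : Y ⟶ X)

lemma app_rs {V W : X.Opens} (h : W ≤ V) (s : Γ(X, V)) :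
    pr.app W (rs h s) = rs (pr.preimage_mono h) (pr.app V s) := by
  change (X.presheaf.map (homOfLE h).op ≫ pr.app W) s = _
  rw [pr.naturality]
  rfl

end Restriction

/-! ### Evaluation of operators on sections -/

section EndRing

instance (X : Scheme.{u}) (V : X.Opens) : Ring (endRing X V) := (endRing X V).toRing

instance (X : Scheme.{u}) (S : LocalSubrings X) (V : X.Opens) : Ring (S.ring V) := (S.ring V).toRing

instance (X : Scheme.{u}) (S : LocalSubrings X) (V : X.Opens) : NonAssocSemiring (S.ring V) :=
  (S.ring V).toRing.toNonAssocSemiring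

variable {X : Scheme.{u}} {V W : X.Opens}

/-- Evaluation of endomorphisms of `𝒪_X|_V` on sections over `W`. -/
def evalHom (h : W ≤ V) : endRing X V →+* AddMonoid.End Γ(X, W) where
  toFun P := evalOp P h
  map_one' := rfl
  map_mul' _ _ := rfl
  map_zero' := rfl
  map_add' _ _ := rfl

lemma evalOp_rs (P : endRing X V) {W' : X.Opens} (h : W ≤ V) (h' : W' ≤ W) (s : Γ(X, W)) :
    evalOp P (h'.trans h) (rs h' s) = rs h' (evalOp P h s) :=
  P.2 ⟨W, h⟩ ⟨W', h'.trans h⟩ h' s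

lemma evalOp_res (P : endRing X V) {W' : X.Opens} (h : W ≤ V) (h' : W' ≤ W) :
    evalOp (endRing.res h P) h' = evalOp P (h'.trans h) := rfl

lemma evalOp_mulOp (a : Γ(X, V)) (h : W ≤ V) (s : Γ(X, W)) :
    evalOp (mulOp V a) h s = rs h a * s := rfl

lemma evalOp_mul (P Q : endRing X V) (h : W ≤ V) (s : Γ(X, W)) :
    evalOp (P * Q) h s = evalOp P h (evalOp Q h s) := rfl

lemma evalOp_add (P Q : endRing X V) (h : W ≤ V) (s : Γ(X, W)) :
    evalOp (P + Q) h s = evalOp P h s + evalOp Q h s := rfl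

lemma evalOp_one (h : W ≤ V) (s : Γ(X, W)) :
    evalOp (1 : endRing X V) h s = s := rfl

lemma evalOp_natCast (n : ℕ) (h : W ≤ V) (s : Γ(X, W)) :
    evalOp (n : endRing X V) h s = n * s := by
  have := congrArg (fun P => evalOp P h s) (map_natCast (mulOp V) n)
  rw [← this, evalOp_mulOp, map_natCast]

lemma evalOp_sum {κ : Type*} (S : Finset κ) (P : κ → endRing X V) (h : W ≤ V) (s : Γ(X, W)) :
    evalOp (∑ i ∈ S, P i) h s = ∑ i ∈ S, evalOp (P i) h s :=
  map_sum (AddMonoidHom.mk' (fun P => evalOp P h s) fun P Q => evalOp_add P Q h s) P S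

lemma endRing_ext {P Q : endRing X V}
    (h : ∀ (W : X.Opens) (h : W ≤ V) (s : Γ(X, W)), evalOp P h s = evalOp Q h s) : P = Q := by
  ext W s
  exact h W.1 W.2 s

lemma res_res {W' : X.Opens} (h : W ≤ V) (h' : W' ≤ W) (P : endRing X V) :
    endRing.res h' (endRing.res h P) = endRing.res (h'.trans h) P := rfl

lemma mulOp_injective : Function.Injective (mulOp (X := X) V) := by
  intro a b h
  have := congrArg (fun P : endRing X V => evalOp P le_rfl 1) h
  simpa [evalOp_mulOp, rs_self] using this

end EndRing

/-! ### Schemes over a domain -/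

section Torsion

variable {X : Scheme.{u}} {R : CommRingCat.{u}} (f : X ⟶ Spec R)

lemma rs_const {V W : X.Opens} (h : W ≤ V) (r : R) : rs h (const f V r) = const f W r := by
  change rs h (rs le_top (f.appTop _)) = rs le_top (f.appTop _)
  rw [rs_rs]

lemma const_flat [Flat f] {V : X.Opens} (hV : IsAffineOpen V) : (const f V).Flat := by
  have h := HasRingHomProperty.appLE @Flat f inferInstance ⟨⊤, isAffineOpen_top (Spec R)⟩ ⟨V, hV⟩
    le_top
  have h' : const f V = (f.appLE ⊤ V le_top).hom.comp (Scheme.ΓSpecIso R).inv.hom := rfl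
  rw [h']
  exact RingHom.Flat.comp (RingHom.Flat.of_bijective
    (ConcreteCategory.bijective_of_isIso (Scheme.ΓSpecIso R).inv)) h

lemma eq_zero_of_const_mul_of_isAffineOpen [Flat f] [IsDomain R] {V : X.Opens}
    (hV : IsAffineOpen V) {r : R} (hr : r ≠ 0) {s : Γ(X, V)} (h : const f V r * s = 0) : s = 0 := by
  let := (const f V).toAlgebra
  have : Module.Flat R Γ(X, V) := const_flat f hV
  have h' := Module.Flat.isSMulRegular_of_nonZeroDivisors (M := Γ(X, V))
    (mem_nonZeroDivisors_of_ne_zero hr)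
  exact h' ((show r • s = 0 from h).trans (smul_zero r).symm)

lemma eq_zero_of_const_mul [Flat f] [IsDomain R] {V : X.Opens} {r : R} (hr : r ≠ 0)
    {s : Γ(X, V)} (h : const f V r * s = 0) : s = 0 := by
  refine rs_ext fun x hx => ?_
  obtain ⟨W, hW, hxW, hWV⟩ := exists_isAffineOpen_mem_and_subset hx
  refine ⟨W, hWV, hxW, ?_⟩
  rw [map_zero]
  refine eq_zero_of_const_mul_of_isAffineOpen f hW hr ?_
  rw [← rs_const f hWV, ← map_mul, h, map_zero]

include f in
lemma eq_zero_of_natCast_mul [Flat f] [IsDomain R] [CharZero R] {V : X.Opens} {n : ℕ} (hn : n ≠ 0)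
    {s : Γ(X, V)} (h : (n : Γ(X, V)) * s = 0) : s = 0 := by
  refine eq_zero_of_const_mul f (r := (n : R)) (Nat.cast_ne_zero.2 hn) ?_
  rwa [map_natCast]

include f in
lemma endRing_eq_zero_of_natCast_mul [Flat f] [IsDomain R] [CharZero R] {V : X.Opens} {n : ℕ}
    (hn : n ≠ 0) {P : endRing X V} (h : (n : endRing X V) * P = 0) : P = 0 := by
  refine endRing_ext fun W hW s => eq_zero_of_natCast_mul f hn ?_
  have := congrArg (fun P => evalOp P hW s) h
  rw [← evalOp_natCast n hW]
  exact this

end Torsion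

/-! ### Derivations in local coordinates -/

section Derivation

variable {X : Scheme.{u}} {R : CommRingCat.{u}} {f : X ⟶ Spec R}

variable (f) in
/-- An endomorphism of `𝒪_X|_V` is an `R`-derivation. -/
structure IsDer {V : X.Opens} (P : endRing X V) : Prop where
  mul : ∀ {W : X.Opens} (h : W ≤ V) (a b : Γ(X, W)),
    evalOp P h (a * b) = a * evalOp P h b + b * evalOp P h a
  const : ∀ {W : X.Opens} (h : W ≤ V) (r : R), evalOp P h (const f W r) = 0

lemma Coordinates.isDer_pd {U : X.Opens} (c : Coordinates f U) (i : Fin c.n) : IsDer f (c.pd i) :=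
  ⟨c.pd_mul i, c.pd_const i⟩

namespace IsDer

variable {V : X.Opens} {P Q : endRing X V}

lemma res (hP : IsDer f P) {W : X.Opens} (h : W ≤ V) : IsDer f (endRing.res h P) :=
  ⟨fun h' => hP.mul (h'.trans h), fun h' => hP.const (h'.trans h)⟩

lemma commutator (hP : IsDer f P) (hQ : IsDer f Q) : IsDer f (P * Q - Q * P) := by
  have h : ∀ {W : X.Opens} (h : W ≤ V) (a : Γ(X, W)), evalOp (P * Q - Q * P) h a =
    evalOp P h (evalOp Q h a) - evalOp Q h (evalOp P h a) := fun _ _ => rfl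
  refine ⟨fun h' a b => ?_, fun h' r => ?_⟩
  · rw [h, h, h, hP.mul, hQ.mul, map_add, map_add, hP.mul, hP.mul, hQ.mul, hQ.mul]
    ring
  · rw [h, hP.const, hQ.const, map_zero, map_zero, sub_zero]

lemma sub (hP : IsDer f P) (hQ : IsDer f Q) : IsDer f (P - Q) := by
  have h : ∀ {W : X.Opens} (h : W ≤ V) (a : Γ(X, W)), evalOp (P - Q) h a =
    evalOp P h a - evalOp Q h a := fun _ _ => rfl
  refine ⟨fun h' a b => ?_, fun h' r => ?_⟩
  · rw [h, h, h, hP.mul, hQ.mul]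
    ring
  · rw [h, hP.const, hQ.const, sub_zero]

lemma sum_mulOp {κ : Type*} (s : Finset κ) (a : κ → Γ(X, V)) (P : κ → endRing X V)
    (hP : ∀ i, IsDer f (P i)) : IsDer f (∑ i ∈ s, mulOp V (a i) * P i) := by
  refine ⟨fun h' b c => ?_, fun h' r => ?_⟩
  · simp only [evalOp_sum, evalOp_mul, evalOp_mulOp, (hP _).mul, Finset.mul_sum,
      ← Finset.sum_add_distrib]
    exact Finset.sum_congr rfl fun i _ => by ring
  · simp only [evalOp_sum, evalOp_mul, evalOp_mulOp, (hP _).const, mul_zero, Finset.sum_const_zero]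

lemma map_one (hP : IsDer f P) {W : X.Opens} (h : W ≤ V) : evalOp P h 1 = 0 := by
  have := hP.const h 1
  rwa [RingHom.map_one] at this

/-- A derivation that vanishes on local coordinates is zero. -/
lemma eq_zero (hP : IsDer f P) {U : X.Opens} (c : Coordinates f U) (h : V ≤ U)
    (hx : ∀ i, evalOp P le_rfl (rs h (c.x i)) = 0) : P = 0 := by
  have hx' : ∀ {W : X.Opens} (hW : W ≤ V) (i), evalOp P hW (rs (hW.trans h) (c.x i)) = 0 := by
    intro W hW i
    rw [← rs_rs h hW]
    exact (evalOp_rs P le_rfl hW _).trans (by rw [hx, map_zero])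
  refine endRing_ext fun W hW s => rs_ext fun y hy => ?_
  -- The coordinates control differentials on `U` only. Basic opens of `U` are small enough, and
  -- their functions are fractions of functions on `U`.
  obtain ⟨g, hgW, hyg⟩ := c.affine.exists_basicOpen_le ⟨y, hy⟩ (h (hW hy))
  refine ⟨X.basicOpen g, hgW, hyg, ?_⟩
  rw [← evalOp_rs, ← evalOp_rs]
  change _ = 0
  generalize rs hgW s = t
  have hgU : X.basicOpen g ≤ U := X.basicOpen_le g
  let := (ArithDiff.const f U).toAlgebra
  let : Algebra Γ(X, U) Γ(X, X.basicOpen g) := (rs hgU).toAlgebra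
  let : Algebra R Γ(X, X.basicOpen g) := (ArithDiff.const f (X.basicOpen g)).toAlgebra
  have : IsScalarTower R Γ(X, U) Γ(X, X.basicOpen g) :=
    IsScalarTower.of_algebraMap_eq fun r => (rs_const f hgU r).symm
  have : IsLocalization.Away g Γ(X, X.basicOpen g) := c.affine.isLocalization_basicOpen g
  have hsm : ∀ (a : Γ(X, U)) (b : Γ(X, X.basicOpen g)), a • b = rs hgU a * b :=
    fun a b => Algebra.smul_def a b
  -- On functions coming from `U`, the operator is a derivation in the algebraic sense. It factors
  -- through the Kähler differentials, which are spanned by the `dx_i`.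
  let d : Derivation R Γ(X, U) Γ(X, X.basicOpen g) :=
    { toFun := fun a => evalOp P (hgW.trans hW) (rs hgU a)
      map_add' := fun a b => by rw [map_add, map_add]
      map_smul' := fun r a => by
        rw [Algebra.smul_def, RingHom.map_mul, hP.mul, RingHom.id_apply, Algebra.smul_def]
        change rs hgU (ArithDiff.const f U r) * _ + _ * evalOp P _ (rs hgU (ArithDiff.const f U r)) = _
        rw [rs_const, hP.const, mul_zero, add_zero]
        rfl
      map_one_eq_zero' := by
        change evalOp P _ (rs hgU 1) = 0
        rw [RingHom.map_one, hP.map_one]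
      leibniz' := fun a b => by
        change evalOp P _ (rs hgU (a * b)) = a • evalOp P _ _ + b • evalOp P _ _
        rw [RingHom.map_mul, hP.mul, hsm, hsm] }
  have hd : ∀ a, d a = 0 := by
    intro a
    rw [← d.liftKaehlerDifferential_comp_D]
    have htop : ⊤ ≤ LinearMap.ker d.liftKaehlerDifferential := by
      rw [← c.span_dx, Submodule.span_le]
      rintro _ ⟨i, rfl⟩
      exact (d.liftKaehlerDifferential_comp_D _).trans (hx' (hgW.trans hW) i)
    exact htop trivial
  -- The quotient rule: `t b = a`, where `P` kills `a` and `b` and where `b` is a unit.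
  obtain ⟨⟨a, b⟩, hab⟩ := IsLocalization.surj (Submonoid.powers g) t
  have hu : IsUnit (rs hgU b.1) := IsLocalization.map_units _ b
  have h1 := congrArg (evalOp P (hgW.trans hW)) hab
  have h2 : evalOp P (hgW.trans hW) (rs hgU b.1) = 0 := hd b.1
  have h3 : evalOp P (hgW.trans hW) (rs hgU a) = 0 := hd a
  have h4 : evalOp P (hgW.trans hW) (t * rs hgU b.1) = 0 := h1.trans h3
  rw [hP.mul, h2, mul_zero, zero_add] at h4
  exact (hu.mul_right_eq_zero).1 h4

end IsDer

end Derivation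


/-! ### The operators attached to local coordinates -/

section Coordinates

variable {X : Scheme.{u}} {R : CommRingCat.{u}} {f : X ⟶ Spec R}

namespace Coordinates

/-- The commutator is again a derivation. It kills the coordinates because each `∂_i x_l` is
constant. -/
lemma pd_commute {U : X.Opens} (c : Coordinates f U) (i j : Fin c.n) :
    Commute (c.pd i) (c.pd j) := by
  rw [commute_iff_eq, ← sub_eq_zero]
  refine ((c.isDer_pd i).commutator (c.isDer_pd j)).eq_zero c le_rfl fun l => ?_
  rw [rs_self]
  change evalOp (c.pd i) _ (evalOp (c.pd j) _ (c.x l)) - evalOp (c.pd j) _ (evalOp (c.pd i) _ (c.x l))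
    = 0
  have h : ∀ i j, evalOp (c.pd i) le_rfl (if j = l then 1 else 0) = 0 := by
    intro i j
    split_ifs
    · exact (c.isDer_pd i).map_one _
    · exact map_zero _
  rw [c.pd_x, c.pd_x, h, h, sub_zero]

/-- The functions on `W` as an algebra over the base. -/
noncomputable abbrev constAlgebra (f : X ⟶ Spec R) (W : X.Opens) : Algebra R Γ(X, W) :=
  (const f W).toAlgebra

variable [Flat f] [IsDomain R] [CharZero R]

/-- The restriction to `W` of the derivations attached to coordinates on `U`. -/
noncomputable def diffSystem {U : X.Opens} (c : Coordinates f U) {W : X.Opens} (h : W ≤ U) :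
    letI := constAlgebra f W
    DiffSystem R Γ(X, W) (endRing X W) c.n :=
  letI := constAlgebra f W
  { mul := mulOp W
    act := evalHom le_rfl
    act_mul := fun a b => by
      change rs le_rfl a * b = a * b
      rw [rs_self]
    x := fun i => rs h (c.x i)
    δ := fun i => endRing.res h (c.pd i)
    dp := fun i ν => endRing.res h (c.dpd i ν)
    δ_comm := fun i j => (c.pd_commute i j).map (endRing.res h)
    δ_mul := fun i a => by
      refine endRing_ext fun W' h' s => ?_
      change evalOp (c.pd i) _ (rs h' a * s) = rs h' a * evalOp (c.pd i) _ s +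
        rs h' (evalOp (c.pd i) _ a) * s
      rw [c.pd_mul, ← evalOp_rs, mul_comm s]
    δ_algebraMap := fun i r => c.pd_const i h r
    δ_x := fun i j => by
      change evalOp (c.pd i) _ (rs h (c.x j)) = _
      have := evalOp_rs (c.pd i) le_rfl h (c.x j)
      rw [c.pd_x] at this
      refine this.trans ?_
      split_ifs
      · exact map_one _
      · exact map_zero _
    factorial_mul_dp := fun i ν => by
      rw [← map_natCast (endRing.res h), ← map_mul, c.factorial_mul_dpd, map_pow]
    eq_zero_of_natCast_mul := fun ν hν P hP => endRing_eq_zero_of_natCast_mul f hν hP }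

variable (ϖ : R) (p m k : ℕ) {U : X.Opens} (c : Coordinates f U) {W : X.Opens} (h : W ≤ U)

lemma diffSystem_op (ν : Fin c.n → ℕ) :
    letI := constAlgebra f W
    (c.diffSystem h).op ϖ p m k ν = endRing.res h (c.op ϖ p m k ν) := by
  let := constAlgebra f W
  rw [Coordinates.op, map_mul, res_mulOp, map_list_prod, List.map_ofFn, DiffSystem.op]
  congr 1
  change mulOp W (const f W ϖ ^ _) = mulOp W (rs h (const f U ϖ ^ _))
  rw [map_pow (rs h), rs_const]

/-- The Leibniz formula. -/
lemma evalOp_op_mul (ν : Fin c.n → ℕ) (s t : Γ(X, W)) :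
    evalOp (c.op ϖ p m k ν) h (s * t) = ∑ μ ∈ Finset.Iic ν, (leibnizCoeff p m ν μ : Γ(X, W)) *
      (evalOp (c.op ϖ p m k μ) h s * evalOp (c.op ϖ p m k (ν - μ)) h t) := by
  let := constAlgebra f W
  have := (c.diffSystem h).act_op_mul ϖ p m k ν s t
  simp only [diffSystem_op] at this
  exact this

lemma op_zero : c.op ϖ p m k 0 = 1 := by
  let := constAlgebra f U
  have := (c.diffSystem le_rfl).op_zero ϖ p m k
  rwa [diffSystem_op] at this

/-- The operators `ϖ^{k|ν|} ∂^⟨ν⟩` on an open `W` on which there are coordinates span the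
operators of level `m` and congruence level `k`. -/
lemma closure_generators_le [Fact p.Prime] (hR : ∀ ν : ℕ, ¬ p ∣ ν → IsUnit (ν : R))
    {P : endRing X W} (hP : P ∈ Subring.closure (generators f ϖ p m k W)) :
    P ∈ (lcomb (mulOp W) fun ν => endRing.res h (c.op ϖ p m k ν)).range := by
  let := constAlgebra f W
  have hle : Subring.closure (generators f ϖ p m k W) ≤
      (c.diffSystem h).opSubring ϖ p m k hR := by
    rw [Subring.closure_le]
    rintro Q (⟨a, rfl⟩ | ⟨U', h', c', ν, rfl⟩)
    · exact (c.diffSystem h).mul_mem_opSubring ϖ p m k hR a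
    · rw [← diffSystem_op]
      -- The coefficients come from the chain rule `∂'_j = ∑ ∂'_j(x_i) ∂_i`: both sides are
      -- derivations with the same values on the `x_i`.
      refine (c.diffSystem h).op_mem_opSubring_of_δ_eq ϖ p m k hR (c'.diffSystem h') rfl
        (fun j i => evalOp (c'.pd j) h' (rs h (c.x i))) (fun j => ?_) ν
      change endRing.res h' (c'.pd j) = ∑ i, mulOp W _ * endRing.res h (c.pd i)
      rw [← sub_eq_zero]
      refine (((c'.isDer_pd j).res h').sub (IsDer.sum_mulOp _ _ _ fun i =>
        (c.isDer_pd i).res h)).eq_zero c h fun i => ?_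
      have hδ := fun i' => (c.diffSystem h).δ_x i' i
      change ∀ i', evalOp (c.pd i') h (rs h (c.x i)) = _ at hδ
      change evalOp (c'.pd j) h' (rs h (c.x i)) -
        evalOp (∑ i', mulOp W _ * endRing.res h (c.pd i')) le_rfl (rs h (c.x i)) = 0
      rw [evalOp_sum]
      simp only [evalOp_mul, evalOp_mulOp, evalOp_res, rs_self]
      rw [sub_eq_zero, Finset.sum_eq_single i]
      · rw [hδ, if_pos rfl, mul_one]
      · intro i' _ hi'
        rw [hδ, if_neg hi', mul_zero]
      · simp
  have := hle hP
  rw [DiffSystem.mem_opSubring] at this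
  have hop : (c.diffSystem h).op ϖ p m k = fun ν => endRing.res h (c.op ϖ p m k ν) :=
    funext fun ν => c.diffSystem_op ϖ p m k h ν
  rw [hop] at this
  exact this

lemma eq_zero_of_sum_op_eq_zero {B : Type*} [CommRing B] (φ : Γ(X, W) →+* B)
    (h0 : ∀ ν : ℕ, ν ≠ 0 → ∀ b : B, (ν : B) * b = 0 → b = 0)
    (hϖ : ∀ b : B, φ (const f W ϖ) * b = 0 → b = 0) (s : (Fin c.n → ℕ) →₀ B)
    (hs : ∀ a, (s.sum fun ν b => b * φ (evalOp (c.op ϖ p m k ν) h a)) = 0) : s = 0 := by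
  let := constAlgebra f W
  refine (c.diffSystem h).eq_zero_of_sum_act_op_monomial ϖ p m k φ h0 hϖ s fun μ => ?_
  simp only [diffSystem_op]
  exact hs _

/-- The operators `ϖ^{k|ν|} ∂^⟨ν⟩` preserve the powers of an ideal that contains `ϖ^k`. -/
lemma evalOp_op_mem_pow (J : Ideal Γ(X, W)) (hJ : const f W (ϖ ^ k) ∈ J) (r : ℕ)
    (ν : Fin c.n → ℕ) {a : Γ(X, W)} (ha : a ∈ J ^ r) : evalOp (c.op ϖ p m k ν) h a ∈ J ^ r := by
  induction r generalizing ν a with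
  | zero => simp
  | succ r ih =>
    -- For `ν ≠ 0` the scalar `ϖ^{k|ν|}` is itself in `J`; for `ν = 0` the operator is the identity.
    have h1 : ∀ ν, ∀ b ∈ J, evalOp (c.op ϖ p m k ν) h b ∈ J := by
      intro ν b hb
      by_cases hν : ∑ i, ν i = 0
      · have : ν = 0 := by
          ext i
          simpa using (Finset.sum_eq_zero_iff.1 hν) i (Finset.mem_univ i)
        rw [this, op_zero]
        exact hb
      · obtain ⟨l, hl⟩ := Nat.exists_eq_succ_of_ne_zero hν
        rw [Coordinates.op, evalOp_mul, evalOp_mulOp, map_pow, rs_const, pow_mul, ← map_pow, hl,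
          pow_succ', mul_assoc]
        exact J.mul_mem_right _ hJ
    rw [pow_succ'] at ha
    refine Submodule.mul_induction_on ha (fun b hb d hd => ?_) fun b d hb hd => ?_
    · rw [evalOp_op_mul]
      refine sum_mem fun μ _ => Ideal.mul_mem_left _ _ ?_
      rw [pow_succ']
      exact Ideal.mul_mem_mul (h1 _ _ hb) (ih _ hd)
    · rw [map_add]
      exact add_mem hb hd

end Coordinates

end Coordinates


/-! ### Charts of the blow-up -/

section Rees

variable {A : Type u} [CommRing A] (I : Ideal A)

/-- The element `a Tⁿ` of the Rees algebra. -/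
noncomputable def reesMonomial {n : ℕ} {a : A} (ha : a ∈ I ^ n) : reesAlgebra I :=
  ⟨Polynomial.monomial n a, reesAlgebra.monomial_mem.2 ha⟩

lemma reesMonomial_mem {n : ℕ} {a : A} (ha : a ∈ I ^ n) : reesMonomial I ha ∈ reesGrading I n :=
  fun i hi => by simp [reesMonomial, Polynomial.coeff_monomial, hi.symm]

lemma exists_eq_reesMonomial {n : ℕ} {z : reesAlgebra I} (hz : z ∈ reesGrading I n) :
    ∃ (a : A) (ha : a ∈ I ^ n), z = reesMonomial I ha := by
  refine ⟨(z : A[X]).coeff n, z.2 n, Subtype.ext (Polynomial.ext fun i => ?_)⟩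
  by_cases hi : i = n
  · subst hi; simp [reesMonomial]
  · rw [hz i hi]; simp [reesMonomial, Polynomial.coeff_monomial, Ne.symm hi]

lemma reesMonomial_mul {n m : ℕ} {a b : A} (ha : a ∈ I ^ n) (hb : b ∈ I ^ m) :
    reesMonomial I ha * reesMonomial I hb =
      reesMonomial I (n := n + m) (a := a * b) (by rw [pow_add]; exact Ideal.mul_mem_mul ha hb) :=
  Subtype.ext (Polynomial.monomial_mul_monomial _ _ _ _)

lemma reesMonomial_pow {n : ℕ} {a : A} (ha : a ∈ I ^ n) (r : ℕ) :
    reesMonomial I ha ^ r =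
      reesMonomial I (n := n * r) (a := a ^ r) (by rw [pow_mul]; exact Ideal.pow_mem_pow ha r) :=
  Subtype.ext (Polynomial.monomial_pow _ _ _)

lemma algebraMap_mul_reesMonomial (c : A) {n : ℕ} {a : A} (ha : a ∈ I ^ n) :
    algebraMap A (reesAlgebra I) c * reesMonomial I ha =
      reesMonomial I (n := n) (a := c * a) (Ideal.mul_mem_left _ _ ha) :=
  Subtype.ext (Polynomial.C_mul_monomial)

lemma reesMonomial_congr {n m : ℕ} {a b : A} (ha : a ∈ I ^ n) (hb : b ∈ I ^ m) (h : n = m)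
    (h' : a = b) : reesMonomial I ha = reesMonomial I hb := by
  subst h h'; rfl

/-- The map from `A` to the degree `0` part of the localization of the Rees algebra at `z`. -/
noncomputable def awayHom (z : reesAlgebra I) :
    A →+* HomogeneousLocalization.Away (reesGrading I) z :=
  (HomogeneousLocalization.fromZeroRingHom (reesGrading I) _).comp (algebraMap A (reesGrading I 0))

lemma val_awayHom (z : reesAlgebra I) (c : A) :
    (awayHom I z c).val = algebraMap (reesAlgebra I) (Localization.Away z)
      (algebraMap A (reesAlgebra I) c) := by
  rw [← Localization.mk_one_eq_algebraMap]
  rfl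

variable {I} {n : ℕ} {a : A} (ha : a ∈ I ^ n)

/-- The element `b Tⁿʳ / (a Tⁿ)ʳ`. -/
noncomputable def awayFrac (r : ℕ) {b : A} (hb : b ∈ I ^ (n * r)) :
    HomogeneousLocalization.Away (reesGrading I) (reesMonomial I ha) :=
  HomogeneousLocalization.Away.mk _ (reesMonomial_mem I ha) r (reesMonomial I hb) (by
    rw [smul_eq_mul, mul_comm]
    exact reesMonomial_mem I hb)

lemma exists_eq_awayFrac (z : HomogeneousLocalization.Away (reesGrading I) (reesMonomial I ha)) :
    ∃ (r : ℕ) (b : A) (hb : b ∈ I ^ (n * r)), z = awayFrac ha r hb := by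
  obtain ⟨r, y, hy, rfl⟩ :=
    HomogeneousLocalization.Away.mk_surjective _ (reesMonomial_mem I ha) z
  have hy' : y ∈ reesGrading I (n * r) := by
    rwa [smul_eq_mul, mul_comm] at hy
  obtain ⟨b, hb, rfl⟩ := exists_eq_reesMonomial I hy'
  exact ⟨r, b, hb, rfl⟩

lemma awayHom_pow_mul_awayFrac (r : ℕ) {b : A} (hb : b ∈ I ^ (n * r)) :
    awayHom I (reesMonomial I ha) (a ^ r) * awayFrac ha r hb = awayHom I (reesMonomial I ha) b := by
  ext
  rw [HomogeneousLocalization.val_mul, val_awayHom, val_awayHom, awayFrac,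
    HomogeneousLocalization.Away.val_mk, ← Localization.mk_one_eq_algebraMap,
    ← Localization.mk_one_eq_algebraMap, Localization.mk_mul, Localization.mk_eq_mk_iff,
    Localization.r_iff_exists]
  refine ⟨1, ?_⟩
  simp only [Submonoid.coe_one, one_mul]
  rw [algebraMap_mul_reesMonomial, reesMonomial_pow, mul_comm _ (algebraMap _ _ b),
    algebraMap_mul_reesMonomial]
  exact reesMonomial_congr I _ _ rfl (mul_comm _ _)

/-- A fraction vanishes when a power of its denominator kills the numerator in the Rees algebra. For
monomials this is an equation `a^q c b = 0` between single coefficients in `A`, where `c` cancels.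
-/
lemma eq_zero_of_awayHom_mul {c : A} (hc : ∀ b, c * b = 0 → b = 0)
    {z : HomogeneousLocalization.Away (reesGrading I) (reesMonomial I ha)}
    (h : awayHom I (reesMonomial I ha) c * z = 0) : z = 0 := by
  obtain ⟨r, b, hb, rfl⟩ := exists_eq_awayFrac ha z
  have h' := congrArg HomogeneousLocalization.val h
  rw [HomogeneousLocalization.val_mul, val_awayHom, HomogeneousLocalization.val_zero, awayFrac,
    HomogeneousLocalization.Away.val_mk, Localization.mk_eq_mk', ← IsLocalization.mk'_one
      (M := Submonoid.powers (reesMonomial I ha)), ← IsLocalization.mk'_mul, 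
    IsLocalization.mk'_eq_zero_iff] at h'
  obtain ⟨⟨_, q, rfl⟩, hq⟩ := h'
  ext
  rw [awayFrac, HomogeneousLocalization.Away.val_mk, HomogeneousLocalization.val_zero,
    Localization.mk_eq_mk', IsLocalization.mk'_eq_zero_iff]
  refine ⟨⟨_, q, rfl⟩, ?_⟩
  dsimp only at hq ⊢
  rw [algebraMap_mul_reesMonomial, reesMonomial_pow, reesMonomial_mul] at hq
  rw [reesMonomial_pow, reesMonomial_mul]
  have h1 := congrArg (fun z : reesAlgebra I => (z : A[X]).coeff (n * q + n * r)) hq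
  simp only [reesMonomial, Polynomial.coeff_monomial, if_true] at h1
  have h2 : a ^ q * b = 0 := hc _ (by rw [mul_left_comm, h1]; simp)
  exact Subtype.ext (by simp [reesMonomial, h2])

end Rees

section Chart

variable {X Y : Scheme.{u}} {pr : X ⟶ Y}

lemma fromSpec_appLE_top {V : Y.Opens} (hV : IsAffineOpen V) (e : ⊤ ≤ hV.fromSpec ⁻¹ᵁ V) :
    hV.fromSpec.appLE V ⊤ e = (Scheme.ΓSpecIso Γ(Y, V)).inv := by
  rw [Scheme.Hom.appLE, hV.fromSpec_app_self, Category.assoc, ← Functor.map_comp]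
  exact (congrArg _ ((Spec Γ(Y, V)).presheaf.map_id _)).trans (Category.comp_id _)

/-- Functions on an affine chart. -/
lemma exists_ringHom_chart {B : CommRingCat.{u}} (j : Spec B ⟶ X) [IsOpenImmersion j]
    {V : Y.Opens} (hV : IsAffineOpen V) (φ : Γ(Y, V) ⟶ B)
    (h : j ≫ pr = Spec.map φ ≫ hV.fromSpec) :
    ∃ (hle : j ''ᵁ ⊤ ≤ pr ⁻¹ᵁ V) (ψ : B →+* Γ(X, j ''ᵁ ⊤)), Function.Bijective ψ ∧
      ∀ c, ψ (φ c) = rs hle (pr.app V c) := by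
  have hle : j ''ᵁ ⊤ ≤ pr ⁻¹ᵁ V := by
    rintro _ ⟨y, -, rfl⟩
    change pr (j y) ∈ V
    rw [← Scheme.Hom.comp_apply, h, Scheme.Hom.comp_apply]
    have : hV.fromSpec (Spec.map φ y) ∈ hV.fromSpec.opensRange := ⟨_, rfl⟩
    rwa [hV.opensRange_fromSpec] at this
  have htop : ⊤ ≤ hV.fromSpec ⁻¹ᵁ V := by rw [hV.fromSpec_preimage_self]
  refine ⟨hle, ((Scheme.ΓSpecIso B).inv ≫ (j.appIso ⊤).inv).hom,
    ConcreteCategory.bijective_of_isIso ((Scheme.ΓSpecIso B).inv ≫ (j.appIso ⊤).inv), fun c => ?_⟩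
  have h1 : φ ≫ (Scheme.ΓSpecIso B).inv = pr.appLE V (j ''ᵁ ⊤) hle ≫
      j.appLE (j ''ᵁ ⊤) ⊤ (j.preimage_image_eq ⊤).ge := by
    rw [Scheme.Hom.appLE_comp_appLE]
    simp only [h]
    rw [← Scheme.Hom.appLE_comp_appLE _ _ V ⊤ ⊤ htop (by simp), fromSpec_appLE_top,
      Scheme.ΓSpecIso_inv_naturality]
    refine congrArg (_ ≫ ·) ?_
    exact ((congrArg _ ((Spec B).presheaf.map_id _)).trans (Category.comp_id _)).symm
  change (φ ≫ (Scheme.ΓSpecIso B).inv ≫ (j.appIso ⊤).inv) c = _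
  rw [← Category.assoc, h1, ← Scheme.Hom.appIso_hom', Category.assoc, Iso.hom_inv_id,
    Category.comp_id]
  rfl

lemma iso_inv_hom_apply (e : X ≅ Y) (x : X) : e.inv (e.hom x) = x := by
  rw [← Scheme.Hom.comp_apply, e.hom_inv_id]
  rfl

lemma iso_hom_inv_apply (e : X ≅ Y) (y : Y) : e.hom (e.inv y) = y :=
  iso_inv_hom_apply e.symm y

/-- The basic opens attached to homogeneous elements of positive degree form a basis. -/
lemma exists_basicOpen_le_of_mem {σ A : Type u} [CommRing A] [SetLike σ A] [AddSubgroupClass σ A]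
    (𝒜 : ℕ → σ) [GradedRing 𝒜] {U : (Proj 𝒜).Opens} {x : Proj 𝒜} (hx : x ∈ U) :
    ∃ n, 0 < n ∧ ∃ z ∈ 𝒜 n, x ∈ Proj.basicOpen 𝒜 z ∧ Proj.basicOpen 𝒜 z ≤ U := by
  obtain ⟨_, ⟨z, rfl⟩, hxz, hzU⟩ :=
    (Opens.isBasis_iff_nbhd.1 (Proj.isBasis_basicOpen 𝒜)) hx
  rw [Proj.basicOpen_eq_iSup_proj, Opens.mem_iSup] at hxz
  obtain ⟨i, hi⟩ := hxz
  have hle : Proj.basicOpen 𝒜 (GradedRing.proj 𝒜 i z) ≤ U := by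
    refine le_trans ?_ hzU
    rw [Proj.basicOpen_eq_iSup_proj 𝒜 z]
    exact le_iSup (fun i => Proj.basicOpen 𝒜 (GradedRing.proj 𝒜 i z)) i
  -- The component found above may have degree zero. It is multiplied by some `w` of positive degree
  -- not vanishing at `x`, which exists because such elements generate the irrelevant ideal.
  obtain ⟨l, hl, w, hwl, hw⟩ : ∃ l, 0 < l ∧ ∃ w ∈ 𝒜 l, x ∈ Proj.basicOpen 𝒜 w := by
    have h := Proj.iSup_basicOpen_eq_top 𝒜 (fun w : {w // ∃ l, 0 < l ∧ w ∈ 𝒜 l} => w.1) (by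
      classical
      intro z hz
      rw [← DirectSum.sum_support_decompose 𝒜 z]
      refine Ideal.sum_mem _ fun c hc => ?_
      rcases Nat.eq_zero_or_pos c with rfl | hc0
      · rw [← GradedRing.proj_apply, (HomogeneousIdeal.mem_irrelevant_iff _ _).1 hz]
        exact zero_mem _
      · exact Ideal.subset_span ⟨⟨_, c, hc0, SetLike.coe_mem _⟩, rfl⟩)
    obtain ⟨⟨w, l, hl, hwl⟩, hw⟩ := Opens.mem_iSup.1 (h.ge (Set.mem_univ x))
    exact ⟨l, hl, w, hwl, hw⟩
  refine ⟨i + l, Nat.add_pos_right _ hl, GradedRing.proj 𝒜 i z * w,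
    SetLike.mul_mem_graded (SetLike.coe_mem _) hwl, ?_, ?_⟩
  · rw [Proj.basicOpen_mul]
    exact ⟨hi, hw⟩
  · rw [Proj.basicOpen_mul]
    exact inf_le_left.trans hle

/-- Functions on an affine chart of a scheme isomorphic to `pr⁻¹ V`. -/
lemma exists_ringHom_chart_of_iso {B : Type u} [CommRing B] {P : Scheme.{u}}
    (j : Spec (.of B) ⟶ P) [IsOpenImmersion j] {V : Y.Opens} (hV : IsAffineOpen V)
    (e : (pr ⁻¹ᵁ V).toScheme ≅ P) (φ : Γ(Y, V) →+* B)
    (h : j ≫ e.inv ≫ (pr ⁻¹ᵁ V).ι ≫ pr = Spec.map (CommRingCat.ofHom φ) ≫ hV.fromSpec)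
    {U : X.Opens} {x : (pr ⁻¹ᵁ V).toScheme} (hx : e.hom x ∈ j.opensRange)
    (hU : j.opensRange ≤ e.inv ⁻¹ᵁ ((pr ⁻¹ᵁ V).ι ⁻¹ᵁ U)) :
    ∃ (D : X.Opens) (hD : D ≤ pr ⁻¹ᵁ V) (ψ : B →+* Γ(X, D)), x.1 ∈ D ∧ D ≤ U ∧
      Function.Bijective ψ ∧ ∀ c, ψ (φ c) = ((rs hD).comp (pr.app V).hom) c := by
  obtain ⟨hle, ψ, hψ, hψc⟩ := exists_ringHom_chart (pr := pr) (j ≫ e.inv ≫ (pr ⁻¹ᵁ V).ι) hV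
    (CommRingCat.ofHom φ) (by simpa only [Category.assoc] using h)
  refine ⟨_, hle, ψ, ?_, ?_, hψ, hψc⟩
  · obtain ⟨w, hw⟩ := hx
    refine ⟨w, trivial, ?_⟩
    change ((pr ⁻¹ᵁ V).ι (e.inv (j w)) : X) = x.1
    rw [hw, iso_inv_hom_apply]
    rfl
  · rintro _ ⟨w, -, rfl⟩
    exact hU ⟨w, rfl⟩

lemma specMap_awayHom {A : Type u} [CommRing A] (J : Ideal A) (z : reesAlgebra J) :
    Spec.map (CommRingCat.ofHom (HomogeneousLocalization.fromZeroRingHom (reesGrading J)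
      (Submonoid.powers z))) ≫ Spec.map (CommRingCat.ofHom (S := reesGrading J 0)
        (algebraMap A (reesGrading J 0))) = Spec.map (CommRingCat.ofHom (awayHom J z)) := by
  rw [← Spec.map_comp]
  rfl

/-- `g : A → C` makes `C` the ring of fractions `b / aʳ` with `b ∈ Jⁿʳ`. -/
structure IsFractionChart {A C : Type*} [CommRing A] [CommRing C] (J : Ideal A) (n : ℕ) (a : A)
    (g : A →+* C) : Prop where
  mem : a ∈ J ^ n
  exists_eq : ∀ s : C, ∃ (r : ℕ), ∃ b ∈ J ^ (n * r), g (a ^ r) * s = g b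
  dvd : ∀ r, ∀ b ∈ J ^ (n * r), ∃ t, g b = g (a ^ r) * t
  eq_zero : ∀ c : A, (∀ b, c * b = 0 → b = 0) → ∀ t, g c * t = 0 → t = 0

lemma isFractionChart_awayHom {A : Type u} {C : Type*} [CommRing A] [CommRing C] {J : Ideal A}
    {n : ℕ} {a : A} (ha : a ∈ J ^ n)
    (ψ : HomogeneousLocalization.Away (reesGrading J) (reesMonomial J ha) →+* C)
    (hψ : Function.Bijective ψ) (g : A →+* C) (hg : ∀ c, ψ (awayHom J (reesMonomial J ha) c) = g c) :
    IsFractionChart J n a g where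
  mem := ha
  exists_eq s := by
    obtain ⟨s, rfl⟩ := hψ.2 s
    obtain ⟨r, b, hb, rfl⟩ := exists_eq_awayFrac ha s
    exact ⟨r, b, hb, by rw [← hg, ← hg, ← map_mul, awayHom_pow_mul_awayFrac]⟩
  dvd r b hb := ⟨ψ (awayFrac ha r hb), by rw [← hg, ← hg, ← map_mul, awayHom_pow_mul_awayFrac]⟩
  eq_zero c hc t ht := by
    obtain ⟨t, rfl⟩ := hψ.2 t
    rw [← hg, ← map_mul] at ht
    rw [eq_zero_of_awayHom_mul ha hc (hψ.1 (ht.trans (map_zero ψ).symm)), map_zero]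

/-- The blow-up has a basis of opens on which the functions are the fractions `b / aʳ`, where
`a ∈ Iⁿ` and `b ∈ Iⁿʳ`. -/
lemma IsBlowup.exists_chart {I : Y.IdealSheafData} (hpr : IsBlowup pr I) (V : Y.affineOpens)
    {U : X.Opens} {x : X} (hxU : x ∈ U) (hxV : x ∈ pr ⁻¹ᵁ V.1) :
    ∃ (D : X.Opens) (hD : D ≤ pr ⁻¹ᵁ V.1) (n : ℕ) (a : Γ(Y, V.1)), x ∈ D ∧ D ≤ U ∧
      IsFractionChart (I.ideal V) n a ((rs hD).comp (pr.app V.1).hom) := by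
  obtain ⟨e, he⟩ := hpr V
  obtain ⟨n, hn, z, hz, hxz, hzU⟩ := exists_basicOpen_le_of_mem (reesGrading (I.ideal V))
    (U := e.inv ⁻¹ᵁ ((pr ⁻¹ᵁ V.1).ι ⁻¹ᵁ U)) (x := e.hom ⟨x, hxV⟩) (by
      have h0 : (pr ⁻¹ᵁ V.1).ι (e.inv (e.hom ⟨x, hxV⟩)) = x :=
        congrArg (pr ⁻¹ᵁ V.1).ι (iso_inv_hom_apply e ⟨x, hxV⟩)
      have h2 : (pr ⁻¹ᵁ V.1).ι (e.inv (e.hom ⟨x, hxV⟩)) ∈ U := by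
        rw [h0]
        exact hxU
      exact h2)
  obtain ⟨a, ha, rfl⟩ := exists_eq_reesMonomial _ hz
  rw [← Proj.opensRange_awayι (reesGrading (I.ideal V)) _ hz hn] at hxz hzU
  have h1 : e.inv ≫ (pr ⁻¹ᵁ V.1).ι ≫ pr = reesProjToSpec (I.ideal V) ≫ V.2.fromSpec := by
    rw [Iso.inv_comp_eq]
    exact he.symm
  obtain ⟨D, hD, ψ, hxD, hDU, hψ, hψc⟩ := exists_ringHom_chart_of_iso
    (Proj.awayι (reesGrading (I.ideal V)) _ hz hn) V.2 e
    (awayHom (I.ideal V) (reesMonomial (I.ideal V) ha)) (by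
      rw [h1, reesProjToSpec, Category.assoc, Proj.awayι_toSpecZero_assoc, ← specMap_awayHom,
        Category.assoc]) hxz hzU
  exact ⟨D, hD, n, a, hxD, hDU, isFractionChart_awayHom ha ψ hψ _ hψc⟩

/-! ### The blow-up is an isomorphism where the ideal is trivial -/

lemma coeff_zero_proj_zero {A : Type u} [CommRing A] (I : Ideal A) (z : reesAlgebra I) :
    ((GradedRing.proj (reesGrading I) 0 z : reesAlgebra I) : A[X]).coeff 0 =
      (z : A[X]).coeff 0 := by
  have h : (reesDecompose I z) 0 = reesComponent I 0 z := by
    rw [reesDecompose, DFinsupp.finsetSum_apply]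
    by_cases hs : 0 ∈ (z : A[X]).support
    · rw [Finset.sum_eq_single_of_mem 0 hs fun j _ hj =>
        DirectSum.of_eq_of_ne _ _ _ (Ne.symm hj)]
      exact DirectSum.of_eq_same _ _
    · rw [Finset.sum_eq_zero fun j hj =>
        DirectSum.of_eq_of_ne j 0 _ (by rintro rfl; exact hs hj)]
      ext
      simp [reesComponent, Polynomial.notMem_support_iff.1 hs]
  rw [GradedRing.proj_apply]
  change ((reesDecompose I z 0 : reesAlgebra I) : A[X]).coeff 0 = _
  rw [h]
  simp [reesComponent]

/-- The element `1 T` generates the irrelevant ideal. -/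
lemma reesMonomial_one_dvd {A : Type u} [CommRing A] (h1 : (1 : A) ∈ (⊤ : Ideal A) ^ 1)
    {z : reesAlgebra (⊤ : Ideal A)} (hz : (z : A[X]).coeff 0 = 0) : reesMonomial _ h1 ∣ z := by
  obtain ⟨y, hy⟩ := Polynomial.X_dvd_iff.2 hz
  refine ⟨⟨y, fun i => by rw [Ideal.top_pow]; trivial⟩, Subtype.ext ?_⟩
  rw [hy]
  simp [reesMonomial, Polynomial.monomial_one_one_eq_X]

lemma awayHom_injective {A : Type u} [CommRing A] (h1 : (1 : A) ∈ (⊤ : Ideal A) ^ 1) :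
    Function.Injective (awayHom ⊤ (reesMonomial _ h1)) := by
  rw [injective_iff_map_eq_zero]
  intro c hc
  have h' := congrArg HomogeneousLocalization.val hc
  rw [val_awayHom, HomogeneousLocalization.val_zero, IsLocalization.map_eq_zero_iff
    (Submonoid.powers (reesMonomial (⊤ : Ideal A) h1))] at h'
  obtain ⟨⟨_, q, rfl⟩, hq⟩ := h'
  dsimp only at hq
  rw [mul_comm, reesMonomial_pow, algebraMap_mul_reesMonomial] at hq
  have h2 := congrArg (fun z : reesAlgebra (⊤ : Ideal A) => (z : A[X]).coeff (1 * q)) hq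
  simpa [reesMonomial, Polynomial.coeff_monomial] using h2

lemma awayHom_surjective {A : Type u} [CommRing A] (h1 : (1 : A) ∈ (⊤ : Ideal A) ^ 1) :
    Function.Surjective (awayHom ⊤ (reesMonomial _ h1)) := by
  intro z
  obtain ⟨r, b, hb, rfl⟩ := exists_eq_awayFrac h1 z
  refine ⟨b, ?_⟩
  rw [← awayHom_pow_mul_awayFrac h1 r hb, one_pow, map_one]
  exact one_mul (awayFrac h1 r hb)

/-- The Rees algebra of the unit ideal is `A[T]`. Its `Proj` is the single chart where `T` is
invertible, on which the functions of degree zero are `A`. -/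
lemma isIso_reesProjToSpec {A : Type u} [CommRing A] : IsIso (reesProjToSpec (⊤ : Ideal A)) := by
  have h1 : (1 : A) ∈ (⊤ : Ideal A) ^ 1 := by simp
  have hT := reesMonomial_mem _ h1
  have htop : (Proj.awayι (reesGrading (⊤ : Ideal A)) _ hT one_pos).opensRange = ⊤ := by
    rw [Proj.opensRange_awayι, ← Proj.iSup_basicOpen_eq_top (reesGrading (⊤ : Ideal A))
      (fun _ : Unit => reesMonomial _ h1)]
    · simp
    · intro z hz
      rw [Set.range_const, Ideal.mem_span_singleton]
      refine reesMonomial_one_dvd h1 ?_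
      have h0 := congrArg (fun y : reesAlgebra (⊤ : Ideal A) => (y : A[X]).coeff 0)
        ((HomogeneousIdeal.mem_irrelevant_iff _ _).1 hz)
      exact (coeff_zero_proj_zero _ z).symm.trans h0
  have hcomp : Proj.awayι (reesGrading (⊤ : Ideal A)) _ hT one_pos ≫ reesProjToSpec (⊤ : Ideal A) =
      Spec.map (CommRingCat.ofHom (awayHom ⊤ (reesMonomial _ h1))) := by
    rw [reesProjToSpec, Proj.awayι_toSpecZero_assoc, ← specMap_awayHom]
  have hiso : IsIso (Proj.awayι (reesGrading (⊤ : Ideal A)) _ hT one_pos) :=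
    isIso_of_isOpenImmersion_of_opensRange_eq_top _ htop
  have : IsIso (CommRingCat.ofHom (awayHom ⊤ (reesMonomial _ h1))) :=
    (ConcreteCategory.isIso_iff_bijective _).2 ⟨awayHom_injective h1, awayHom_surjective h1⟩
  exact IsIso.of_isIso_fac_left hcomp

lemma isIso_reesProjToSpec_of_eq_top {A : Type u} [CommRing A] {J : Ideal A} (hJ : J = ⊤) :
    IsIso (reesProjToSpec J) := by
  subst hJ
  exact isIso_reesProjToSpec

lemma isIso_morphismRestrict_of_isAffineOpen {I : Y.IdealSheafData} (hpr : IsBlowup pr I)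
    (V : Y.affineOpens) (hV : I.ideal V = ⊤) : IsIso (pr ∣_ V.1) := by
  obtain ⟨e, he⟩ := hpr V
  have := isIso_reesProjToSpec_of_eq_top hV
  have h : pr ∣_ V.1 = e.hom ≫ reesProjToSpec _ ≫ V.2.isoSpec.inv := by
    rw [← cancel_mono V.1.ι, morphismRestrict_ι, ← he]
    simp only [Category.assoc]
    rfl
  rw [h]
  infer_instance

lemma isIso_morphismRestrict {I : Y.IdealSheafData} (hpr : IsBlowup pr I) (U : Y.Opens)
    (hU : ∀ V : Y.affineOpens, V.1 ≤ U → I.ideal V = ⊤) : IsIso (pr ∣_ U) := by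
  change MorphismProperty.isomorphisms Scheme.{u} (pr ∣_ U)
  refine IsZariskiLocalAtTarget.of_forall_exists_morphismRestrict fun x => ?_
  obtain ⟨W, hW, hxW, hWU⟩ := exists_isAffineOpen_mem_and_subset x.2
  refine ⟨U.ι ⁻¹ᵁ W, hxW, ?_⟩
  rw [MorphismProperty.arrow_mk_iso_iff (MorphismProperty.isomorphisms Scheme.{u})
      (morphismRestrictRestrict pr U (U.ι ⁻¹ᵁ W)),
    MorphismProperty.arrow_mk_iso_iff (MorphismProperty.isomorphisms Scheme.{u})
      (morphismRestrictEq pr (V := W) (by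
        rw [Scheme.Hom.image_preimage_eq_opensRange_inf, Scheme.Opens.opensRange_ι]
        exact inf_eq_right.2 hWU))]
  exact isIso_morphismRestrict_of_isAffineOpen hpr ⟨W, hW⟩ (hU ⟨W, hW⟩ hWU)

end Chart


/-! ### Modifications -/

section Modification

variable {X Y : Scheme.{u}} (pr : X ⟶ Y) (Z : Y.Opens)

/-- `pr` is an isomorphism over the open subset `Z`, and functions on `X` are determined by their
restrictions to the inverse image of `Z`. -/
structure IsModification : Prop where
  bijective : ∀ W ≤ Z, Function.Bijective (pr.app W)
  le_of_preimage_le : ∀ {W W' : Y.Opens}, W ≤ Z → pr ⁻¹ᵁ W ≤ pr ⁻¹ᵁ W' → W ≤ W'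
  exists_eq_preimage : ∀ U ≤ pr ⁻¹ᵁ Z, ∃ W ≤ Z, U = pr ⁻¹ᵁ W
  eq_zero : ∀ {U : X.Opens} {s : Γ(X, U)}, rs (inf_le_left : U ⊓ pr ⁻¹ᵁ Z ≤ U) s = 0 → s = 0

variable {pr Z}

lemma isModification_of_isIso [IsIso (pr ∣_ Z)]
    (h : ∀ {U : X.Opens} {s : Γ(X, U)}, rs (inf_le_left : U ⊓ pr ⁻¹ᵁ Z ≤ U) s = 0 → s = 0) :
    IsModification pr Z where
  bijective W hW := by
    have h1 : MorphismProperty.isomorphisms Scheme.{u} (pr ∣_ W) := by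
      rw [← MorphismProperty.arrow_mk_iso_iff (MorphismProperty.isomorphisms Scheme.{u})
          (morphismRestrictEq pr (U := Z.ι ''ᵁ (Z.ι ⁻¹ᵁ W)) (V := W) (by
            rw [Scheme.Hom.image_preimage_eq_opensRange_inf, Scheme.Opens.opensRange_ι]
            exact inf_eq_right.2 hW)),
        ← MorphismProperty.arrow_mk_iso_iff (MorphismProperty.isomorphisms Scheme.{u})
          (morphismRestrictRestrict pr Z (Z.ι ⁻¹ᵁ W))]
      exact inferInstanceAs (IsIso (pr ∣_ Z ∣_ (Z.ι ⁻¹ᵁ W)))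
    have h2 : IsIso (pr ∣_ W) := h1
    have h3 : IsIso (pr.app (W.ι ''ᵁ ⊤)) := by
      have h4 := morphismRestrict_appTop pr W
      have h5 : IsIso (pr.app (W.ι ''ᵁ ⊤) ≫
          X.presheaf.map (eqToHom (image_morphismRestrict_preimage pr W ⊤)).op) := by
        rw [← h4]
        exact inferInstanceAs (IsIso ((pr ∣_ W).app ⊤))
      exact IsIso.of_isIso_comp_right _
        (X.presheaf.map (eqToHom (image_morphismRestrict_preimage pr W ⊤)).op)
    rw [W.ι_image_top] at h3
    exact ConcreteCategory.bijective_of_isIso (pr.app W)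
  le_of_preimage_le {W W'} hW hWW' y hy := by
    have h1 : (pr ∣_ Z) (inv (pr ∣_ Z) ⟨y, hW hy⟩) = ⟨y, hW hy⟩ :=
      iso_hom_inv_apply (asIso (pr ∣_ Z)) _
    have h2 := morphismRestrict_base_coe pr Z (inv (pr ∣_ Z) ⟨y, hW hy⟩)
    rw [h1] at h2
    have h3 : (inv (pr ∣_ Z) ⟨y, hW hy⟩).1 ∈ pr ⁻¹ᵁ W := by
      change pr _ ∈ W
      rw [← h2]
      exact hy
    have h4 : pr _ ∈ W' := hWW' h3
    rw [← h2] at h4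
    exact h4
  exists_eq_preimage U hU := by
    refine ⟨Z.ι ''ᵁ (inv (pr ∣_ Z) ⁻¹ᵁ ((pr ⁻¹ᵁ Z).ι ⁻¹ᵁ U)), ?_, ?_⟩
    · exact Scheme.Opens.ι_image_le _ _
    · rw [← image_morphismRestrict_preimage, ← Scheme.Hom.comp_preimage, IsIso.hom_inv_id,
        Scheme.Hom.id_preimage, Scheme.Hom.image_preimage_eq_opensRange_inf,
        Scheme.Opens.opensRange_ι]
      exact (inf_eq_right.2 hU).symm
  eq_zero := h

end Modification

/-! ### Torsion in a blow-up and the locus where it is an isomorphism -/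

section Blowup

variable {X Y : Scheme.{u}} {R : CommRingCat.{u}} (f : Y ⟶ Spec R) {pr : X ⟶ Y}
  {I : Y.IdealSheafData}

lemma app_const (V : Y.Opens) (r : R) : pr.app V (const f V r) = const (pr ≫ f) (pr ⁻¹ᵁ V) r := by
  change pr.app V (rs le_top (f.appTop _)) = rs le_top ((pr ≫ f).appTop _)
  rw [app_rs]
  rfl

/-- A blow-up of a flat scheme is torsion free. -/
lemma IsBlowup.eq_zero_of_const_mul [Flat f] [IsDomain R] (hpr : IsBlowup pr I) {r : R} (hr : r ≠ 0)
    {U : X.Opens} {s : Γ(X, U)} (h : const (pr ≫ f) U r * s = 0) : s = 0 := by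
  refine rs_ext fun x hx => ?_
  obtain ⟨V, hV, hxV, -⟩ := exists_isAffineOpen_mem_and_subset (U := ⊤) (x := pr x) trivial
  obtain ⟨D, hD, n, a, hxD, hDU, hF⟩ := hpr.exists_chart ⟨V, hV⟩ hx hxV
  refine ⟨D, hDU, hxD, ?_⟩
  rw [map_zero]
  refine hF.eq_zero (const f V r) (fun b => ArithDiff.eq_zero_of_const_mul f hr) _ ?_
  have h' := congrArg (rs hDU) h
  rw [map_mul, map_zero, rs_const] at h'
  rw [RingHom.comp_apply]
  change rs hD (pr.app V _) * _ = 0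
  rw [app_const, rs_const]
  exact h'

lemma IsBlowup.eq_zero_of_natCast_mul [Flat f] [IsDomain R] [CharZero R] (hpr : IsBlowup pr I)
    {n : ℕ} (hn : n ≠ 0) {U : X.Opens} {s : Γ(X, U)} (h : (n : Γ(X, U)) * s = 0) : s = 0 := by
  refine hpr.eq_zero_of_const_mul f (r := (n : R)) (Nat.cast_ne_zero.2 hn) ?_
  rwa [map_natCast]

/-- A blow-up in an ideal that contains a power of `ϖ` is an isomorphism where `ϖ` is
invertible. -/
lemma IsBlowup.isModification [Flat f] [IsDomain R] (hpr : IsBlowup pr I) {ϖ : R} (hϖ : ϖ ≠ 0)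
    {N : ℕ} (hI : ∀ U : Y.affineOpens, const f U.1 (ϖ ^ N) ∈ I.ideal U) :
    IsModification pr (Y.basicOpen (const f ⊤ ϖ)) := by
  have : IsIso (pr ∣_ Y.basicOpen (const f ⊤ ϖ)) := by
    -- Over this open set the ideal contains the unit `ϖ^N`.
    refine isIso_morphismRestrict hpr _ fun V hV => ?_
    refine Ideal.eq_top_of_isUnit_mem _ (hI V) ?_
    rw [map_pow]
    refine IsUnit.pow _ ?_
    have h1 : IsUnit (rs (Y.basicOpen_le _) (const f ⊤ ϖ) : Γ(Y, Y.basicOpen (const f ⊤ ϖ))) :=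
      RingedSpace.isUnit_res_basicOpen _ _
    have h2 := h1.map (rs hV)
    rwa [rs_rs, rs_const] at h2
  refine isModification_of_isIso fun {U s} hs => rs_ext fun x hx => ?_
  obtain ⟨D, hD, hxD, hDU⟩ := exists_isAffineOpen_mem_and_subset hx
  refine ⟨D, hDU, hxD, ?_⟩
  have hb : X.basicOpen (const (pr ≫ f) D ϖ) ≤ U ⊓ pr ⁻¹ᵁ Y.basicOpen (const f ⊤ ϖ) := by
    refine le_inf ((X.basicOpen_le _).trans hDU) ?_
    rw [Scheme.preimage_basicOpen]
    change _ ≤ X.basicOpen (pr.app ⊤ (const f ⊤ ϖ))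
    rw [app_const, ← rs_const (pr ≫ f) (le_top : D ≤ ⊤)]
    change X.basicOpen (X.presheaf.map _ _) ≤ _
    rw [Scheme.basicOpen_res]
    exact inf_le_right
  have h1 := congrArg (rs hb) hs
  rw [rs_rs, map_zero] at h1
  -- A section over an affine open that vanishes where `ϖ` is invertible is killed by a power of
  -- `ϖ`, hence zero as `X` is torsion free.
  obtain ⟨n, hn⟩ := exists_pow_mul_eq_zero_of_res_basicOpen_eq_zero_of_isCompact X hD.isCompact
    (rs hDU s) (const (pr ≫ f) D ϖ) (by
      exact (rs_rs hDU (X.basicOpen_le _) s).trans h1)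
  rw [map_zero]
  rw [← map_pow] at hn
  exact hpr.eq_zero_of_const_mul f (pow_ne_zero n hϖ) hn

end Blowup


/-! ### Extension of operators along a modification -/

section Extension

variable {X Y : Scheme.{u}} (pr : X ⟶ Y) (Z : Y.Opens) {V : Y.Opens}

/-- The section `t` of `𝒪_X` is the value at `s` of the operator `P` on `𝒪_Y`, as far as can be
seen over `Z`. -/
def IsValue (P : endRing Y V) {U : X.Opens} (s t : Γ(X, U)) : Prop :=
  ∀ (W : Y.Opens) (hV : W ≤ V) (_ : W ≤ Z) (hU : pr ⁻¹ᵁ W ≤ U) (a : Γ(Y, W)),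
    rs hU s = pr.app W a → rs hU t = pr.app W (evalOp P hV a)

variable {pr Z} (hZ : IsModification pr Z) {P Q : endRing Y V} {U : X.Opens} {s s' t t' : Γ(X, U)}

namespace IsValue

lemma res (h : IsValue pr Z P s t) {V' : Y.Opens} (hV : V' ≤ V) {U' : X.Opens} (hU : U' ≤ U) :
    IsValue pr Z (endRing.res hV P) (rs hU s) (rs hU t) := by
  intro W hWV hWZ hWU a ha
  rw [rs_rs] at ha ⊢
  exact h W (hWV.trans hV) hWZ (hWU.trans hU) a ha

lemma rs (h : IsValue pr Z P s t) {U' : X.Opens} (hU : U' ≤ U) :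
    IsValue pr Z P (rs hU s) (rs hU t) :=
  h.res le_rfl hU

include hZ

lemma of_res {V' : Y.Opens} (hV : V' ≤ V) (hU : U ≤ pr ⁻¹ᵁ V')
    (h : IsValue pr Z (endRing.res hV P) s t) : IsValue pr Z P s t := fun W _ hWZ hWU a ha =>
  h W (hZ.le_of_preimage_le hWZ (hWU.trans hU)) hWZ hWU a ha

/-- Over `Z` the section `s` comes from a function on `Y`, which fixes the value there; sections of
`𝒪_X` are determined by what they are over `Z`. -/
lemma unique (hU : U ≤ pr ⁻¹ᵁ V) (h : IsValue pr Z P s t) (h' : IsValue pr Z P s t') : t = t' := by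
  obtain ⟨W, hWZ, hW⟩ := hZ.exists_eq_preimage (U ⊓ pr ⁻¹ᵁ Z) inf_le_right
  have hWU : pr ⁻¹ᵁ W ≤ U := hW.symm.le.trans inf_le_left
  have hWV : W ≤ V := hZ.le_of_preimage_le hWZ (hWU.trans hU)
  obtain ⟨a, ha⟩ := (hZ.bijective W hWZ).2 (ArithDiff.rs hWU s)
  have h1 : ArithDiff.rs hWU t = ArithDiff.rs hWU t' :=
    (h W hWV hWZ hWU a ha.symm).trans (h' W hWV hWZ hWU a ha.symm).symm
  rw [← sub_eq_zero]
  refine hZ.eq_zero ?_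
  rw [← rs_rs hWU hW.le, map_sub, h1, sub_self, map_zero]

lemma add (h : IsValue pr Z P s t) (h' : IsValue pr Z P s' t') :
    IsValue pr Z P (s + s') (t + t') := by
  intro W hWV hWZ hWU a ha
  obtain ⟨b, hb⟩ := (hZ.bijective W hWZ).2 (ArithDiff.rs hWU s)
  obtain ⟨b', hb'⟩ := (hZ.bijective W hWZ).2 (ArithDiff.rs hWU s')
  have hab : a = b + b' := (hZ.bijective W hWZ).1 (by
    rw [← ha, map_add, map_add]
    exact congrArg₂ _ hb.symm hb'.symm)
  rw [map_add, h W hWV hWZ hWU b hb.symm, h' W hWV hWZ hWU b' hb'.symm, hab, map_add, map_add]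

omit hZ

lemma comp (h : IsValue pr Z Q s t) (h' : IsValue pr Z P t t') : IsValue pr Z (P * Q) s t' :=
  fun W hWV hWZ hWU a ha => h' W hWV hWZ hWU _ (h W hWV hWZ hWU a ha)

lemma op_add (h : IsValue pr Z P s t) (h' : IsValue pr Z Q s t') :
    IsValue pr Z (P + Q) s (t + t') := by
  intro W hWV hWZ hWU a ha
  rw [evalOp_add, map_add, map_add, h W hWV hWZ hWU a ha, h' W hWV hWZ hWU a ha]

lemma op_neg (h : IsValue pr Z P s t) : IsValue pr Z (-P) s (-t) := by
  intro W hWV hWZ hWU a ha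
  have : evalOp (-P) hWV a = -evalOp P hWV a := rfl
  rw [this, map_neg, map_neg, h W hWV hWZ hWU a ha]

lemma op_zero : IsValue pr Z (0 : endRing Y V) s 0 := by
  intro W hWV hWZ hWU a ha
  have : evalOp (0 : endRing Y V) hWV a = 0 := rfl
  rw [this, map_zero, map_zero]

lemma op_one : IsValue pr Z (1 : endRing Y V) s s := fun _ _ _ _ _ ha => ha

lemma mulOp (hU : U ≤ pr ⁻¹ᵁ V) (a : Γ(Y, V)) (s : Γ(X, U)) :
    IsValue pr Z (mulOp V a) s (ArithDiff.rs hU (pr.app V a) * s) := by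
  intro W hWV hWZ hWU b hb
  rw [evalOp_mulOp, map_mul, map_mul, hb, rs_rs, app_rs]

lemma app {W : Y.Opens} (hW : W ≤ V) (a : Γ(Y, W)) (hZ : IsModification pr Z) :
    IsValue pr Z P (pr.app W a) (pr.app W (evalOp P hW a)) := by
  intro W' hWV hWZ hWU b hb
  have hWW := hZ.le_of_preimage_le hWZ hWU
  rw [← app_rs pr hWW, ← evalOp_rs P hW hWW] 
  rw [← app_rs pr hWW] at hb
  rw [(hZ.bijective W' hWZ).1 hb]

end IsValue

include hZ

lemma isValue_of_locally (h : ∀ x ∈ U, ∃ (U' : X.Opens) (hU : U' ≤ U), x ∈ U' ∧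
    IsValue pr Z P (rs hU s) (rs hU t)) : IsValue pr Z P s t := by
  intro W hWV hWZ hWU a ha
  refine rs_ext fun x hx => ?_
  obtain ⟨U', hU, hxU', hU'⟩ := h x (hWU hx)
  obtain ⟨W', hWZ', hW'⟩ := hZ.exists_eq_preimage (U' ⊓ pr ⁻¹ᵁ W)
    (inf_le_right.trans (pr.preimage_mono hWZ))
  have hWW : W' ≤ W := hZ.le_of_preimage_le hWZ' (hW'.symm.le.trans inf_le_right)
  have hWU' : pr ⁻¹ᵁ W' ≤ U' := hW'.symm.le.trans inf_le_left
  refine ⟨pr ⁻¹ᵁ W', pr.preimage_mono hWW, hW'.le ⟨hxU', hx⟩, ?_⟩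
  have h1 := hU' W' (hWW.trans hWV) hWZ' hWU' (rs hWW a) (by
    rw [app_rs, ← ha, rs_rs, rs_rs])
  rw [rs_rs, evalOp_rs P hWV hWW, app_rs] at h1
  rw [rs_rs, h1]

/-- By uniqueness local values agree on overlaps and glue. This reduces the construction of values
to charts. -/
lemma exists_isValue_of_locally (hU : U ≤ pr ⁻¹ᵁ V)
    (h : ∀ x ∈ U, ∃ (U' : X.Opens) (hU : U' ≤ U), x ∈ U' ∧ ∃ t, IsValue pr Z P (rs hU s) t) :
    ∃ t, IsValue pr Z P s t := by
  obtain ⟨t, ht⟩ := exists_of_locally X.sheaf (V := U)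
    (fun U' (t : Γ(X, U')) => ∃ h : U' ≤ U, IsValue pr Z P (rs h s) t)
    (fun W W' h t ht => by
      obtain ⟨h', ht⟩ := ht
      refine ⟨h.trans h', ?_⟩
      have h2 := ht.rs h
      rwa [rs_rs] at h2)
    (fun W hW t t' ht ht' => ht.2.unique hZ (hW.trans hU) ht'.2)
    (fun x hx => by
      obtain ⟨U', hU', hx', t, ht⟩ := h x hx
      exact ⟨U', hU', hx', t, hU', ht⟩)
  refine ⟨t, isValue_of_locally hZ fun x hx => ?_⟩
  obtain ⟨U', hU', hx', ht'⟩ := ht x hx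
  exact ⟨U', hU', hx', ht'.2⟩

variable (pr Z) in
omit hZ in
/-- The operator `P` extends to `X`. -/
def Extends (P : endRing Y V) : Prop :=
  ∀ (U : X.Opens) (_ : U ≤ pr ⁻¹ᵁ V) (s : Γ(X, U)), ∃ t, IsValue pr Z P s t

/-- The operators that extend to `X` form a subring. -/
def extendSubring (V : Y.Opens) : Subring (endRing Y V) where
  carrier := {P | Extends pr Z P}
  mul_mem' hP hQ U hU s := by
    obtain ⟨t, ht⟩ := hQ U hU s
    obtain ⟨t', ht'⟩ := hP U hU t
    exact ⟨t', ht.comp ht'⟩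
  one_mem' U hU s := ⟨s, .op_one⟩
  add_mem' hP hQ U hU s := by
    obtain ⟨t, ht⟩ := hP U hU s
    obtain ⟨t', ht'⟩ := hQ U hU s
    exact ⟨t + t', ht.op_add ht'⟩
  zero_mem' U hU s := ⟨0, .op_zero⟩
  neg_mem' hP U hU s := by
    obtain ⟨t, ht⟩ := hP U hU s
    exact ⟨-t, ht.op_neg⟩

lemma extends_of_locally (h : ∀ y ∈ V, ∃ (W : Y.Opens) (h : W ≤ V), y ∈ W ∧
    Extends pr Z (endRing.res h P)) : Extends pr Z P := by
  intro U hU s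
  refine exists_isValue_of_locally hZ hU fun x hx => ?_
  obtain ⟨W, hW, hxW, hWP⟩ := h (pr x) (hU hx)
  obtain ⟨t, ht⟩ := hWP (U ⊓ pr ⁻¹ᵁ W) inf_le_right (rs inf_le_left s)
  exact ⟨U ⊓ pr ⁻¹ᵁ W, inf_le_left, ⟨hx, hxW⟩, t, ht.of_res hZ hW inf_le_right⟩

omit hZ in
lemma Extends.res (h : Extends pr Z P) {V' : Y.Opens} (hV : V' ≤ V) :
    Extends pr Z (endRing.res hV P) := by
  intro U hU s
  obtain ⟨t, ht⟩ := h U (hU.trans (pr.preimage_mono hV)) s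
  refine ⟨t, ?_⟩
  have := ht.res hV le_rfl
  rwa [rs_self, rs_self] at this

/-- The extension to `X` of an operator. -/
noncomputable def Extends.extend (h : Extends pr Z P) : endRing X (pr ⁻¹ᵁ V) :=
  ⟨fun U => AddMonoidHom.mk' (fun s => (h U.1 U.2 s).choose) fun s s' =>
      IsValue.unique hZ U.2 (h U.1 U.2 (s + s')).choose_spec
        ((h U.1 U.2 s).choose_spec.add hZ (h U.1 U.2 s').choose_spec),
    fun U U' hU s => IsValue.unique hZ U'.2 (h U'.1 U'.2 _).choose_spec
      ((h U.1 U.2 s).choose_spec.rs hU)⟩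

lemma Extends.isValue (h : Extends pr Z P) (hU : U ≤ pr ⁻¹ᵁ V) (s : Γ(X, U)) :
    IsValue pr Z P s (evalOp (h.extend hZ) hU s) :=
  (h U hU s).choose_spec

lemma Extends.eq_of_isValue (h : Extends pr Z P) (hU : U ≤ pr ⁻¹ᵁ V) (hst : IsValue pr Z P s t) :
    evalOp (h.extend hZ) hU s = t :=
  (h.isValue hZ hU s).unique hZ hU hst

end Extension

/-! ### Extension of the operators of level `m` to a blow-up -/

section Blowup

variable {X Y : Scheme.{u}} {R : CommRingCat.{u}} {f : Y ⟶ Spec R} {pr : X ⟶ Y}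
  {I : Y.IdealSheafData} [Flat f] [IsDomain R] [CharZero R] {ϖ : R} {N : ℕ} {Z : Y.Opens}

lemma leibnizCoeff_self (p m : ℕ) {n : ℕ} (ν : Fin n → ℕ) : leibnizCoeff p m ν ν = 1 := by
  refine Finset.prod_eq_one fun i _ => ?_
  rw [Nat.sub_self, Nat.zero_div, Nat.factorial_zero, mul_one, Nat.div_self (Nat.factorial_pos _)]

/-- The operators of level `m` extend to the blow-up, in local coordinates. -/
lemma Coordinates.extends_op (hpr : IsBlowup pr I) (hZ : IsModification pr Z) (hϖ : ϖ ≠ 0)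
    (hI : ∀ U : Y.affineOpens, const f U.1 (ϖ ^ N) ∈ I.ideal U) (p m : ℕ) {k : ℕ} (hk : N ≤ k)
    {V : Y.Opens} (c : Coordinates f V) (ν : Fin c.n → ℕ) :
    Extends pr Z (c.op ϖ p m k ν) := by
  intro U hU s
  refine exists_isValue_of_locally hZ hU fun x hx => ?_
  obtain ⟨D, hD, n, a, hxD, hDU, hF⟩ := hpr.exists_chart ⟨V, c.affine⟩ hx (hU hx)
  refine ⟨D, hDU, hxD, ?_⟩
  generalize rs hDU s = s
  obtain ⟨r, b, hb, hs⟩ := hF.exists_eq s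
  -- This is where `N ≤ k` is needed: it puts `ϖ^k` into the ideal.
  have hJ : ∀ μ, ∀ b ∈ I.ideal ⟨V, c.affine⟩ ^ (n * r),
      evalOp (c.op ϖ p m k μ) le_rfl b ∈ I.ideal ⟨V, c.affine⟩ ^ (n * r) := fun μ b hb =>
    c.evalOp_op_mem_pow ϖ p m k le_rfl _ (by
      rw [← Nat.sub_add_cancel hk, pow_add, map_mul]
      exact Ideal.mul_mem_left _ _ (hI ⟨V, c.affine⟩)) _ _ hb
  have ha : a ^ r ∈ I.ideal ⟨V, c.affine⟩ ^ (n * r) := by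
    rw [pow_mul]
    exact Ideal.pow_mem_pow hF.mem r
  -- `α μ` and `β μ` are the quotients by `aʳ` of the operator of index `μ` applied to `aʳ` and to
  -- `b`. They are functions on the chart since the numerators stay in `Jⁿʳ`.
  choose α hα using fun μ => hF.dvd r _ (hJ μ _ ha)
  choose β hβ using fun μ => hF.dvd r _ (hJ μ _ hb)
  -- On the chart `aʳ` divides `ϖ^{Nnr}`. Nonzero constants cancel on `X`, so `aʳ` will cancel too.
  obtain ⟨γ, hγ⟩ := hF.dvd r _ (Ideal.pow_mem_pow (hI ⟨V, c.affine⟩) (n * r))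
  induction ν using WellFoundedLT.induction with
  | ind ν ih =>
  choose! t ht using ih
  -- The quotient rule: the Leibniz formula for `b = s aʳ`, divided by `aʳ` and solved for the term
  -- `μ = ν`. The lower values `t μ` exist by induction.
  refine ⟨β ν - ∑ μ ∈ Finset.Iio ν, (leibnizCoeff p m ν μ : Γ(X, D)) * (t μ * α (ν - μ)), ?_⟩
  intro W hWV hWZ hWD d hd
  have hg : ∀ b, rs hWD ((rs hD).comp (pr.app V).hom b) = pr.app W (rs hWV b) := fun b => by
    rw [app_rs, ← rs_rs hD hWD]
    rfl
  have hda : d * rs hWV (a ^ r) = rs hWV b := (hZ.bijective W hWZ).1 (by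
    rw [map_mul, ← hd, ← hg, ← hg, ← hs, map_mul, mul_comm])
  have hα' : ∀ μ, pr.app W (evalOp (c.op ϖ p m k μ) hWV (rs hWV (a ^ r))) =
      pr.app W (rs hWV (a ^ r)) * rs hWD (α μ) := fun μ => by
    rw [evalOp_rs _ le_rfl hWV, ← hg, hα, map_mul, hg]
  -- Over `Z` the Leibniz formula on `Y` applies to `d aʳ = b`, where `d` represents `s`. The term
  -- `μ = ν` is split off.
  have key := congrArg (pr.app W) (c.evalOp_op_mul ϖ p m k hWV ν d (rs hWV (a ^ r)))
  rw [hda, evalOp_rs _ le_rfl hWV, ← hg, hβ, map_mul, hg, map_sum, ← Finset.Iio_insert,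
    Finset.sum_insert Finset.notMem_Iio_self, leibnizCoeff_self, tsub_self, c.op_zero, evalOp_one,
    Nat.cast_one, one_mul, map_mul] at key
  have hsum : ∑ μ ∈ Finset.Iio ν, pr.app W ((leibnizCoeff p m ν μ : Γ(Y, W)) *
      (evalOp (c.op ϖ p m k μ) hWV d * evalOp (c.op ϖ p m k (ν - μ)) hWV (rs hWV (a ^ r)))) =
      pr.app W (rs hWV (a ^ r)) * rs hWD (∑ μ ∈ Finset.Iio ν,
        (leibnizCoeff p m ν μ : Γ(X, D)) * (t μ * α (ν - μ))) := by
    rw [map_sum, Finset.mul_sum]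
    refine Finset.sum_congr rfl fun μ hμ => ?_
    rw [map_mul, map_mul, hα', map_mul, map_mul, map_natCast, map_natCast,
      ht μ (Finset.mem_Iio.1 hμ) W hWV hWZ hWD d hd]
    ring
  rw [hsum] at key
  rw [← sub_eq_zero]
  refine hpr.eq_zero_of_const_mul f (pow_ne_zero (n * r) (pow_ne_zero N hϖ)) ?_
  have hγ' := congrArg (rs hWD) hγ
  rw [map_mul, hg, hg, ← map_pow, rs_const, app_const] at hγ'
  rw [hγ', map_sub]
  linear_combination (rs hWD γ) * key

/-- Being extendable is local and stable under ring operations, so only the generators matter. -/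
lemma extends_of_mem_levelSubrings (hpr : IsBlowup pr I) (hZ : IsModification pr Z) (hϖ : ϖ ≠ 0)
    (hI : ∀ U : Y.affineOpens, const f U.1 (ϖ ^ N) ∈ I.ideal U) (p m : ℕ) {k : ℕ} (hk : N ≤ k)
    {V : Y.Opens} {P : endRing Y V} (hP : P ∈ (levelSubrings f ϖ p m k).ring V) :
    Extends pr Z P := by
  refine extends_of_locally hZ fun y hy => ?_
  obtain ⟨W, hW, hyW, hWP⟩ := hP y hy
  refine ⟨W, hW, hyW, ?_⟩
  have hle : Subring.closure (generators f ϖ p m k W) ≤ extendSubring (pr := pr) (Z := Z) W := by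
    rw [Subring.closure_le]
    rintro Q (⟨a, rfl⟩ | ⟨U, hU, c, ν, rfl⟩)
    · exact fun U hU s => ⟨_, IsValue.mulOp hU a s⟩
    · exact (c.extends_op hpr hZ hϖ hI p m hk ν).res hU
  exact hle hWP

/-- The formula of Leibniz for the values on `X` of the operators of level `m`. -/
lemma Coordinates.isValue_op_mul (hZ : IsModification pr Z) (ϖ : R) (p m k : ℕ) {V : Y.Opens}
    (c : Coordinates f V) (ν : Fin c.n → ℕ) {U : X.Opens} {s t : Γ(X, U)}
    {S T : (Fin c.n → ℕ) → Γ(X, U)} (hS : ∀ μ, IsValue pr Z (c.op ϖ p m k μ) s (S μ))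
    (hT : ∀ μ, IsValue pr Z (c.op ϖ p m k μ) t (T μ)) :
    IsValue pr Z (c.op ϖ p m k ν) (s * t)
      (∑ μ ∈ Finset.Iic ν, (leibnizCoeff p m ν μ : Γ(X, U)) * (S μ * T (ν - μ))) := by
  intro W hWV hWZ hWU a ha
  obtain ⟨b, hb⟩ := (hZ.bijective W hWZ).2 (rs hWU s)
  obtain ⟨d, hd⟩ := (hZ.bijective W hWZ).2 (rs hWU t)
  have h1 : a = b * d := (hZ.bijective W hWZ).1 (by
    rw [← ha, map_mul, map_mul]
    exact congrArg₂ _ hb.symm hd.symm)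
  rw [h1, c.evalOp_op_mul, map_sum, map_sum]
  refine Finset.sum_congr rfl fun μ _ => ?_
  rw [map_mul, map_mul, map_mul, map_mul, map_natCast, map_natCast, hS μ W hWV hWZ hWU b hb.symm,
    hT (ν - μ) W hWV hWZ hWU d hd.symm]

end Blowup

/-! ### Morphisms out of an inverse image, by adjunction -/

section OfSections

variable {X Y : Scheme.{u}} {pr : X ⟶ Y} {𝒜 : TopCat.Sheaf RingCat.{u} Y}
  {ℬ : TopCat.Sheaf RingCat.{u} X}

/-- The morphism `pr⁻¹ 𝒜 ⟶ ℬ` with given maps `𝒜(V) → ℬ(pr⁻¹ V)`. -/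
noncomputable def ofSections (φ : 𝒜 ⟶ (TopCat.Sheaf.pushforward RingCat.{u} pr.base).obj ℬ) :
    inverseImage pr 𝒜 ⟶ ℬ :=
  ((TopCat.Sheaf.pullbackPushforwardAdjunction RingCat.{u} pr.base).homEquiv 𝒜 ℬ).symm φ

lemma onSections_ofSections (φ : 𝒜 ⟶ (TopCat.Sheaf.pushforward RingCat.{u} pr.base).obj ℬ)
    (V : Y.Opens) : onSections (ofSections φ) V = (φ.hom.app (op V)).hom :=
  congrArg (fun φ : 𝒜 ⟶ (TopCat.Sheaf.pushforward RingCat.{u} pr.base).obj ℬ =>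
    (φ.hom.app (op V)).hom) (Equiv.apply_symm_apply
      ((TopCat.Sheaf.pullbackPushforwardAdjunction RingCat.{u} pr.base).homEquiv 𝒜 ℬ) φ)

end OfSections

/-! ### The action of the operators on the functions on the modification -/

section Action

variable {X Y : Scheme.{u}} {R : CommRingCat.{u}} {f : Y ⟶ Spec R} {pr : X ⟶ Y} {ϖ : R}
  {p m k : ℕ} {Z : Y.Opens} (hZ : IsModification pr Z)
  (hE : ∀ {V : Y.Opens} {P : endRing Y V}, P ∈ (levelSubrings f ϖ p m k).ring V → Extends pr Z P)

/-- Uniqueness of values, in the form used to prove that extension is a ring homomorphism. -/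
lemma extend_eq {V : Y.Opens} {P : (levelSubrings f ϖ p m k).ring V} {Q : endRing X (pr ⁻¹ᵁ V)}
    (h : ∀ (U : X.Opens) (hU : U ≤ pr ⁻¹ᵁ V) (s : Γ(X, U)), IsValue pr Z P.1 s (evalOp Q hU s)) :
    (hE P.2).extend hZ = Q :=
  endRing_ext fun U hU s => (hE P.2).eq_of_isValue hZ hU (h U hU s)

/-- The extension to `X` of the operators of level `m`, on sections. -/
noncomputable def extendHom (V : Y.Opens) :
    (levelSubrings f ϖ p m k).ring V →+* (endSubrings X).ring (pr ⁻¹ᵁ V) :=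
  RingHom.codRestrict
    { toFun P := (hE P.2).extend hZ
      map_one' := extend_eq hZ hE (V := V) (P := 1) fun _ _ _ => .op_one
      map_mul' P Q := extend_eq hZ hE (V := V) (P := P * Q) fun _ hU s =>
        ((hE Q.2).isValue hZ hU s).comp ((hE P.2).isValue hZ hU _)
      map_zero' := extend_eq hZ hE (V := V) (P := 0) fun _ _ _ => .op_zero
      map_add' P Q := extend_eq hZ hE (V := V) (P := P + Q) fun _ hU s =>
        ((hE P.2).isValue hZ hU s).op_add ((hE Q.2).isValue hZ hU s) }
    ((endSubrings X).ring (pr ⁻¹ᵁ V)) fun _ => trivial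

lemma isValue_extendHom {V : Y.Opens} (P : (levelSubrings f ϖ p m k).ring V) {U : X.Opens}
    (hU : U ≤ pr ⁻¹ᵁ V) (s : Γ(X, U)) :
    IsValue pr Z P.1 s (evalOp (extendHom hZ hE V P).1 hU s) :=
  (hE P.2).isValue hZ hU s

/-- The action on `𝒪_X` of the operators of level `m` on `𝒪_Y`. -/
noncomputable def extendAction : inverseImage pr (levelSheaf f ϖ p m k) ⟶ endSheaf X :=
  ofSections
    { hom :=
        { app V := RingCat.ofHom (extendHom hZ hE V.unop)
          naturality V V' i := by
            ext P
            refine Subtype.ext (endRing_ext fun W hW s => ?_)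
            refine IsValue.unique hZ hW (isValue_extendHom hZ hE _ hW s) ?_
            have h := (isValue_extendHom hZ hE (V := V.unop) P
              (hW.trans (pr.preimage_mono i.unop.le)) s).res i.unop.le le_rfl
            rw [rs_self, rs_self] at h
            exact h } }

lemma onSections_extendAction (V : Y.Opens) :
    onSections (extendAction hZ hE) V = extendHom hZ hE V :=
  onSections_ofSections _ V

/-- In each condition both sides are values of the same operator at the same section, hence equal.
-/
lemma isCompatibleAction_extendAction [Flat f] [IsDomain R] [CharZero R] :
    IsCompatibleAction f ϖ p m k pr (extendAction hZ hE) where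
  linear V P W h a := by
    rw [onSections_extendAction]
    exact (isValue_extendHom hZ hE P _ _).unique hZ (pr.preimage_mono h) (.app h a hZ)
  mul V a := by
    rw [onSections_extendAction]
    exact endRing_ext fun W hW s => (isValue_extendHom hZ hE _ hW s).unique hZ hW (.mulOp hW a s)
  leibniz {V} c ν U h s t := by
    rw [onSections_extendAction]
    refine (isValue_extendHom hZ hE _ h _).unique hZ h ?_
    exact c.isValue_op_mul hZ ϖ p m k ν (fun μ => isValue_extendHom hZ hE (c.levelSection ϖ p m k μ) h s)
      (fun μ => isValue_extendHom hZ hE (c.levelSection ϖ p m k μ) h t)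

end Action


/-! ### Sections of modules -/

section Modules

variable {X : Scheme.{u}} {M N : X.Modules} {U V W : X.Opens}

/-- Restriction of sections of a module. -/
noncomputable def mrs (M : X.Modules) (h : W ≤ V) : Γ(M, V) →+ Γ(M, W) :=
  (M.presheaf.map (homOfLE h).op).hom

lemma mrs_mrs (h : V ≤ U) (h' : W ≤ V) (s : Γ(M, U)) :
    mrs M h' (mrs M h s) = mrs M (h'.trans h) s := by
  change (M.presheaf.map (homOfLE h).op ≫ M.presheaf.map (homOfLE h').op) s = _
  rw [← Functor.map_comp]
  rfl

lemma mrs_self (h : V ≤ V) (s : Γ(M, V)) : mrs M h s = s := by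
  change (M.presheaf.map (𝟙 (op V))) s = s
  rw [M.presheaf.map_id]
  rfl

lemma mrs_smul (h : W ≤ V) (a : Γ(X, V)) (s : Γ(M, V)) :
    mrs M h (a • s) = rs h a • mrs M h s :=
  Scheme.Modules.map_smul M (homOfLE h) a s

lemma mrs_ext {s t : Γ(M, V)}
    (h : ∀ x ∈ V, ∃ (W : X.Opens) (h : W ≤ V), x ∈ W ∧ mrs M h s = mrs M h t) : s = t := by
  choose W hW hxW hs using fun x : V => h x.1 x.2
  exact TopCat.Sheaf.eq_of_locally_eq' ⟨M.presheaf, M.isSheaf⟩ W V (fun x => homOfLE (hW x))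
    (fun x hx => Opens.mem_iSup.2 ⟨⟨x, hx⟩, hxW ⟨x, hx⟩⟩) s t hs

lemma mrs_exists_of_locally (Q : ∀ W : X.Opens, Γ(M, W) → Prop)
    (hres : ∀ (W W' : X.Opens) (h : W' ≤ W) t, Q W t → Q W' (mrs M h t))
    (huniq : ∀ W ≤ V, ∀ t t', Q W t → Q W t' → t = t')
    (hex : ∀ x ∈ V, ∃ W ≤ V, x ∈ W ∧ ∃ t, Q W t) :
    ∃ t, ∀ x ∈ V, ∃ (W : X.Opens) (h : W ≤ V), x ∈ W ∧ Q W (mrs M h t) :=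
  exists_of_locally (C := Ab.{u}) ⟨M.presheaf, M.isSheaf⟩ Q hres huniq hex

lemma app_mrs (φ : M ⟶ N) (h : W ≤ V) (s : Γ(M, V)) :
    φ.app W (mrs M h s) = mrs N h (φ.app V s) :=
  congr($(φ.mapPresheaf.naturality (homOfLE h).op) s)

/-- Construction of morphisms of modules. -/
noncomputable def modulesHom (g : ∀ U : X.Opens, Γ(M, U) →+ Γ(N, U))
    (hg : ∀ {U W : X.Opens} (h : W ≤ U) s, g W (mrs M h s) = mrs N h (g U s))
    (hsmul : ∀ {U : X.Opens} (a : Γ(X, U)) s, g U (a • s) = a • g U s) : M ⟶ N where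
  val :=
    { app U := ModuleCat.ofHom
        { toFun := g U.unop
          map_add' := map_add _
          map_smul' := hsmul }
      naturality {U W} i := by
        ext s
        exact hg i.unop.le s }

end Modules

/-! ### Sections of sheaves of operators, and sheaves generated by operators -/

namespace LocalSubrings

variable {X : Scheme.{u}} (S : LocalSubrings X) {U V : X.Opens}

/-- Restriction of sections of a local family of subrings. -/
def rres (h : U ≤ V) : S.ring V →+* S.ring U :=
  ((endRing.res h).comp (S.ring V).subtype).codRestrict (S.ring U) fun P => S.res_mem h P.1 P.2

/-- The sections of the `𝒪_X`-module attached to a local family of subrings. -/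
noncomputable def toModule (U : X.Opens) : S.ring U ≃+ Γ(S.leftModule, U) where
  toFun P := P
  invFun P := P
  left_inv _ := rfl
  right_inv _ := rfl
  map_add' _ _ := rfl

/-- Multiplication by a function. -/
def mulSec (a : Γ(X, U)) : S.ring U := ⟨mulOp U a, S.mulOp_mem a⟩

/-- The local family of subrings generated by a family of sets of endomorphisms. -/
def generate (G : ∀ U : X.Opens, Set (endRing X U))
    (hG : ∀ {U W : X.Opens} (h : W ≤ U), ∀ P ∈ G U, endRing.res h P ∈ G W)
    (hG' : ∀ {U : X.Opens} (a : Γ(X, U)), mulOp U a ∈ G U) : LocalSubrings X :=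
  have hres : ∀ {V V' : X.Opens} (h : V' ≤ V) {P : endRing X V},
      P ∈ Subring.closure (G V) → endRing.res h P ∈ Subring.closure (G V') := fun {V V'} h {P} hP => by
    have hle : Subring.closure (G V) ≤ (Subring.closure (G V')).comap (endRing.res h) :=
      (Subring.closure_le).2 fun Q hQ => Subring.subset_closure (hG h Q hQ)
    exact hle hP
  { ring V :=
    { carrier := {P | ∀ x ∈ V, ∃ (W : X.Opens) (h : W ≤ V), x ∈ W ∧
        endRing.res h P ∈ Subring.closure (G W)}
      mul_mem' := by
        intro P Q hP hQ x hx
        obtain ⟨W, h, hxW, hW⟩ := hP x hx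
        obtain ⟨W', h', hxW', hW'⟩ := hQ x hx
        refine ⟨W ⊓ W', inf_le_left.trans h, ⟨hxW, hxW'⟩, ?_⟩
        rw [RingHom.map_mul]
        exact mul_mem (hres inf_le_left hW) (hres inf_le_right hW')
      one_mem' := by
        intro x hx
        exact ⟨V, le_rfl, hx, by rw [map_one]; exact one_mem _⟩
      add_mem' := by
        intro P Q hP hQ x hx
        obtain ⟨W, h, hxW, hW⟩ := hP x hx
        obtain ⟨W', h', hxW', hW'⟩ := hQ x hx
        refine ⟨W ⊓ W', inf_le_left.trans h, ⟨hxW, hxW'⟩, ?_⟩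
        rw [map_add]
        exact add_mem (hres inf_le_left hW) (hres inf_le_right hW')
      zero_mem' := by
        intro x hx
        exact ⟨V, le_rfl, hx, by rw [map_zero]; exact zero_mem _⟩
      neg_mem' := by
        intro P hP x hx
        obtain ⟨W, h, hxW, hW⟩ := hP x hx
        exact ⟨W, h, hxW, by rw [map_neg]; exact neg_mem hW⟩ }
    res_mem := by
      intro V V' h P hP x hx
      obtain ⟨W, hW, hxW, hP⟩ := hP x (h hx)
      exact ⟨W ⊓ V', inf_le_right, ⟨hxW, hx⟩, hres inf_le_left hP⟩
    mem_of_local := by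
      intro V P hP x hx
      obtain ⟨W, h, hxW, hW⟩ := hP x hx
      obtain ⟨W', h', hxW', hW'⟩ := hW x hxW
      exact ⟨W', h'.trans h, hxW', hW'⟩
    mulOp_mem := by
      intro V a x hx
      refine ⟨V, le_rfl, hx, Subring.subset_closure ?_⟩
      exact hG' a }

end LocalSubrings

/-- The expansion is given in `E`, but all its terms lie in `S`, where `χ` is defined. -/
lemma map_eq_sum_of_lcomb_eq_coe {A E κ G : Type*} [CommRing A] [Ring E] [AddCommGroup G]
    (S : Subring E) (μ : A →+* S) (B : κ → S) (b : κ →₀ A) (Q : S)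
    (hb : lcomb (S.subtype.comp μ) (fun i => (B i : E)) b = Q) (χ : S →+ G) :
    χ Q = b.sum fun i a => χ (μ a * B i) := by
  have : Q = lcomb μ B b := by
    refine Subtype.ext ?_
    rw [← hb, lcomb_apply, lcomb_apply]
    change _ = S.subtype _
    rw [map_finsuppSum]
    rfl
  rw [this, lcomb_apply, map_finsuppSum]

/-! ### Actions of rings of operators along a morphism -/

section Action

variable {X Y : Scheme.{u}} (pr : X ⟶ Y) (S₀ : LocalSubrings Y)

/-- An action on `𝒪_X` of a sheaf of rings of operators on `𝒪_Y`. -/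
structure OperatorAction where
  σ : ∀ V : Y.Opens, S₀.ring V →+* endRing X (pr ⁻¹ᵁ V)
  res : ∀ {V V' : Y.Opens} (h : V' ≤ V) (P : S₀.ring V),
    σ V' (S₀.rres h P) = endRing.res (pr.preimage_mono h) (σ V P)
  mul : ∀ {V : Y.Opens} (a : Γ(Y, V)), σ V (S₀.mulSec a) = mulOp _ (pr.app V a)

namespace OperatorAction

variable {pr S₀} (A : OperatorAction pr S₀)

/-- The endomorphism of `𝒪_X|_W` given by an operator on an open whose inverse image
contains `W`. -/
def on {V : Y.Opens} {W : X.Opens} (h : W ≤ pr ⁻¹ᵁ V) : S₀.ring V →+* endRing X W :=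
  (endRing.res h).comp (A.σ V)

lemma res_on {V : Y.Opens} {W W' : X.Opens} (h : W ≤ pr ⁻¹ᵁ V) (h' : W' ≤ W) (P : S₀.ring V) :
    endRing.res h' (A.on h P) = A.on (h'.trans h) P := rfl

lemma on_rres {V V' : Y.Opens} (h : V' ≤ V) {W : X.Opens} (h' : W ≤ pr ⁻¹ᵁ V') (P : S₀.ring V) :
    A.on h' (S₀.rres h P) = A.on (h'.trans (pr.preimage_mono h)) P :=
  congrArg (endRing.res h') (A.res h P)

lemma on_mulSec {V : Y.Opens} {W : X.Opens} (h : W ≤ pr ⁻¹ᵁ V) (a : Γ(Y, V)) :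
    A.on h (S₀.mulSec a) = mulOp W (rs h (pr.app V a)) :=
  (congrArg (endRing.res h) (A.mul a)).trans (res_mulOp h _)

/-- A basis of the operators near `x`. -/
structure Frame (V : Y.Opens) (x : X) where
  κ : Type
  B : κ → S₀.ring V
  mem : pr x ∈ V
  span : ∀ {V' : Y.Opens} (Q : S₀.ring V'), pr x ∈ V' → ∃ (W : Y.Opens) (h' : W ≤ V') (h : W ≤ V),
    pr x ∈ W ∧ endRing.res h' Q.1 ∈ (lcomb (mulOp W) fun i => endRing.res h (B i).1).range
  one : (1 : endRing Y V) ∈ (lcomb (mulOp V) fun i => (B i).1).range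
  mul : ∀ i j, (B i).1 * (B j).1 ∈ (lcomb (mulOp V) fun i => (B i).1).range
  comm : ∀ {W : X.Opens} (h : W ≤ pr ⁻¹ᵁ V) i (s : Γ(X, W)),
    A.on h (B i) * mulOp W s ∈ (lcomb (mulOp W) fun i => A.on h (B i)).range
  inj : ∀ {W : X.Opens} (h : W ≤ pr ⁻¹ᵁ V),
    Function.Injective (lcomb (mulOp W) fun i => A.on h (B i))

/-- The products of functions and operators. -/
def generators (W : X.Opens) : Set (endRing X W) :=
  Set.range (mulOp W) ∪ {T | ∃ (V : Y.Opens) (h : W ≤ pr ⁻¹ᵁ V) (Q : S₀.ring V), T = A.on h Q}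

/-- The sheaf of rings of endomorphisms generated by functions and operators. -/
def subrings : LocalSubrings X := .generate A.generators
  (by
    rintro U W h P (⟨a, rfl⟩ | ⟨V, hV, Q, rfl⟩)
    · exact Or.inl ⟨_, (res_mulOp h a).symm⟩
    · exact Or.inr ⟨V, h.trans hV, Q, rfl⟩)
  fun a => Or.inl ⟨a, rfl⟩

lemma on_mem {V : Y.Opens} {W : X.Opens} (h : W ≤ pr ⁻¹ᵁ V) (Q : S₀.ring V) :
    A.on h Q ∈ A.subrings.ring W := fun _ hx =>
  ⟨W, le_rfl, hx, Subring.subset_closure (Or.inr ⟨V, h, Q, rfl⟩)⟩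

lemma map_eq_sum_of_lcomb_eq {V W : Y.Opens} (h : W ≤ V) {κ : Type} (B : κ → S₀.ring V)
    (b : κ →₀ Γ(Y, W)) (Q : S₀.ring W)
    (hb : lcomb (mulOp W) (fun i => endRing.res h (B i).1) b = Q.1) {G : Type*} [AddCommGroup G]
    (χ : S₀.ring W →+ G) : χ Q = b.sum fun i a => χ (S₀.mulSec a * S₀.rres h (B i)) :=
  map_eq_sum_of_lcomb_eq_coe (S₀.ring W)
    ((mulOp W).codRestrict (S₀.ring W) fun a => S₀.mulOp_mem a) (fun i => S₀.rres h (B i)) b Q hb χ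

namespace Frame

variable {A} {V : Y.Opens} {x : X} (F : A.Frame V x)

/-- The linear combinations of the elements of a basis. -/
noncomputable def comb {W : X.Opens} (h : W ≤ pr ⁻¹ᵁ V) : (F.κ →₀ Γ(X, W)) →+ endRing X W :=
  lcomb (mulOp W) fun i => A.on h (F.B i)

lemma on_mem_range {W : X.Opens} (h : W ≤ pr ⁻¹ᵁ V) {W₀ : Y.Opens} (h₀ : W₀ ≤ V)
    (hW : W ≤ pr ⁻¹ᵁ W₀) (Q : S₀.ring W₀)
    (hQ : Q.1 ∈ (lcomb (mulOp W₀) fun i => endRing.res h₀ (F.B i).1).range) :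
    A.on hW Q ∈ (F.comb h).range := by
  obtain ⟨b, hb⟩ := hQ
  have := map_eq_sum_of_lcomb_eq h₀ F.B b Q hb (A.on hW).toAddMonoidHom
  change A.on hW Q = _ at this
  rw [this]
  refine sum_mem fun i _ => ?_
  change A.on hW (_ * _) ∈ _
  rw [RingHom.map_mul, on_mulSec, on_rres]
  exact mul_mem_range_lcomb _ _ _ _

lemma one_mem {W : X.Opens} (h : W ≤ pr ⁻¹ᵁ V) : 1 ∈ (F.comb h).range := by
  rw [← (A.on h).map_one]
  exact F.on_mem_range h le_rfl h 1 F.one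

/-- In `a B_i b B_j`, the relation `F.comm` moves `b` to the left and `F.mul` expands the remaining
products of basis elements. -/
lemma mul_mem {W : X.Opens} (h : W ≤ pr ⁻¹ᵁ V) {P Q : endRing X W} (hP : P ∈ (F.comb h).range)
    (hQ : Q ∈ (F.comb h).range) : P * Q ∈ (F.comb h).range := by
  have h1 : ∀ {P : endRing X W} (j), P ∈ (F.comb h).range →
      P * A.on h (F.B j) ∈ (F.comb h).range := fun {P} j hP => by
    refine range_lcomb_induction (C := fun P => P * A.on h (F.B j) ∈ (F.comb h).range) _ _
      (by rw [zero_mul]; exact zero_mem _)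
      (fun P P' h h' => by rw [add_mul]; exact add_mem h h') (fun i a => ?_) hP
    rw [mul_assoc, ← RingHom.map_mul]
    exact mul_mem_range_lcomb_of_mem _ _ _ (F.on_mem_range h le_rfl h _ (F.mul i j))
  refine range_lcomb_induction (C := fun P => P * Q ∈ (F.comb h).range) _ _
    (by rw [zero_mul]; exact zero_mem _)
    (fun P P' h h' => by rw [add_mul]; exact add_mem h h') (fun i a => ?_) hP
  refine range_lcomb_induction (C := fun Q => mulOp W a * A.on h (F.B i) * Q ∈ (F.comb h).range) _ _
    (by rw [mul_zero]; exact zero_mem _)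
    (fun P P' h h' => by rw [mul_add]; exact add_mem h h') (fun j b => ?_) hQ
  rw [mul_assoc, ← mul_assoc (A.on h (F.B i))]
  exact mul_mem_range_lcomb_of_mem _ _ _ (h1 j (F.comm h i b))

lemma mulOp_mem {W : X.Opens} (h : W ≤ pr ⁻¹ᵁ V) (a : Γ(X, W)) :
    mulOp W a ∈ (F.comb h).range := by
  rw [← mul_one (mulOp W a)]
  exact mul_mem_range_lcomb_of_mem _ _ _ (F.one_mem h)

lemma res_mem {W W' : X.Opens} (h : W ≤ pr ⁻¹ᵁ V) (h' : W' ≤ W) {P : endRing X W}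
    (hP : P ∈ (F.comb h).range) : endRing.res h' P ∈ (F.comb (h'.trans h)).range := by
  refine range_lcomb_induction (C := fun P => endRing.res h' P ∈ (F.comb (h'.trans h)).range) _ _
    (by rw [map_zero]; exact zero_mem _)
    (fun P P' h h' => by rw [map_add]; exact add_mem h h') (fun i a => ?_) hP
  rw [RingHom.map_mul, res_mulOp]
  exact mul_mem_range_lcomb (mulOp W') _ _ _

/-- The endomorphisms that are linear combinations of the elements of the basis near `x`. -/
def germSubring {W : X.Opens} (hx : x ∈ W) : Subring (endRing X W) where
  carrier := {T | ∃ (W' : X.Opens) (h : W' ≤ W) (h' : W' ≤ pr ⁻¹ᵁ V), x ∈ W' ∧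
    endRing.res h T ∈ (F.comb h').range}
  mul_mem' := by
    rintro P Q ⟨W₁, h₁, h₁', hx₁, hP⟩ ⟨W₂, h₂, h₂', hx₂, hQ⟩
    refine ⟨W₁ ⊓ W₂, inf_le_left.trans h₁, inf_le_left.trans h₁', ⟨hx₁, hx₂⟩, ?_⟩
    rw [RingHom.map_mul]
    exact F.mul_mem _ (F.res_mem h₁' inf_le_left hP) (F.res_mem h₂' inf_le_right hQ)
  one_mem' := ⟨W ⊓ pr ⁻¹ᵁ V, inf_le_left, inf_le_right, ⟨hx, F.mem⟩, by
    rw [RingHom.map_one]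
    exact F.one_mem _⟩
  add_mem' := by
    rintro P Q ⟨W₁, h₁, h₁', hx₁, hP⟩ ⟨W₂, h₂, h₂', hx₂, hQ⟩
    refine ⟨W₁ ⊓ W₂, inf_le_left.trans h₁, inf_le_left.trans h₁', ⟨hx₁, hx₂⟩, ?_⟩
    rw [map_add]
    exact add_mem (F.res_mem h₁' inf_le_left hP) (F.res_mem h₂' inf_le_right hQ)
  zero_mem' := ⟨W ⊓ pr ⁻¹ᵁ V, inf_le_left, inf_le_right, ⟨hx, F.mem⟩, by
    rw [map_zero]
    exact zero_mem _⟩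
  neg_mem' := by
    rintro P ⟨W₁, h₁, h₁', hx₁, hP⟩
    exact ⟨W₁, h₁, h₁', hx₁, by rw [map_neg]; exact neg_mem hP⟩

/-- Near `x`, the sections of the sheaf of rings generated by functions and operators are linear
combinations of the elements of the basis. -/
lemma exists_mem_range {W : X.Opens} (hx : x ∈ W) {T : endRing X W}
    (hT : T ∈ A.subrings.ring W) : ∃ (W' : X.Opens) (h : W' ≤ W) (h' : W' ≤ pr ⁻¹ᵁ V), x ∈ W' ∧
      endRing.res h T ∈ (F.comb h').range := by
  obtain ⟨W₁, h₁, hx₁, hT₁⟩ := hT x hx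
  have hle : Subring.closure (A.generators W₁) ≤ F.germSubring hx₁ := by
    rw [Subring.closure_le]
    rintro Q (⟨a, rfl⟩ | ⟨V', hV', Q, rfl⟩)
    · refine ⟨W₁ ⊓ pr ⁻¹ᵁ V, inf_le_left, inf_le_right, ⟨hx₁, F.mem⟩, ?_⟩
      rw [res_mulOp]
      exact F.mulOp_mem _ _
    · obtain ⟨W₀, h₀', h₀, hx₀, hQ⟩ := F.span Q (hV' hx₁)
      refine ⟨W₁ ⊓ pr ⁻¹ᵁ W₀, inf_le_left, inf_le_right.trans (pr.preimage_mono h₀),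
        ⟨hx₁, hx₀⟩, ?_⟩
      rw [res_on, ← A.on_rres h₀' inf_le_right]
      exact F.on_mem_range _ h₀ inf_le_right _ hQ
  obtain ⟨W', h, h', hx', hT'⟩ := hle hT₁
  exact ⟨W', h.trans h₁, h', hx', hT'⟩

end Frame

end OperatorAction

end Action


lemma map_mul_finsuppSum {A B E κ : Type*} [CommRing A] [Zero B] [Ring E] (μ : A →+* E) (s : A)
    (c : B → A) (b : κ →₀ B) (P : κ → E) :
    (μ s * b.sum fun i a => μ (c a) * P i) = b.sum fun i a => μ (s * c a) * P i := by
  simp only [Finsupp.sum, Finset.mul_sum, map_mul, mul_assoc]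

lemma smul_finsuppSum {A B E κ : Type*} [CommRing A] [Zero B] [AddCommGroup E] [Module A E] (s : A)
    (c : B → A) (b : κ →₀ B) (P : κ → E) :
    (s • b.sum fun i a => c a • P i) = b.sum fun i a => (s * c a) • P i := by
  simp only [Finsupp.sum, Finset.smul_sum, smul_smul]

/-! ### Linear maps on operators and their extension along the action -/

namespace OperatorAction

variable {X Y : Scheme.{u}} {pr : X ⟶ Y} {S₀ : LocalSubrings Y} (A : OperatorAction pr S₀)
  (M : X.Modules)

/-- An `𝒪_Y`-linear map from a sheaf of rings of operators on `𝒪_Y` to the push-forward of an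
`𝒪_X`-module `M`. -/
structure LinearMap (S₀ : LocalSubrings Y) (pr : X ⟶ Y) (M : X.Modules) where
  φ : ∀ V : Y.Opens, S₀.ring V →+ Γ(M, pr ⁻¹ᵁ V)
  res : ∀ {V V' : Y.Opens} (h : V' ≤ V) (P : S₀.ring V),
    φ V' (S₀.rres h P) = mrs M (pr.preimage_mono h) (φ V P)
  mul : ∀ {V : Y.Opens} (a : Γ(Y, V)) (P : S₀.ring V),
    φ V (S₀.mulSec a * P) = (pr.app V a : Γ(X, pr ⁻¹ᵁ V)) • φ V P

variable {M} (Φ : LinearMap S₀ pr M)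

/-- The value of `Φ`, restricted to `W`. -/
noncomputable def LinearMap.on {V : Y.Opens} {W : X.Opens} (h : W ≤ pr ⁻¹ᵁ V) :
    S₀.ring V →+ Γ(M, W) :=
  (mrs M h).comp (Φ.φ V)

lemma LinearMap.res_on {V : Y.Opens} {W W' : X.Opens} (h : W ≤ pr ⁻¹ᵁ V) (h' : W' ≤ W)
    (P : S₀.ring V) : mrs M h' (Φ.on h P) = Φ.on (h'.trans h) P :=
  mrs_mrs h h' _

lemma LinearMap.on_rres {V V' : Y.Opens} (h : V' ≤ V) {W : X.Opens} (h' : W ≤ pr ⁻¹ᵁ V')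
    (P : S₀.ring V) :
    Φ.on h' (S₀.rres h P) = Φ.on (h'.trans (pr.preimage_mono h)) P :=
  (congrArg (mrs M h') (Φ.res h P)).trans (mrs_mrs _ _ _)

lemma LinearMap.on_mulSec_mul {V : Y.Opens} {W : X.Opens} (h : W ≤ pr ⁻¹ᵁ V) (a : Γ(Y, V))
    (P : S₀.ring V) : Φ.on h (S₀.mulSec a * P) = rs h (pr.app V a) • Φ.on h P :=
  (congrArg (mrs M h) (Φ.mul a P)).trans (mrs_smul _ _ _)

lemma on_eq_sum_of_lcomb_eq {V V' : Y.Opens} (h : V' ≤ V) {W : X.Opens} (hW : W ≤ pr ⁻¹ᵁ V')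
    {κ : Type} (B : κ → S₀.ring V) (b : κ →₀ Γ(Y, V')) (Q : S₀.ring V')
    (hb : lcomb (mulOp V') (fun i => endRing.res h (B i).1) b = Q.1) :
    A.on hW Q = b.sum fun i a =>
      mulOp W (rs hW (pr.app V' a)) * A.on (hW.trans (pr.preimage_mono h)) (B i) := by
  refine (map_eq_sum_of_lcomb_eq h B b Q hb (A.on hW).toAddMonoidHom).trans ?_
  refine Finsupp.sum_congr fun i _ => ?_
  refine ((A.on hW).map_mul _ _).trans ?_
  rw [on_mulSec, on_rres]

lemma LinearMap.on_eq_sum_of_lcomb_eq {V V' : Y.Opens} (h : V' ≤ V) {W : X.Opens}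
    (hW : W ≤ pr ⁻¹ᵁ V') {κ : Type} (B : κ → S₀.ring V) (b : κ →₀ Γ(Y, V')) (Q : S₀.ring V')
    (hb : lcomb (mulOp V') (fun i => endRing.res h (B i).1) b = Q.1) :
    Φ.on hW Q = b.sum fun i a =>
      rs hW (pr.app V' a) • Φ.on (hW.trans (pr.preimage_mono h)) (B i) := by
  rw [map_eq_sum_of_lcomb_eq h B b Q hb (Φ.on hW)]
  refine Finsupp.sum_congr fun i _ => ?_
  rw [Φ.on_mulSec_mul, Φ.on_rres]

/-- The graph of the linear map `s ρ(Q) ↦ s Φ(Q)`. -/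
noncomputable def graph (W : X.Opens) : AddSubmonoid (endRing X W × Γ(M, W)) :=
  AddSubmonoid.closure {q | ∃ (V : Y.Opens) (h : W ≤ pr ⁻¹ᵁ V) (s : Γ(X, W)) (Q : S₀.ring V),
    q = (mulOp W s * A.on h Q, s • Φ.on h Q)}

variable {A Φ}

lemma graph_induction {W : X.Opens} {C : endRing X W → Γ(M, W) → Prop}
    (zero : C 0 0) (add : ∀ T T' m m', C T m → C T' m' → C (T + T') (m + m'))
    (mul : ∀ (V : Y.Opens) (h : W ≤ pr ⁻¹ᵁ V) (s : Γ(X, W)) (Q : S₀.ring V),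
      C (mulOp W s * A.on h Q) (s • Φ.on h Q))
    {T : endRing X W} {m : Γ(M, W)} (h : (T, m) ∈ A.graph Φ W) : C T m := by
  suffices h' : ∀ q ∈ A.graph Φ W, C q.1 q.2 from h' _ h
  intro q hq
  induction hq using AddSubmonoid.closure_induction with
  | mem q hq =>
    obtain ⟨V, h, s, Q, rfl⟩ := hq
    exact mul V h s Q
  | zero => exact zero
  | add q q' _ _ h h' => exact add _ _ _ _ h h'

lemma mul_mem_graph {W : X.Opens} {V : Y.Opens} (h : W ≤ pr ⁻¹ᵁ V) (s : Γ(X, W)) (Q : S₀.ring V) :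
    (mulOp W s * A.on h Q, s • Φ.on h Q) ∈ A.graph Φ W :=
  AddSubmonoid.subset_closure ⟨V, h, s, Q, rfl⟩

lemma on_mem_graph {W : X.Opens} {V : Y.Opens} (h : W ≤ pr ⁻¹ᵁ V) (Q : S₀.ring V) :
    (A.on h Q, Φ.on h Q) ∈ A.graph Φ W := by
  have := mul_mem_graph (A := A) (Φ := Φ) h 1 Q
  rwa [RingHom.map_one, one_mul, one_smul] at this

lemma res_mem_graph {W W' : X.Opens} (h' : W' ≤ W) {T : endRing X W} {m : Γ(M, W)}
    (h : (T, m) ∈ A.graph Φ W) : (endRing.res h' T, mrs M h' m) ∈ A.graph Φ W' := by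
  refine graph_induction (C := fun T m => (endRing.res h' T, mrs M h' m) ∈ A.graph Φ W')
    ?_ ?_ ?_ h
  · rw [map_zero, map_zero]
    exact zero_mem _
  · intro T T' m m' h h'
    rw [map_add, map_add]
    exact add_mem h h'
  · intro V h s Q
    rw [RingHom.map_mul, res_mulOp, mrs_smul, res_on, Φ.res_on]
    exact mul_mem_graph _ _ _

lemma smul_mem_graph {W : X.Opens} (a : Γ(X, W)) {T : endRing X W} {m : Γ(M, W)}
    (h : (T, m) ∈ A.graph Φ W) : (mulOp W a * T, a • m) ∈ A.graph Φ W := by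
  refine graph_induction (C := fun T m => (mulOp W a * T, a • m) ∈ A.graph Φ W) ?_ ?_ ?_ h
  · rw [mul_zero, smul_zero]
    exact zero_mem _
  · intro T T' m m' h h'
    rw [mul_add, smul_add]
    exact add_mem h h'
  · intro V h s Q
    rw [← mul_assoc, ← RingHom.map_mul, smul_smul]
    exact mul_mem_graph h (a * s) Q

namespace Frame

variable {V : Y.Opens} {x : X} (F : A.Frame V x)

variable (Φ) in
/-- The linear combinations of the values of `Φ` on the elements of a basis. -/
noncomputable def value {W : X.Opens} (h : W ≤ pr ⁻¹ᵁ V) : (F.κ →₀ Γ(X, W)) →+ Γ(M, W) :=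
  Finsupp.liftAddHom fun i => (AddMonoidHom.flip (smulAddHom Γ(X, W) Γ(M, W))) (Φ.on h (F.B i))

lemma comb_value_mem_graph {W : X.Opens} (h : W ≤ pr ⁻¹ᵁ V) (b : F.κ →₀ Γ(X, W)) :
    (F.comb h b, F.value Φ h b) ∈ A.graph Φ W := by
  induction b using Finsupp.induction_linear with
  | zero =>
    rw [map_zero, map_zero]
    exact zero_mem _
  | add b c hb hc =>
    rw [map_add, map_add]
    exact add_mem hb hc
  | single i c =>
    rw [comb, lcomb_single, value, Finsupp.liftAddHom_apply_single]
    exact mul_mem_graph h c (F.B i)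

lemma comb_mapRange {B : Type*} [AddCommGroup B] {W : X.Opens} (h : W ≤ pr ⁻¹ᵁ V)
    (c : B →+ Γ(X, W)) (b : F.κ →₀ B) : F.comb h (Finsupp.mapRange.addMonoidHom c b) =
      b.sum fun i a => mulOp W (c a) * A.on h (F.B i) :=
  Finsupp.sum_mapRange_index (hf := c.map_zero) (h := fun i a => mulOp W a * A.on h (F.B i))
    fun _ => by rw [RingHom.map_zero, zero_mul]

lemma value_mapRange {B : Type*} [AddCommGroup B] {W : X.Opens} (h : W ≤ pr ⁻¹ᵁ V)
    (c : B →+ Γ(X, W)) (b : F.κ →₀ B) : F.value Φ h (Finsupp.mapRange.addMonoidHom c b) =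
      b.sum fun i a => c a • Φ.on h (F.B i) :=
  Finsupp.sum_mapRange_index (hf := c.map_zero) (h := fun i a => a • Φ.on h (F.B i))
    fun _ => zero_smul _ _

lemma res_comb {W W' : X.Opens} (h : W ≤ pr ⁻¹ᵁ V) (h' : W' ≤ W) (b : F.κ →₀ Γ(X, W)) :
    endRing.res h' (F.comb h b) =
      F.comb (h'.trans h) (Finsupp.mapRange.addMonoidHom (rs h').toAddMonoidHom b) := by
  rw [comb_mapRange, comb, lcomb_apply, map_finsuppSum]
  refine Finsupp.sum_congr fun i _ => ?_
  rw [RingHom.map_mul, res_mulOp]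
  rfl

lemma mrs_value {W W' : X.Opens} (h : W ≤ pr ⁻¹ᵁ V) (h' : W' ≤ W) (b : F.κ →₀ Γ(X, W)) :
    mrs M h' (F.value Φ h b) =
      F.value Φ (h'.trans h) (Finsupp.mapRange.addMonoidHom (rs h').toAddMonoidHom b) := by
  have h1 : F.value Φ h b = b.sum fun i a => a • Φ.on h (F.B i) := rfl
  rw [value_mapRange, h1, map_finsuppSum]
  refine Finsupp.sum_congr fun i _ => ?_
  rw [mrs_smul, Φ.res_on]
  rfl

/-- Near `x`, the pair `(T, m)` is a linear combination of the elements of the basis and of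
their images. -/
def IsComb {W : X.Opens} (T : endRing X W) (m : Γ(M, W)) : Prop :=
  ∃ (W' : X.Opens) (h : W' ≤ W) (h' : W' ≤ pr ⁻¹ᵁ V), x ∈ W' ∧
    ∃ b, endRing.res h T = F.comb h' b ∧ mrs M h m = F.value Φ h' b

lemma IsComb.add {W : X.Opens} {T T' : endRing X W} {m m' : Γ(M, W)}
    (h : F.IsComb (Φ := Φ) T m) (h' : F.IsComb (Φ := Φ) T' m') :
    F.IsComb (Φ := Φ) (T + T') (m + m') := by
  obtain ⟨W₁, h₁, h₁', hx₁, b, hb, hbm⟩ := h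
  obtain ⟨W₂, h₂, h₂', hx₂, b', hb', hbm'⟩ := h'
  refine ⟨W₁ ⊓ W₂, inf_le_left.trans h₁, inf_le_left.trans h₁', ⟨hx₁, hx₂⟩,
    Finsupp.mapRange.addMonoidHom (rs inf_le_left).toAddMonoidHom b +
    Finsupp.mapRange.addMonoidHom (rs inf_le_right).toAddMonoidHom b', ?_, ?_⟩
  · rw [map_add, map_add, ← F.res_comb h₁', ← F.res_comb h₂', ← hb, ← hb', res_res, res_res]
  · rw [map_add, map_add, ← F.mrs_value h₁', ← F.mrs_value h₂', ← hbm, ← hbm', mrs_mrs, mrs_mrs]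

lemma isComb_mul {W : X.Opens} (hx : x ∈ W) {V' : Y.Opens} (hV' : W ≤ pr ⁻¹ᵁ V') (s : Γ(X, W))
    (Q : S₀.ring V') :
    F.IsComb (Φ := Φ) (mulOp W s * A.on hV' Q) (s • Φ.on hV' Q) := by
  obtain ⟨W₀, h₀', h₀, hx₀, b, hb⟩ := F.span Q (hV' hx)
  have hW : W ⊓ pr ⁻¹ᵁ W₀ ≤ pr ⁻¹ᵁ W₀ := inf_le_right
  have hW' : W ⊓ pr ⁻¹ᵁ W₀ ≤ W := inf_le_left
  refine ⟨W ⊓ pr ⁻¹ᵁ W₀, hW', hW.trans (pr.preimage_mono h₀), ⟨hx, hx₀⟩,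
    Finsupp.mapRange.addMonoidHom ((AddMonoidHom.mulLeft (rs hW' s)).comp
      ((rs hW).comp (pr.app W₀).hom).toAddMonoidHom) b, ?_, ?_⟩
  · rw [comb_mapRange, RingHom.map_mul, res_mulOp, res_on, ← A.on_rres h₀' hW,
      A.on_eq_sum_of_lcomb_eq h₀ hW F.B b (S₀.rres h₀' Q) hb]
    exact map_mul_finsuppSum _ _ _ _ _
  · have e : mrs M hW' (s • Φ.on hV' Q) = rs hW' s • Φ.on (hW'.trans hV') Q :=
      (mrs_smul _ _ _).trans (congrArg (rs hW' s • ·) (Φ.res_on hV' hW' Q))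
    have e' := (Φ.on_rres h₀' hW Q).symm.trans
      (Φ.on_eq_sum_of_lcomb_eq h₀ hW F.B b (S₀.rres h₀' Q) hb)
    rw [value_mapRange]
    exact (e.trans (congrArg (rs hW' s • ·) e')).trans (smul_finsuppSum _ _ _ _)

/-- Near `x`, the graph consists of linear combinations of the elements of a basis. -/
lemma isComb_of_mem_graph {W : X.Opens} (hx : x ∈ W) {T : endRing X W} {m : Γ(M, W)}
    (h : (T, m) ∈ A.graph Φ W) : F.IsComb (Φ := Φ) T m := by
  refine graph_induction (C := fun T m => F.IsComb (Φ := Φ) T m) ?_ (fun _ _ _ _ => IsComb.add F)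
    (fun V' hV' s Q => F.isComb_mul hx hV' s Q) h
  exact ⟨W ⊓ pr ⁻¹ᵁ V, inf_le_left, inf_le_right, ⟨hx, F.mem⟩, 0, by rw [map_zero, map_zero],
    by rw [map_zero, map_zero]⟩

include F in
-- Near `x` both images come from expansions of the same `T` in the basis. By `F.inj` the
-- coefficients coincide.
lemma eq_of_mem_graph {W : X.Opens} (hx : x ∈ W) {T : endRing X W} {m m' : Γ(M, W)}
    (h : (T, m) ∈ A.graph Φ W) (h' : (T, m') ∈ A.graph Φ W) :
    ∃ (W' : X.Opens) (h : W' ≤ W), x ∈ W' ∧ mrs M h m = mrs M h m' := by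
  obtain ⟨W₁, h₁, h₁', hx₁, b, hb, hbm⟩ := F.isComb_of_mem_graph hx h
  obtain ⟨W₂, h₂, h₂', hx₂, b', hb', hbm'⟩ := F.isComb_of_mem_graph hx h'
  refine ⟨W₁ ⊓ W₂, inf_le_left.trans h₁, ⟨hx₁, hx₂⟩, ?_⟩
  have e := congrArg (endRing.res (inf_le_left : W₁ ⊓ W₂ ≤ W₁)) hb
  have e' := congrArg (endRing.res (inf_le_right : W₁ ⊓ W₂ ≤ W₂)) hb'
  rw [res_res, res_comb] at e e'
  have em := congrArg (mrs M (inf_le_left : W₁ ⊓ W₂ ≤ W₁)) hbm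
  have em' := congrArg (mrs M (inf_le_right : W₁ ⊓ W₂ ≤ W₂)) hbm'
  rw [mrs_mrs, mrs_value] at em em'
  rw [em, em', F.inj _ (e.symm.trans e')]

end Frame

/-! ### The linear map attached to a graph -/

section Extend

variable (hF : ∀ x : X, ∃ V, Nonempty (A.Frame V x))

include hF

lemma eq_of_mem_graph {W : X.Opens} {T : endRing X W} {m m' : Γ(M, W)}
    (h : (T, m) ∈ A.graph Φ W) (h' : (T, m') ∈ A.graph Φ W) : m = m' := by
  refine mrs_ext fun x hx => ?_
  obtain ⟨V, ⟨F⟩⟩ := hF x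
  exact F.eq_of_mem_graph hx h h'

omit hF in
variable (A Φ) in
/-- The pairs that lie locally in the graph. -/
def IsImage {W : X.Opens} (T : endRing X W) (m : Γ(M, W)) : Prop :=
  ∀ x ∈ W, ∃ (W' : X.Opens) (h : W' ≤ W), x ∈ W' ∧ (endRing.res h T, mrs M h m) ∈ A.graph Φ W'

lemma IsImage.unique {W : X.Opens} {T : endRing X W} {m m' : Γ(M, W)} (h : IsImage A Φ T m)
    (h' : IsImage A Φ T m') : m = m' := by
  refine mrs_ext fun x hx => ?_
  obtain ⟨W₁, h₁, hx₁, hm⟩ := h x hx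
  obtain ⟨W₂, h₂, hx₂, hm'⟩ := h' x hx
  refine ⟨W₁ ⊓ W₂, inf_le_left.trans h₁, ⟨hx₁, hx₂⟩, ?_⟩
  have e := res_mem_graph (inf_le_left : W₁ ⊓ W₂ ≤ _) hm
  have e' := res_mem_graph (inf_le_right : W₁ ⊓ W₂ ≤ _) hm'
  rw [mrs_mrs, res_res] at e e'
  exact eq_of_mem_graph hF e e'

omit hF

lemma IsImage.of_mem_graph {W : X.Opens} {T : endRing X W} {m : Γ(M, W)}
    (h : (T, m) ∈ A.graph Φ W) : IsImage A Φ T m := fun _ hx =>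
  ⟨W, le_rfl, hx, res_mem_graph le_rfl h⟩

lemma IsImage.res {W W' : X.Opens} (hW : W' ≤ W) {T : endRing X W} {m : Γ(M, W)}
    (h : IsImage A Φ T m) : IsImage A Φ (endRing.res hW T) (mrs M hW m) := by
  intro x hx
  obtain ⟨W₁, h₁, hx₁, hm⟩ := h x (hW hx)
  refine ⟨W₁ ⊓ W', inf_le_right, ⟨hx₁, hx⟩, ?_⟩
  have e := res_mem_graph (inf_le_left : W₁ ⊓ W' ≤ _) hm
  rw [mrs_mrs, res_res] at e
  rw [mrs_mrs, res_res]
  exact e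

lemma IsImage.add {W : X.Opens} {T T' : endRing X W} {m m' : Γ(M, W)}
    (h : IsImage A Φ T m) (h' : IsImage A Φ T' m') : IsImage A Φ (T + T') (m + m') := by
  intro x hx
  obtain ⟨W₁, h₁, hx₁, hm⟩ := h x hx
  obtain ⟨W₂, h₂, hx₂, hm'⟩ := h' x hx
  refine ⟨W₁ ⊓ W₂, inf_le_left.trans h₁, ⟨hx₁, hx₂⟩, ?_⟩
  have e := add_mem (res_mem_graph (inf_le_left : W₁ ⊓ W₂ ≤ _) hm)
    (res_mem_graph (inf_le_right : W₁ ⊓ W₂ ≤ _) hm')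
  rw [mrs_mrs, res_res, mrs_mrs, res_res, Prod.mk_add_mk, ← map_add, ← map_add] at e
  exact e

lemma IsImage.smul {W : X.Opens} (a : Γ(X, W)) {T : endRing X W} {m : Γ(M, W)}
    (h : IsImage A Φ T m) : IsImage A Φ (mulOp W a * T) (a • m) := by
  intro x hx
  obtain ⟨W₁, h₁, hx₁, hm⟩ := h x hx
  refine ⟨W₁, h₁, hx₁, ?_⟩
  rw [RingHom.map_mul, res_mulOp, mrs_smul]
  exact smul_mem_graph _ hm

include hF

/-- Basis expansions of `T` provide images locally; they glue since the graph is single valued. -/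
lemma exists_isImage {W : X.Opens} {T : endRing X W} (hT : T ∈ A.subrings.ring W) :
    ∃ m, IsImage A Φ T m := by
  obtain ⟨m, hm⟩ := mrs_exists_of_locally (M := M) (V := W)
    (fun W' m => ∃ h : W' ≤ W, (endRing.res h T, m) ∈ A.graph Φ W')
    (fun W₁ W₂ h m hm => by
      obtain ⟨h', hm⟩ := hm
      exact ⟨h.trans h', res_mem_graph h hm⟩)
    (fun W₁ _ m m' hm hm' => eq_of_mem_graph hF hm.2 hm'.2)
    (fun x hx => by
      obtain ⟨V, ⟨F⟩⟩ := hF x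
      obtain ⟨W', h, h', hx', b, hb⟩ := F.exists_mem_range hx hT
      refine ⟨W', h, hx', F.value Φ h' b, h, ?_⟩
      rw [← hb]
      exact F.comb_value_mem_graph h' b)
  refine ⟨m, fun x hx => ?_⟩
  obtain ⟨W', h, hx', hm'⟩ := hm x hx
  exact ⟨W', h, hx', hm'.2⟩

variable (Φ) in
/-- The linear map `s ρ(Q) ↦ s Φ(Q)`, on sections. -/
noncomputable def extendFun {U : X.Opens} (T : A.subrings.ring U) : Γ(M, U) :=
  (exists_isImage (Φ := Φ) hF T.2).choose

lemma isImage_extendFun {U : X.Opens} (T : A.subrings.ring U) :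
    IsImage A Φ T.1 (extendFun Φ hF T) :=
  (exists_isImage (Φ := Φ) hF T.2).choose_spec

lemma extendFun_eq {U : X.Opens} (T : A.subrings.ring U) {m : Γ(M, U)} (h : IsImage A Φ T.1 m) :
    extendFun Φ hF T = m :=
  (isImage_extendFun hF T).unique hF h

variable (A Φ) in
/-- The linear map `s ρ(Q) ↦ s Φ(Q)`. -/
noncomputable def extendLinear : A.subrings.leftModule ⟶ M :=
  modulesHom (fun U => (AddMonoidHom.mk' (extendFun Φ hF) fun T T' => extendFun_eq hF (T + T')
        ((isImage_extendFun hF T).add (isImage_extendFun hF T'))).comp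
          (A.subrings.toModule U).symm.toAddMonoidHom)
    (fun h T => extendFun_eq hF (A.subrings.rres h T) ((isImage_extendFun hF T).res h))
    (fun {U} a T => extendFun_eq hF
      (A.subrings.mulSec a * (A.subrings.toModule U).symm T) ((isImage_extendFun hF T).smul a))

lemma isImage_extendLinear {U : X.Opens} (T : A.subrings.ring U) :
    IsImage A Φ T.1 ((extendLinear A Φ hF).app U (A.subrings.toModule U T)) :=
  isImage_extendFun hF T

end Extend

end OperatorAction


namespace OperatorAction

variable {X Y : Scheme.{u}} {pr : X ⟶ Y} {S₀ : LocalSubrings Y} (A : OperatorAction pr S₀)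

/-! ### The inverse image of a sheaf of rings of operators -/

variable (pr S₀) in
/-- The map `P ↦ 1 ⊗ P`. -/
noncomputable def tensorMap : LinearMap S₀ pr ((Scheme.Modules.pullback pr).obj S₀.leftModule) where
  φ V := (pullbackSection pr S₀.leftModule V).comp (S₀.toModule V).toAddMonoidHom
  res h P := app_mrs ((Scheme.Modules.pullbackPushforwardAdjunction pr).unit.app S₀.leftModule) h
    (S₀.toModule _ P)
  mul a P := Scheme.Modules.Hom.app_smul
    ((Scheme.Modules.pullbackPushforwardAdjunction pr).unit.app S₀.leftModule) a (S₀.toModule _ P)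

/-- An operator on `𝒪_Y`, as a section of the sheaf of rings generated by functions and
operators. -/
def onSec {V : Y.Opens} {W : X.Opens} (h : W ≤ pr ⁻¹ᵁ V) : S₀.ring V →+* A.subrings.ring W :=
  (A.on h).codRestrict (A.subrings.ring W) fun P => A.on_mem h P

lemma onSec_rres {V V' : Y.Opens} (h : V' ≤ V) {W W' : X.Opens} (h' : W' ≤ pr ⁻¹ᵁ V')
    (hW : W ≤ pr ⁻¹ᵁ V) (hW' : W' ≤ W) (P : S₀.ring V) :
    A.onSec h' (S₀.rres h P) = A.subrings.rres hW' (A.onSec hW P) :=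
  Subtype.ext (A.on_rres h h' P)

lemma onSec_mulSec {V : Y.Opens} {W : X.Opens} (h : W ≤ pr ⁻¹ᵁ V) (a : Γ(Y, V)) :
    A.onSec h (S₀.mulSec a) = A.subrings.mulSec (rs h (pr.app V a)) :=
  Subtype.ext (A.on_mulSec h a)

lemma onSec_mulSec_mul {V : Y.Opens} {W : X.Opens} (h : W ≤ pr ⁻¹ᵁ V) (a : Γ(Y, V))
    (P : S₀.ring V) : A.onSec h (S₀.mulSec a * P) =
      A.subrings.mulSec (rs h (pr.app V a)) * A.onSec h P := by
  rw [← onSec_mulSec]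
  exact (A.onSec h).map_mul _ _

/-- The map from the operators to the endomorphisms of `𝒪_X`, as a morphism of modules. -/
noncomputable def toPushforward :
    S₀.leftModule ⟶ (Scheme.Modules.pushforward pr).obj A.subrings.leftModule :=
  modulesHom (M := S₀.leftModule) (N := (Scheme.Modules.pushforward pr).obj A.subrings.leftModule)
    (fun V => (A.subrings.toModule (pr ⁻¹ᵁ V)).toAddMonoidHom.comp
      ((A.onSec le_rfl).toAddMonoidHom.comp (S₀.toModule V).symm.toAddMonoidHom))
    (fun h P => congrArg (A.subrings.toModule _) (A.onSec_rres h le_rfl le_rfl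
      (pr.preimage_mono h) ((S₀.toModule _).symm P)))
    (fun {V} a P => congrArg (A.subrings.toModule _) ((A.onSec_mulSec_mul le_rfl a
      ((S₀.toModule _).symm P)).trans (by rw [rs_self]; rfl)))

/-- The map `s ⊗ P ↦ s ρ(P)`. -/
noncomputable def fromPullback :
    (Scheme.Modules.pullback pr).obj S₀.leftModule ⟶ A.subrings.leftModule :=
  ((Scheme.Modules.pullbackPushforwardAdjunction pr).homEquiv _ _).symm A.toPushforward

lemma homEquiv_fromPullback :
    (Scheme.Modules.pullbackPushforwardAdjunction pr).homEquiv _ _ A.fromPullback =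
      A.toPushforward :=
  Equiv.apply_symm_apply _ _

lemma fromPullback_tensorMap {V : Y.Opens} (P : S₀.ring V) :
    A.fromPullback.app (pr ⁻¹ᵁ V) ((tensorMap pr S₀).φ V P) =
      A.subrings.toModule (pr ⁻¹ᵁ V) (A.onSec le_rfl P) := by
  have h := congrArg (fun g => g.app V (S₀.toModule V P)) A.homEquiv_fromPullback
  rw [Adjunction.homEquiv_unit] at h
  exact h

variable (hF : ∀ x : X, ∃ V, Nonempty (A.Frame V x))

include hF

/-- By adjunction, an endomorphism of the pullback is determined by its effect on the sections `1 ⊗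
P`. -/
lemma fromPullback_extendLinear :
    A.fromPullback ≫ A.extendLinear (tensorMap pr S₀) hF = 𝟙 _ := by
  refine ((Scheme.Modules.pullbackPushforwardAdjunction pr).homEquiv _ _).injective ?_
  rw [Adjunction.homEquiv_naturality_right, homEquiv_fromPullback, Adjunction.homEquiv_id]
  refine Scheme.Modules.hom_ext _ _ fun V => ?_
  ext P
  refine (extendFun_eq hF (A.onSec le_rfl P) (.of_mem_graph (on_mem_graph
    (Φ := tensorMap pr S₀) (le_refl (pr ⁻¹ᵁ V)) P))).trans ?_
  exact mrs_self _ _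

omit hF in
lemma fromPullback_of_mem_graph {W : X.Opens} {T : endRing X W}
    {m : Γ((Scheme.Modules.pullback pr).obj S₀.leftModule, W)}
    (h : (T, m) ∈ A.graph (tensorMap pr S₀) W) :
    ((A.subrings.toModule W).symm (A.fromPullback.app W m)).1 = T := by
  refine graph_induction (C := fun T m =>
    ((A.subrings.toModule W).symm (A.fromPullback.app W m)).1 = T) ?_ ?_ ?_ h
  · exact congrArg (fun z => ((A.subrings.toModule W).symm z).1) (map_zero (A.fromPullback.app W).hom)
  · intro T T' m m' h h'
    exact (congrArg (fun z => ((A.subrings.toModule W).symm z).1)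
      (map_add (A.fromPullback.app W).hom m m')).trans (congrArg₂ (· + ·) h h')
  · intro V hV s Q
    rw [Scheme.Modules.Hom.app_smul]
    refine congrArg (mulOp W s * ·) ?_
    have e := (app_mrs A.fromPullback hV ((tensorMap pr S₀).φ V Q)).trans
      (congrArg (mrs _ hV) (A.fromPullback_tensorMap Q))
    exact congrArg (fun z => ((A.subrings.toModule W).symm z).1) e

/-- The other composite is checked locally on the graph, where `s ρ(P) ↦ s ⊗ P ↦ s ρ(P)`. -/
lemma extendLinear_fromPullback :
    A.extendLinear (tensorMap pr S₀) hF ≫ A.fromPullback = 𝟙 _ := by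
  refine Scheme.Modules.hom_ext _ _ fun U => ?_
  ext T
  refine mrs_ext (M := A.subrings.leftModule) fun x hx => ?_
  obtain ⟨W, hW, hxW, h⟩ := isImage_extendLinear hF ((A.subrings.toModule U).symm T) x hx
  refine ⟨W, hW, hxW, ?_⟩
  have e := A.fromPullback_of_mem_graph h
  refine (app_mrs A.fromPullback hW _).symm.trans ?_
  exact (A.subrings.toModule W).symm.injective (Subtype.ext e)

/-- The isomorphism `s ρ(P) ↦ s ⊗ P`. -/
noncomputable def pullbackIso :
    A.subrings.leftModule ≅ (Scheme.Modules.pullback pr).obj S₀.leftModule where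
  hom := A.extendLinear (tensorMap pr S₀) hF
  inv := A.fromPullback
  hom_inv_id := A.extendLinear_fromPullback hF
  inv_hom_id := A.fromPullback_extendLinear hF

lemma pullbackIso_on {V : Y.Opens} (P : S₀.ring V) :
    (A.pullbackIso hF).hom.app (pr ⁻¹ᵁ V)
      (A.subrings.toModule _ (A.onSec le_rfl P)) = (tensorMap pr S₀).φ V P := by
  refine (extendFun_eq hF (A.onSec le_rfl P) (.of_mem_graph (on_mem_graph
    (Φ := tensorMap pr S₀) (le_refl (pr ⁻¹ᵁ V)) P))).trans ?_
  exact mrs_self _ _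

end OperatorAction


/-! ### Operators of level `m` on a blow-up -/

section Level

variable {X Y : Scheme.{u}} {R : CommRingCat.{u}} {f : Y ⟶ Spec R} {ϖ : R} {p m k : ℕ} {pr : X ⟶ Y}

lemma onSections_rres {S₀ : LocalSubrings Y} (ρ : inverseImage pr S₀.sheaf ⟶ endSheaf X)
    {V V' : Y.Opens} (h : V' ≤ V) (P : S₀.ring V) :
    (onSections ρ V' (S₀.rres h P)).1 =
      endRing.res (pr.preimage_mono h) (onSections ρ V P).1 := by
  have e := (((TopCat.Sheaf.pullbackPushforwardAdjunction RingCat.{u} pr.base).homEquiv _ _ ρ).hom.naturality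
    (homOfLE h).op)
  exact congrArg Subtype.val (congr($e P))

/-- A compatible action, as an action of operators. -/
noncomputable def IsCompatibleAction.operatorAction
    {ρ : inverseImage pr (levelSheaf f ϖ p m k) ⟶ endSheaf X}
    (hρ : IsCompatibleAction f ϖ p m k pr ρ) : OperatorAction pr (levelSubrings f ϖ p m k) where
  σ V := ((endSubrings X).ring (pr ⁻¹ᵁ V)).subtype.comp (onSections ρ V)
  res h P := onSections_rres (S₀ := levelSubrings f ϖ p m k) ρ h P
  mul a := hρ.mul _ a

variable {ρ : inverseImage pr (levelSheaf f ϖ p m k) ⟶ endSheaf X}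
  (hρ : IsCompatibleAction f ϖ p m k pr ρ)

/-- The Leibniz formula for `s t` with `t` arbitrary is an identity of operators applied to `t`. -/
lemma IsCompatibleAction.on_mul_mulOp {V : Y.Opens} (c : Coordinates f V) (ν : Fin c.n → ℕ)
    {U : X.Opens} (h : U ≤ pr ⁻¹ᵁ V) (s : Γ(X, U)) :
    hρ.operatorAction.on h (c.levelSection ϖ p m k ν) * mulOp U s =
      ∑ μ ∈ Finset.Iic ν, (leibnizCoeff p m ν μ : endRing X U) *
        (mulOp U (evalOp (onSections ρ V (c.levelSection ϖ p m k μ)).1 h s) *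
          hρ.operatorAction.on h (c.levelSection ϖ p m k (ν - μ))) := by
  refine endRing_ext fun W hW t => ?_
  rw [evalOp_sum, evalOp_mul, evalOp_mulOp]
  refine (hρ.leibniz c ν (hW.trans h) (rs hW s) t).trans (Finset.sum_congr rfl fun μ _ => ?_)
  rw [evalOp_mul, evalOp_natCast, evalOp_mul, evalOp_mulOp, evalOp_rs _ h hW]
  rfl

/-- The operators `ϖ^{k|ν|} ∂^⟨ν⟩` are a basis of the operators on which there are coordinates. -/
noncomputable def IsCompatibleAction.frameOfCoordinates [Flat f] [IsDomain R] [CharZero R]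
    [Fact p.Prime] (hR : ∀ ν : ℕ, ¬ p ∣ ν → IsUnit (ν : R))
    (h0 : ∀ {U : X.Opens} {ν : ℕ}, ν ≠ 0 → ∀ s : Γ(X, U), (ν : Γ(X, U)) * s = 0 → s = 0)
    (hϖ : ∀ {U : X.Opens} (s : Γ(X, U)), const (pr ≫ f) U ϖ * s = 0 → s = 0) {V : Y.Opens}
    (c : Coordinates f V) {x : X} (hx : pr x ∈ V) : hρ.operatorAction.Frame V x where
  κ := Fin c.n → ℕ
  B ν := c.levelSection ϖ p m k ν
  mem := hx
  span Q hxV' := by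
    obtain ⟨W, hW, hxW, hQ⟩ := Q.2 _ hxV'
    exact ⟨W ⊓ V, inf_le_left.trans hW, inf_le_right, ⟨hxW, hx⟩,
      c.closure_generators_le ϖ p m k inf_le_right hR
        (res_mem_closure f ϖ p m k inf_le_left hQ)⟩
  one := c.closure_generators_le ϖ p m k le_rfl hR (one_mem _)
  mul i j := c.closure_generators_le ϖ p m k le_rfl hR
    (mul_mem (Subring.subset_closure (Or.inr ⟨V, le_rfl, c, i, rfl⟩))
      (Subring.subset_closure (Or.inr ⟨V, le_rfl, c, j, rfl⟩)))
  comm {W} h ν s := by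
    rw [hρ.on_mul_mulOp]
    refine sum_mem fun μ _ => ?_
    rw [← map_natCast (mulOp W)]
    exact mul_mem_range_lcomb_of_mem _ _ _ (mul_mem_range_lcomb _ _ _ _)
  inj {W} h := by
    rw [injective_iff_map_eq_zero]
    intro b hb
    -- Linear independence on `X` is tested on functions pulled back from `Y`, where by linearity
    -- the action is the original one.
    refine c.eq_zero_of_sum_op_eq_zero ϖ p m k le_rfl ((rs h).comp (pr.app V).hom)
      (fun ν hν => h0 hν) (fun s hs => hϖ s ?_) b fun a => ?_
    · rw [← hs, RingHom.comp_apply]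
      change _ = rs h (pr.app V _) * s
      rw [app_const, rs_const]
    · have e := congrArg (fun P => evalOp P le_rfl (rs h (pr.app V a))) hb
      rw [lcomb_apply, Finsupp.sum] at e
      refine Eq.trans ?_ e
      rw [evalOp_sum]
      refine Finset.sum_congr rfl fun ν _ => ?_
      rw [evalOp_mul, evalOp_mulOp, rs_self]
      refine congrArg (b ν * ·) ?_
      have e2 := hρ.linear V (c.levelSection ϖ p m k ν) le_rfl a
      refine (congrArg (rs h) e2.symm).trans ?_
      exact (evalOp_rs (onSections ρ V (c.levelSection ϖ p m k ν)).1 le_rfl h _).symm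

lemma mem_range_lcomb_one {A E : Type*} [CommRing A] [Ring E] (μ : A →+* E) {B : Unit → E}
    (hB : B () = 1) (s : A) : μ s ∈ (lcomb μ B).range := by
  have h := mul_mem_range_lcomb μ B () s
  rwa [hB, mul_one] at h

lemma injective_lcomb_one {A E : Type*} [CommRing A] [Ring E] {μ : A →+* E}
    (hμ : Function.Injective μ) {B : Unit → E} (hB : B () = 1) :
    Function.Injective (lcomb μ B) := by
  have e : ∀ b, lcomb μ B b = μ (b ()) := fun b => by
    rw [Finsupp.unique_single b, lcomb_single, hB, mul_one, Finsupp.single_eq_same]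
  intro b b' hb
  rw [e, e] at hb
  exact Finsupp.unique_ext (hμ hb)

/-- If there are no coordinates near the image of `x`, then all operators are functions near `x`. -/
noncomputable def IsCompatibleAction.frameOfIsEmpty {x : X}
    (hx : ∀ V : Y.Opens, pr x ∈ V → IsEmpty (Coordinates f V)) :
    hρ.operatorAction.Frame ⊤ x where
  κ := Unit
  B _ := 1
  mem := trivial
  span Q hxV' := by
    obtain ⟨W, hW, hxW, hQ⟩ := Q.2 _ hxV'
    refine ⟨W, hW, le_top, hxW, ?_⟩
    have hle : Subring.closure (generators f ϖ p m k W) ≤ (mulOp W).range := by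
      rw [Subring.closure_le]
      rintro Q (⟨a, rfl⟩ | ⟨U, hU, c, ν, rfl⟩)
      · exact ⟨a, rfl⟩
      · exact ((hx U (hU hxW)).false c).elim
    obtain ⟨a, ha⟩ := hle hQ
    rw [← ha]
    exact mem_range_lcomb_one (mulOp W) rfl a
  one := by
    have h := mem_range_lcomb_one (mulOp (⊤ : Y.Opens)) (B := fun _ => 1) rfl 1
    rwa [RingHom.map_one] at h
  mul _ _ := by
    have h := mem_range_lcomb_one (mulOp (⊤ : Y.Opens)) (B := fun _ => 1) rfl 1
    rwa [RingHom.map_one] at h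
  comm {W} h _ s := by
    have e := (hρ.operatorAction.on h).map_one
    have h1 : hρ.operatorAction.on h 1 * mulOp W s = mulOp W s :=
      (congrArg (· * mulOp W s) e).trans (one_mul _)
    exact h1.symm ▸ mem_range_lcomb_one (mulOp W) (B := fun _ => hρ.operatorAction.on h 1) e s
  inj {W} h := injective_lcomb_one mulOp_injective (hρ.operatorAction.on h).map_one

/-- Either there are coordinates near the image of `x`, or the operators are just functions there
and `1` is a basis. No existence theorem for coordinates enters. -/
lemma IsCompatibleAction.exists_frame [Flat f] [IsDomain R] [CharZero R]
    [Fact p.Prime] (hR : ∀ ν : ℕ, ¬ p ∣ ν → IsUnit (ν : R))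
    (h0 : ∀ {U : X.Opens} {ν : ℕ}, ν ≠ 0 → ∀ s : Γ(X, U), (ν : Γ(X, U)) * s = 0 → s = 0)
    (hϖ : ∀ {U : X.Opens} (s : Γ(X, U)), const (pr ≫ f) U ϖ * s = 0 → s = 0) (x : X) :
    ∃ V, Nonempty (hρ.operatorAction.Frame V x) := by
  by_cases h : ∀ V : Y.Opens, pr x ∈ V → IsEmpty (Coordinates f V)
  · exact ⟨_, ⟨hρ.frameOfIsEmpty h⟩⟩
  · push Not at h
    obtain ⟨V, hxV, ⟨c⟩⟩ := h
    exact ⟨V, ⟨hρ.frameOfCoordinates hR h0 hϖ c hxV⟩⟩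

/-- The ring homomorphism `P ↦ 1 ⊗ P`. -/
noncomputable def OperatorAction.fromInverseImage {S₀ : LocalSubrings Y}
    (A : OperatorAction pr S₀) : inverseImage pr S₀.sheaf ⟶ A.subrings.sheaf :=
  ofSections
    { hom :=
        { app V := RingCat.ofHom (A.onSec (V := V.unop) le_rfl)
          naturality V V' i := by
            ext P
            exact A.onSec_rres i.unop.le le_rfl le_rfl (pr.preimage_mono i.unop.le) P } }

lemma OperatorAction.onSections_fromInverseImage {S₀ : LocalSubrings Y}
    (A : OperatorAction pr S₀) (V : Y.Opens) (P : S₀.ring V) :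
    onSections A.fromInverseImage V P = A.onSec le_rfl P :=
  congrArg (fun g : S₀.ring V →+* A.subrings.ring (pr ⁻¹ᵁ V) => g P) (onSections_ofSections _ V)

lemma IsCompatibleAction.onSec_mul_mulSec {V : Y.Opens} (c : Coordinates f V)
    (ν : Fin c.n → ℕ) {U : X.Opens} (h : U ≤ pr ⁻¹ᵁ V) (s : Γ(X, U)) :
    hρ.operatorAction.onSec h (c.levelSection ϖ p m k ν) *
        hρ.operatorAction.subrings.mulSec s =
      ∑ μ ∈ Finset.Iic ν, (leibnizCoeff p m ν μ : hρ.operatorAction.subrings.ring U) *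
        (hρ.operatorAction.subrings.mulSec
            (evalOp (onSections ρ V (c.levelSection ϖ p m k μ)).1 h s) *
          hρ.operatorAction.onSec h (c.levelSection ϖ p m k (ν - μ))) := by
  refine Subtype.ext ((hρ.on_mul_mulOp c ν h s).trans ?_)
  rw [AddSubmonoidClass.coe_finsetSum]
  rfl

/-- The structure of sheaf of rings on `pr^* 𝒟̃^{(m)}`. -/
noncomputable def IsCompatibleAction.pullbackRingStructure
    (hF : ∀ x : X, ∃ V, Nonempty (hρ.operatorAction.Frame V x)) : PullbackRingStructure ρ where
  ring := hρ.operatorAction.subrings.sheaf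
  iso := (Scheme.Modules.toPresheaf X).mapIso (hρ.operatorAction.pullbackIso hF)
  left := hρ.operatorAction.subrings.mulHom
  right := hρ.operatorAction.fromInverseImage
  left_mul U s r := Scheme.Modules.Hom.app_smul (hρ.operatorAction.pullbackIso hF).hom s
    (hρ.operatorAction.subrings.toModule U r)
  right_eq V P :=
    (congrArg (fun z => (hρ.operatorAction.pullbackIso hF).hom.app (pr ⁻¹ᵁ V)
      (hρ.operatorAction.subrings.toModule _ z))
      (hρ.operatorAction.onSections_fromInverseImage V P)).trans
    (hρ.operatorAction.pullbackIso_on hF P)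
  commutation {V} c ν U h s := by
    have e := fun P => congrArg (hρ.operatorAction.subrings.rres h)
      (hρ.operatorAction.onSections_fromInverseImage V P)
    refine (congrArg (· * hρ.operatorAction.subrings.mulSec s) (e _)).trans
      ((hρ.onSec_mul_mulSec c ν h s).trans (Finset.sum_congr rfl fun μ _ => ?_))
    exact (congrArg (fun z => (leibnizCoeff p m ν μ : hρ.operatorAction.subrings.ring U) *
        (hρ.operatorAction.subrings.mulSec
            (evalOp (onSections ρ V (c.levelSection ϖ p m k μ)).1 h s) * z)) (e _)).symm

end Level

/-- The two structures on a blow-up, over an arbitrary domain of characteristic zero in which the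
integers prime to `p` are invertible. -/
theorem IsBlowup.exists_action {X Y : Scheme.{u}} {R : CommRingCat.{u}} [IsDomain R] [CharZero R]
    {p : ℕ} [Fact p.Prime] (hR : ∀ ν : ℕ, ¬ p ∣ ν → IsUnit (ν : R)) {f : Y ⟶ Spec R} [Flat f]
    {pr : X ⟶ Y} {I : Y.IdealSheafData} (hpr : IsBlowup pr I) {ϖ : R} (hϖ : ϖ ≠ 0) {N : ℕ}
    (hI : ∀ U : Y.affineOpens, const f U.1 (ϖ ^ N) ∈ I.ideal U) (m : ℕ) {k : ℕ} (hk : N ≤ k) :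
    ∃ ρ : inverseImage pr (levelSheaf f ϖ p m k) ⟶ endSheaf X,
      IsCompatibleAction f ϖ p m k pr ρ ∧ Nonempty (PullbackRingStructure ρ) := by
  have hZ := hpr.isModification f hϖ hI
  have hE : ∀ {V : Y.Opens} {P : endRing Y V}, P ∈ (levelSubrings f ϖ p m k).ring V →
      Extends pr _ P := fun hP => extends_of_mem_levelSubrings hpr hZ hϖ hI p m hk hP
  have hρ := isCompatibleAction_extendAction hZ hE
  exact ⟨_, hρ, ⟨hρ.pullbackRingStructure (hρ.exists_frame hR
    (fun hν _ => hpr.eq_zero_of_natCast_mul f hν) fun _ => hpr.eq_zero_of_const_mul f hϖ)⟩⟩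

lemma isUnit_natCast_of_not_dvd {p : ℕ} [Fact p.Prime] (A : Type*) [CommRing A] [Algebra ℤ_[p] A]
    {n : ℕ} (hn : ¬ p ∣ n) : IsUnit (n : A) := by
  have h : IsUnit (n : ℤ_[p]) := by
    rw [PadicInt.isUnit_iff, PadicInt.norm_natCast_eq_one_iff]
    exact (Nat.Prime.coprime_iff_not_dvd Fact.out).2 hn
  have h' := h.map (algebraMap ℤ_[p] A)
  rwa [map_natCast] at h'

end ArithDiff

theorem mainTheorem9 (p : ℕ) [Fact p.Prime] {L : Type u} [Field L] [Algebra ℚ_[p] L]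
    [FiniteDimensional ℚ_[p] L] [Algebra ℤ_[p] L] [IsScalarTower ℤ_[p] ℚ_[p] L]
    (ϖ : integralClosure ℤ_[p] L) (hϖ : Irreducible ϖ)
    {X X₀ : Scheme.{u}} (f : X₀ ⟶ Spec (.of (integralClosure ℤ_[p] L))) [Smooth f]
    (I : X₀.IdealSheafData) (N : ℕ)
    (hI : ∀ U : X₀.affineOpens, ArithDiff.const f U.1 (ϖ ^ N) ∈ I.ideal U)
    (pr : X ⟶ X₀) (hpr : ArithDiff.IsBlowup pr I) (m k : ℕ) (hk : N ≤ k) :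
    ∃ ρ : ArithDiff.inverseImage pr (ArithDiff.levelSheaf f ϖ p m k) ⟶ ArithDiff.endSheaf X,
      ArithDiff.IsCompatibleAction f ϖ p m k pr ρ ∧
        Nonempty (ArithDiff.PullbackRingStructure ρ) := by
  have : CharZero L := charZero_of_injective_algebraMap (algebraMap ℚ_[p] L).injective
  have : CharZero (integralClosure ℤ_[p] L) :=
    charZero_of_injective_algebraMap (R := ℤ) fun a b h => by
      have h' := congrArg (Subtype.val : integralClosure ℤ_[p] L → L) h
      simpa using h'
  have : CharZero (CommRingCat.of (integralClosure ℤ_[p] L)) := this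
  have : IsDomain (CommRingCat.of (integralClosure ℤ_[p] L)) :=
    inferInstanceAs (IsDomain (integralClosure ℤ_[p] L))
  -- Smoothness enters through flatness, and integers prime to `p` are units because they already
  -- are in `ℤ_p`.
  exact ArithDiff.IsBlowup.exists_action
    (fun _ hν => ArithDiff.isUnit_natCast_of_not_dvd (integralClosure ℤ_[p] L) hν) hpr hϖ.ne_zero
    hI m hk
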